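/- **Setting (direct incentives).** A principal and an agent interact for $T$ rounds. In round $t$ a set of actions $\mathcal A_t$ is available and is observed by the principal. The principal posts a payment rule $x_t:\mathcal A_t\to\mathbb R_{\ge 0}$, computed by a (possibly randomized) measurable policy from $\mathcal A_1,\dots,\mathcal A_t$ and from the actions and noisy rewards of the earlier rounds. The agent takes an action $a_t\in\arg\max_{a\in\mathcal A_t}\,[x_t(a)-c(a)]$, where $c$ is his cost function; the principal observes $a_t$ and the noisy reward $r(a_t)+\epsilon_t$ and pays $x_t(a_t)$. The functions $r,c$ and the law of the noise are unknown to the principal. The noise $\epsilon_1,\epsilon_2,\dots$ is i.i.d., centered and $\sigma$-sub-Gaussian ($\mathbf E e^{s\epsilon_t}\le e^{\sigma^2s^2/2}$ for all $s\in\mathbb R$) with a known $\sigma>0$. The regret is $$\mathrm{Reg}(T)=\sum_{t=1}^T\Big(\max_{a\in\mathcal A_t}[r(a)-c(a)]-[r(a_t)-x_t(a_t)]\Big).$$ * *Multi-armed bandits with $N$ arms:* $\mathcal A_t=\{1,\dots,N\}$ for all $t$, and $r,c:\{1,\dots,N\}\to[0,1]$ are arbitrary. * *Linear bandits in dimension $d$:*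 each $\mathcal A_t\subset\mathbb R^d$ is a nonempty compact (possibly infinite) set, the sequence $(\mathcal A_t)$ is arbitrary, $r(a)=a^\top\theta$ and $c(a)=a^\top\gamma$ with $\|\theta\|,\|\gamma\|\le1$, and $\|a\|\le\sqrt d$, $r(a),c(a)\in[0,1]$ for all $a\in\mathcal A_t$ and all $t$. **Theorem.** Multi-armed bandits and linear bandits under direct incentives have minimax expected regret $\tilde\Theta(\sqrt T)$. That is, there is a $k\in\mathbb N$ such that: 1. (Upper bounds.) For all $N\ge1$ and $\sigma>0$ there is a constant $C=C(N,\sigma)$ such that for every $T\ge1$ the principal has a policy which, in every $N$-armed bandit with $\sigma$-sub-Gaussian noise, satisfies $\mathbf E[\mathrm{Reg}(T)]\le C\sqrt T\,(1+\log T)^k$. Likewise, for all $d\ge1$ and $\sigma>0$ there is $C=C(d,\sigma)$ such that for every $T\ge1$ the principal has a policy which, in every $d$-dimensional linear bandit with $\sigma$-sub-Gaussian noise, satisfies $\mathbf E[\mathrm{Reg}(T)]\le C\sqrt T\,(1+\log T)^k$. 2. (Lower bounds.) For all $N\ge2$ and $\sigma>0$ there is a constant $c_0=c_0(N,\sigma)>0$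 such that for every $T\ge1$ and every policy there is an $N$-armed bandit with $\sigma$-sub-Gaussian noise in which $\mathbf E[\mathrm{Reg}(T)]\ge c_0\sqrt T$. Likewise, for all $d\ge1$ and $\sigma>0$ there is $c_0=c_0(d,\sigma)>0$ such that for every $T\ge1$ and every policy there is a $d$-dimensional linear bandit with $\sigma$-sub-Gaussian noise in which $\mathbf E[\mathrm{Reg}(T)]\ge c_0\sqrt T$. In these instances a best-responding agent who breaks ties in favor of the principal exists (in the upper bounds: for the given policy and every instance; in the lower bounds: for the given policy and the hard instance), and the bounds hold for every best-responding agent whose choice in each round depends only on the posted contract and the round, however he breaks ties (subject to the actions being measurable). -/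

import Mathlib

open MeasureTheory ProbabilityTheory
open scoped NNReal

noncomputable section

/-- A bandit problem under direct incentives with actions in `α`: in round `t` (rounds are numbered
from `0`) the agent picks an action from `actionSet t`; an action `a` has mean reward `reward a`
for the principal and costs the agent `cost a`; the reward noise of the rounds is i.i.d. with law
`noise`. -/
structure Environment (α : Type) where
  actionSet : ℕ → Set α
  reward : α → ℝ
  cost : α → ℝ
  noise : Measure ℝ

/-- A (possibly randomized) learning algorithm of the principal. The contract of round `t` is a
payment rule `α → ℝ≥0`, contingent on the agent's action. It is computed from the action sets of
the rounds `0, …, t`, a private random seed, and the actions and noisy rewards observed in the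
rounds `0, …, t - 1`. -/
structure Policy (α : Type) [MeasurableSpace α] where
  seedLaw : Measure ℝ
  isProbabilityMeasure_seedLaw : IsProbabilityMeasure seedLaw
  contract : (t : ℕ) → (Fin (t + 1) → Set α) → ℝ → (Fin t → α × ℝ) → α → ℝ≥0
  measurable_contract : ∀ (t : ℕ) (S : Fin (t + 1) → Set α),
    Measurable fun p : (ℝ × (Fin t → α × ℝ)) × α => contract t S p.1.1 p.1.2 p.2

/-- The actions in `S` that maximize the agent's utility, payment minus cost. -/
def bestResponses {α : Type} (S : Set α) (c : α → ℝ) (x : α → ℝ≥0) : Set α :=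
  {a | a ∈ S ∧ ∀ b ∈ S, (x b : ℝ) - c b ≤ (x a : ℝ) - c a}

/-- The agent of round `t` only reacts to the contract posted in round `t`. -/
abbrev Agent (α : Type) : Type := ℕ → (α → ℝ≥0) → α

namespace Policy

variable {α : Type} [MeasurableSpace α]

/-- Actions and noisy rewards of the first `t` rounds, when the principal's seed is `ω.1` and the
noise of round `s` is `ω.2 s`. -/
def history (π : Policy α) (E : Environment α) (ag : Agent α) (ω : ℝ × (ℕ → ℝ)) :
    (t : ℕ) → Fin t → α × ℝ
  | 0 => Fin.elim0
  | t + 1 =>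
    let h := history π E ag ω t
    let a := ag t (π.contract t (fun s => E.actionSet s) ω.1 h)
    Fin.snoc (α := fun _ => α × ℝ) h (a, E.reward a + ω.2 t)

/-- The contract posted in round `t`. -/
def posted (π : Policy α) (E : Environment α) (ag : Agent α) (t : ℕ) (ω : ℝ × (ℕ → ℝ)) :
    α → ℝ≥0 :=
  π.contract t (fun s => E.actionSet s) ω.1 (π.history E ag ω t)

/-- The agent's action in round `t`. -/
def action (π : Policy α) (E : Environment α) (ag : Agent α) (t : ℕ) (ω : ℝ × (ℕ → ℝ)) : α :=
  ag t (π.posted E ag t ω)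

/-- The joint law of the seed and the noise sequence: the seed is independent of the noise, and
the noise is i.i.d. -/
def law (π : Policy α) (E : Environment α) : Measure (ℝ × (ℕ → ℝ)) :=
  π.seedLaw.prod (Measure.infinitePi fun _ : ℕ => E.noise)

/-- The regret of the first `T` rounds: the benchmark in a round is the largest reward minus cost
over the available actions; the principal gets the reward minus the payment of the action taken. -/
def regret (π : Policy α) (E : Environment α) (ag : Agent α) (T : ℕ) (ω : ℝ × (ℕ → ℝ)) : ℝ :=
  ∑ t ∈ Finset.range T,
    ((⨆ a : E.actionSet t, (E.reward a - E.cost a)) -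
      (E.reward (π.action E ag t ω) - (π.posted E ag t ω (π.action E ag t ω) : ℝ)))

/-- In every round the agent takes an action that maximizes his utility under the posted contract
(ties may be broken in any way for which the actions are random variables). -/
structure IsBestResponding (π : Policy α) (E : Environment α) (ag : Agent α) : Prop where
  mem_bestResponses : ∀ (t : ℕ) (ω : ℝ × (ℕ → ℝ)),
    π.action E ag t ω ∈ bestResponses (E.actionSet t) E.cost (π.posted E ag t ω)
  measurable_action : ∀ t : ℕ, Measurable (π.action E ag t)

/-- Among his best responses the agent takes one that is best for the principal. -/
def TiesFavorPrincipal (π : Policy α) (E : Environment α) (ag : Agent α) : Prop :=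
  ∀ (t : ℕ) (ω : ℝ × (ℕ → ℝ)),
    ∀ b ∈ bestResponses (E.actionSet t) E.cost (π.posted E ag t ω),
      E.reward b - (π.posted E ag t ω b : ℝ) ≤
        E.reward (π.action E ag t ω) - (π.posted E ag t ω (π.action E ag t ω) : ℝ)

/-- The policy can be run against a best-responding agent who breaks ties in favor of the
principal, and against every best-responding agent, however he breaks ties, its expected regret
after `T` rounds is finite and at most `B`. -/
def ExpectedRegretLE (π : Policy α) (E : Environment α) (T : ℕ) (B : ℝ) : Prop :=
  (∃ ag : Agent α, π.IsBestResponding E ag ∧ π.TiesFavorPrincipal E ag) ∧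
  ∀ ag : Agent α, π.IsBestResponding E ag →
    Integrable (π.regret E ag T) (π.law E) ∧ ∫ ω, π.regret E ag T ω ∂(π.law E) ≤ B

/-- The policy can be run against a best-responding agent who breaks ties in favor of the
principal, and against every best-responding agent, however he breaks ties, its expected regret
after `T` rounds is at least `B`. With bounded mean rewards and costs the regret is bounded below,
so that a regret that is not integrable has expectation `+∞`. -/
def ExpectedRegretGE (π : Policy α) (E : Environment α) (T : ℕ) (B : ℝ) : Prop :=
  (∃ ag : Agent α, π.IsBestResponding E ag ∧ π.TiesFavorPrincipal E ag) ∧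
  ∀ ag : Agent α, π.IsBestResponding E ag →
    Integrable (π.regret E ag T) (π.law E) → B ≤ ∫ ω, π.regret E ag T ω ∂(π.law E)

end Policy

/-- `ν` is a centered `σ`-sub-Gaussian probability law: `E exp (s X) ≤ exp (σ² s² / 2)` for
all real `s`. -/
structure IsSubgaussianNoise (σ : ℝ≥0) (ν : Measure ℝ) : Prop where
  isProbabilityMeasure : IsProbabilityMeasure ν
  centered : ∫ z, z ∂ν = 0
  subgaussian : HasSubgaussianMGF (fun z : ℝ => z) (σ ^ 2) ν

/-- Multi-armed bandits under direct incentives: `N` arms, all of them available in each round. -/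
structure IsMultiArmedBandit (N : ℕ) (σ : ℝ≥0) (E : Environment (Fin N)) : Prop where
  actionSet_eq : ∀ t, E.actionSet t = Set.univ
  reward_mem : ∀ i, E.reward i ∈ Set.Icc (0 : ℝ) 1
  cost_mem : ∀ i, E.cost i ∈ Set.Icc (0 : ℝ) 1
  noise : IsSubgaussianNoise σ E.noise

/-- Linear bandits under direct incentives: mean reward and cost are linear in the action, and an
arbitrary, possibly infinite set of actions (contexts) is available in each round. -/
structure IsLinearBandit (d : ℕ) (σ : ℝ≥0) (E : Environment (EuclideanSpace ℝ (Fin d))) :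
    Prop where
  exists_parameters : ∃ θ γ : EuclideanSpace ℝ (Fin d), ‖θ‖ ≤ 1 ∧ ‖γ‖ ≤ 1 ∧
    (E.reward = fun a => inner ℝ a θ) ∧ (E.cost = fun a => inner ℝ a γ)
  nonempty : ∀ t, (E.actionSet t).Nonempty
  isCompact : ∀ t, IsCompact (E.actionSet t)
  norm_le : ∀ t, ∀ a ∈ E.actionSet t, ‖a‖ ≤ √(d : ℝ)
  reward_mem : ∀ t, ∀ a ∈ E.actionSet t, E.reward a ∈ Set.Icc (0 : ℝ) 1
  cost_mem : ∀ t, ∀ a ∈ E.actionSet t, E.cost a ∈ Set.Icc (0 : ℝ) 1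
  noise : IsSubgaussianNoise σ E.noise

end

/-! Upper bounds. Both classes are bandits linear in a feature map, so one policy serves both. It
keeps a ridge regression for the reward parameter `θ` and, separately, an ellipsoid that contains
the cost parameter `γ`. It pays for a single target action, chosen optimistically in both respects.
The payment is the estimated cost gap between the target and the action that looks cheapest, plus a
small bonus.

The agent's reaction is noiseless information on `γ`. A refusal reveals that some action of the net
undercuts the target by more than estimated, which is a cut of the ellipsoid beyond its centre. An
acceptance shows that the gap was not underestimated by more than the bonus. If the ellipsoid is
still wide in the direction of the gap, this is a cut that misses the centre only slightly. Either
cut replaces the ellipsoid by one with smaller volume (`mem_ellipsoidUpdate`,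
`det_ellipsoidUpdate`). The determinant of its matrix thus grows geometrically with the number of
cuts while the trace grows only linearly, so there are `O(log T)` cuts (`Fits.cutCount_le`). Each
costs `O(1)`.

In a round without a cut the target is taken at almost the right price. By optimism its regret is at
most twice the confidence width of the reward plus `2 / √T` (`Fits.profit_le`). The widths sum to
`√T` up to logarithms by the elliptical potential lemma. Confidence comes from the method of
mixtures: `exp (‖N‖² / (2σ²)) / √det V`, with `N` the noise-weighted sum of features, `V` the design
matrix and the norm dual to that of `V`, has expectation at most one
(`Fits.lintegral_potential_le`).

Lower bounds. One action has reward `1/2 + δ` or `1/2`, with `δ` of order `1 / √T`, and a cost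
strictly in between. Since another action is free and payments are nonnegative, the regret is at
least the welfare loss (`le_round_regret`), so each wrong decision costs at least `δ / 3`. By
Cauchy–Schwarz for Gaussian likelihood ratios, `T` rounds do not separate the two worlds
(`lintegral_history_sq_le`).

Ties need care, as the agent may break them differently in the two worlds. Only countably many cost
scales make a tie possible with positive probability. For any other scale all best-responding agents
agree almost surely with one fixed agent (`ae_action_eq`). -/

/-! ### Measurable choice from a finite set -/

/-- An element of the finite set `S` satisfying `p`, if there is one. -/
noncomputable def chooseIn {α : Type} [Nonempty α] (S : Finset α) (p : α → Prop) : α :=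
  Classical.epsilon fun a => a ∈ S ∧ p a

theorem chooseIn_spec {α : Type} [Nonempty α] {S : Finset α} {p : α → Prop}
    (h : ∃ a ∈ S, p a) : chooseIn S p ∈ S ∧ p (chooseIn S p) :=
  Classical.epsilon_spec (p := fun a => a ∈ S ∧ p a) h

/-- The choice factors through the truth values of `p` on `S`, which form a finite discrete space,
so no structure on `α` is needed. -/
theorem measurable_chooseIn {α Ω : Type} [Nonempty α] [MeasurableSpace α] [MeasurableSpace Ω]
    (S : Finset α) {p : Ω → α → Prop} (hp : ∀ a ∈ S, MeasurableSet {ω | p ω a}) :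
    Measurable fun ω => chooseIn S (p ω) := by
  have h : (fun ω => chooseIn S (p ω)) =
      (fun q : S → Prop => Classical.epsilon fun a => ∃ h : a ∈ S, q ⟨a, h⟩) ∘
        (fun ω (a : S) => p ω a) := by
    funext ω
    simp only [Function.comp, chooseIn]
    congr 1
    funext a
    simp
  rw [h]
  refine Measurable.comp (measurable_of_countable _) (measurable_pi_lambda _ fun a => ?_)
  exact measurable_to_prop (by simpa [Set.preimage, Set.mem_singleton_iff] using hp a a.2)

/-! ### Resampling one coordinate of an i.i.d. sequence -/

/-- A product measure is determined by finite boxes, and the preimage of a box is again a box with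
the side at `t` moved to the fresh variable. -/
theorem map_update_infinitePi (ν : Measure ℝ) [IsProbabilityMeasure ν] (t : ℕ) :
    ((Measure.infinitePi fun _ : ℕ => ν).prod ν).map (fun p => Function.update p.1 t p.2) =
      Measure.infinitePi fun _ : ℕ => ν := by
  have hm : Measurable fun p : (ℕ → ℝ) × ℝ => Function.update p.1 t p.2 := by
    refine measurable_pi_lambda _ fun i => ?_
    by_cases h : i = t
    · subst h; simpa using measurable_snd
    · simp only [Function.update_of_ne h]
      fun_prop
  refine Measure.eq_infinitePi _ fun s u hu => ?_
  rw [Measure.map_apply hm (MeasurableSet.pi s.countable_toSet fun i _ => hu i)]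
  by_cases hts : t ∈ s
  · have : (fun p : (ℕ → ℝ) × ℝ => Function.update p.1 t p.2) ⁻¹' (Set.pi s u) =
        (Set.pi (s.erase t : Finset ℕ) u) ×ˢ (u t) := by
      ext ⟨x, z⟩
      simp only [Set.mem_preimage, Set.mem_pi, Set.mem_prod, Finset.mem_coe, Finset.mem_erase]
      constructor
      · intro h
        refine ⟨fun i hi => ?_, by simpa using h t hts⟩
        simpa [Function.update_of_ne hi.1] using h i hi.2
      · rintro ⟨h, hz⟩ i hi
        by_cases hit : i = t
        · subst hit; simpa using hz
        · simpa [Function.update_of_ne hit] using h i ⟨hit, hi⟩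
    rw [this, Measure.prod_prod, Measure.infinitePi_pi _ (fun i _ => hu i),
      Finset.prod_erase_mul _ _ hts]
  · have : (fun p : (ℕ → ℝ) × ℝ => Function.update p.1 t p.2) ⁻¹' (Set.pi s u) =
        (Set.pi s u) ×ˢ Set.univ := by
      ext ⟨x, z⟩
      simp only [Set.mem_preimage, Set.mem_pi, Set.mem_prod, Finset.mem_coe, Set.mem_univ, and_true]
      refine forall₂_congr fun i hi => ?_
      rw [Function.update_of_ne (by rintro rfl; exact hts hi)]
    rw [this, Measure.prod_prod, Measure.infinitePi_pi _ (fun i _ => hu i)]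
    simp

/-- Replace the noise of round `t`. -/
def resample (t : ℕ) (ω : ℝ × (ℕ → ℝ)) (z : ℝ) : ℝ × (ℕ → ℝ) := (ω.1, Function.update ω.2 t z)

theorem measurable_resample (t : ℕ) :
    Measurable fun p : (ℝ × (ℕ → ℝ)) × ℝ => resample t p.1 p.2 := by
  refine Measurable.prodMk (by fun_prop) (measurable_pi_lambda _ fun i => ?_)
  by_cases h : i = t
  · subst h; simpa using measurable_snd
  · simp only [Function.update_of_ne h]
    fun_prop

/-- This replaces conditioning on the past. Whatever happens up to the action of round `t` ignores
the noise of round `t`, so the inner integral averages over that noise alone. -/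
theorem lintegral_resample (μ : Measure ℝ) [SFinite μ] (ν : Measure ℝ) [IsProbabilityMeasure ν]
    (t : ℕ) {G : ℝ × (ℕ → ℝ) → ENNReal} (hG : Measurable G) :
    ∫⁻ ω, G ω ∂(μ.prod (Measure.infinitePi fun _ : ℕ => ν)) =
      ∫⁻ ω, ∫⁻ z, G (resample t ω z) ∂ν ∂(μ.prod (Measure.infinitePi fun _ : ℕ => ν)) := by
  have hm : Measurable fun p : (ℕ → ℝ) × ℝ => Function.update p.1 t p.2 := by
    have := measurable_snd.comp ((measurable_resample t).comp
      (f := fun p : (ℕ → ℝ) × ℝ => (((0 : ℝ), p.1), p.2)) (by fun_prop))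
    exact this
  rw [lintegral_prod _ hG.aemeasurable, lintegral_prod (fun ω => ∫⁻ z, G (resample t ω z) ∂ν)
    (Measurable.aemeasurable (hG.comp (measurable_resample t)).lintegral_prod_right')]
  refine lintegral_congr fun x => ?_
  conv_lhs => rw [← map_update_infinitePi ν t]
  have hG' : Measurable fun y => G (x, y) := hG.comp (by fun_prop)
  rw [lintegral_map hG' hm]
  exact lintegral_prod _ (hG'.comp hm).aemeasurable

/-! ### Exponential moments of quadratic functions of sub-Gaussian noise -/

theorem lintegral_exp_mul_le {σ : ℝ≥0} {ν : Measure ℝ} (h : IsSubgaussianNoise σ ν) (s : ℝ) :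
    ∫⁻ x, ENNReal.ofReal (Real.exp (s * x)) ∂ν ≤
      ENNReal.ofReal (Real.exp (σ ^ 2 * s ^ 2 / 2)) := by
  rw [← ofReal_integral_eq_lintegral_ofReal (h.subgaussian.integrable_exp_mul s)
    (Filter.Eventually.of_forall fun x => (Real.exp_pos _).le)]
  exact ENNReal.ofReal_le_ofReal (by simpa [mgf] using h.subgaussian.mgf_le s)

theorem lintegral_exp_mul_gaussianReal (b : ℝ) :
    ∫⁻ g, ENNReal.ofReal (Real.exp (b * g)) ∂(gaussianReal 0 1) =
      ENNReal.ofReal (Real.exp (b ^ 2 / 2)) := by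
  rw [← ofReal_integral_eq_lintegral_ofReal (integrable_exp_mul_gaussianReal b)
    (Filter.Eventually.of_forall fun x => (Real.exp_pos _).le)]
  have := congrFun (mgf_id_gaussianReal (μ := 0) (v := 1)) b
  simp only [mgf, id] at this
  rw [this]; simp

/-- Completing the square turns the integrand times the standard Gaussian density into a constant
times the density with mean `α σ² b v` and variance `v`. -/
theorem lintegral_exp_quadratic_gaussianReal {σ α b v : ℝ} (hv : 0 < v)
    (hb : b ^ 2 * σ ^ 2 = 1 - 1 / v) :
    ∫⁻ g, ENNReal.ofReal (Real.exp (σ ^ 2 * (α + b * g) ^ 2 / 2)) ∂(gaussianReal 0 1) =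
      ENNReal.ofReal (√v * Real.exp (α ^ 2 * σ ^ 2 * v / 2)) := by
  have hv' : v.toNNReal ≠ 0 := by simpa using hv
  rw [gaussianReal_of_var_ne_zero _ one_ne_zero,
    lintegral_withDensity_eq_lintegral_mul _ (measurable_gaussianPDF _ _) (by fun_prop)]
  calc _ = ∫⁻ g, ENNReal.ofReal (√v * Real.exp (α ^ 2 * σ ^ 2 * v / 2)) *
        gaussianPDF (α * σ ^ 2 * b * v) v.toNNReal g := by
        refine lintegral_congr fun g => ?_
        simp only [Pi.mul_apply, gaussianPDF]
        rw [← ENNReal.ofReal_mul (gaussianPDFReal_nonneg _ _ _),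
          ← ENNReal.ofReal_mul (by positivity)]
        congr 1
        simp only [gaussianPDFReal, NNReal.coe_one, Real.coe_toNNReal _ hv.le, mul_one, sub_zero]
        rw [Real.sqrt_mul' _ hv.le]
        have h1 : √v ≠ 0 := (Real.sqrt_pos.2 hv).ne'
        have h2 : √(2 * Real.pi) ≠ 0 := (Real.sqrt_pos.2 (by positivity)).ne'
        have e : -g ^ 2 / 2 + σ ^ 2 * (α + b * g) ^ 2 / 2 =
            α ^ 2 * σ ^ 2 * v / 2 + -(g - α * σ ^ 2 * b * v) ^ 2 / (2 * v) := by
          field_simp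
          field_simp at hb
          linear_combination (v * α ^ 2 * σ ^ 2 + g ^ 2) * hb
        field_simp
        rw [← Real.exp_add, ← Real.exp_add]
        congr 1
        ring_nf at e ⊢
        exact e
    _ = _ := by
      rw [lintegral_const_mul _ (measurable_gaussianPDF _ _), lintegral_gaussianPDF_eq_one _ hv',
        mul_one]

/-- An auxiliary Gaussian `g` linearises the square, as `exp (b² x² / 2)` is the average of `exp (b
g x)`. After exchanging the integrals only the sub-Gaussian bound for exponentials of linear
functions is needed. -/
theorem lintegral_exp_quadratic_le {σ : ℝ≥0} {ν : Measure ℝ} (h : IsSubgaussianNoise σ ν)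
    {α b v : ℝ} (hv : 0 < v) (hb : b ^ 2 * (σ : ℝ) ^ 2 = 1 - 1 / v) :
    ∫⁻ x, ENNReal.ofReal (Real.exp (α * x + b ^ 2 * x ^ 2 / 2)) ∂ν ≤
      ENNReal.ofReal (√v * Real.exp (α ^ 2 * σ ^ 2 * v / 2)) := by
  have := h.isProbabilityMeasure
  rw [← lintegral_exp_quadratic_gaussianReal hv hb]
  calc _ = ∫⁻ x, ∫⁻ g, ENNReal.ofReal (Real.exp ((α + b * g) * x)) ∂(gaussianReal 0 1) ∂ν := by
        refine lintegral_congr fun x => ?_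
        have : ∀ g : ℝ, ENNReal.ofReal (Real.exp ((α + b * g) * x)) =
            ENNReal.ofReal (Real.exp (α * x)) * ENNReal.ofReal (Real.exp ((b * x) * g)) := by
          intro g
          rw [← ENNReal.ofReal_mul (Real.exp_pos _).le, ← Real.exp_add]
          ring_nf
        simp_rw [this]
        rw [lintegral_const_mul _ (by fun_prop), lintegral_exp_mul_gaussianReal,
          ← ENNReal.ofReal_mul (Real.exp_pos _).le, ← Real.exp_add]
        ring_nf
    _ = ∫⁻ g, ∫⁻ x, ENNReal.ofReal (Real.exp ((α + b * g) * x)) ∂ν ∂(gaussianReal 0 1) := by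
        rw [lintegral_lintegral_swap (by fun_prop)]
    _ ≤ _ := lintegral_mono fun g => lintegral_exp_mul_le h _

/-! ### Rank-one updates of positive definite matrices -/

section RankOne

open Matrix

variable {d : ℕ} {A : Matrix (Fin d) (Fin d) ℝ}

/-- The squared norm dual to the norm `x ↦ √(x ⬝ᵥ A *ᵥ x)`. -/
noncomputable def dualSq (A : Matrix (Fin d) (Fin d) ℝ) (w : Fin d → ℝ) : ℝ := w ⬝ᵥ A⁻¹ *ᵥ w

/-- The matrix `A + s w wᵀ`. -/
noncomputable def rankOneUpdate (A : Matrix (Fin d) (Fin d) ℝ) (s : ℝ) (w : Fin d → ℝ) :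
    Matrix (Fin d) (Fin d) ℝ := A + s • vecMulVec w w

theorem rankOneUpdate_mulVec (A : Matrix (Fin d) (Fin d) ℝ) (s : ℝ) (w x : Fin d → ℝ) :
    rankOneUpdate A s w *ᵥ x = A *ᵥ x + (s * (w ⬝ᵥ x)) • w := by
  ext i
  simp [rankOneUpdate, add_mulVec, smul_mulVec, vecMulVec_mulVec]
  ring

theorem dotProduct_rankOneUpdate_mulVec (A : Matrix (Fin d) (Fin d) ℝ) (s : ℝ)
    (w x : Fin d → ℝ) :
    x ⬝ᵥ rankOneUpdate A s w *ᵥ x = x ⬝ᵥ A *ᵥ x + s * (w ⬝ᵥ x) ^ 2 := by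
  rw [rankOneUpdate_mulVec, dotProduct_add, dotProduct_smul, dotProduct_comm x w, smul_eq_mul]
  ring

theorem Matrix.PosDef.dotProduct_nonneg (hA : A.PosDef) (x : Fin d → ℝ) : 0 ≤ x ⬝ᵥ A *ᵥ x := by
  simpa using hA.posSemidef.dotProduct_mulVec_nonneg x

theorem Matrix.PosDef.dotProduct_comm (hA : A.PosDef) (x y : Fin d → ℝ) :
    x ⬝ᵥ A *ᵥ y = y ⬝ᵥ A *ᵥ x := by
  have h : Aᵀ = A := by simpa using hA.isHermitian.eq
  rw [dotProduct_mulVec, ← mulVec_transpose, h, _root_.dotProduct_comm]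

theorem Matrix.PosDef.mulVec_inv_mulVec (hA : A.PosDef) (x : Fin d → ℝ) :
    A *ᵥ A⁻¹ *ᵥ x = x := by
  rw [mulVec_mulVec, mul_nonsing_inv _ hA.det_pos.ne'.isUnit, one_mulVec]

theorem Matrix.PosDef.inv_mulVec_mulVec (hA : A.PosDef) (x : Fin d → ℝ) :
    A⁻¹ *ᵥ A *ᵥ x = x := by
  rw [mulVec_mulVec, nonsing_inv_mul _ hA.det_pos.ne'.isUnit, one_mulVec]

theorem posDef_rankOneUpdate (hA : A.PosDef) {s : ℝ} (hs : 0 ≤ s) (w : Fin d → ℝ) :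
    (rankOneUpdate A s w).PosDef := by
  refine hA.add_posSemidef (PosSemidef.smul ?_ hs)
  simpa using posSemidef_vecMulVec_self_star w

theorem dualSq_nonneg (hA : A.PosDef) (w : Fin d → ℝ) : 0 ≤ dualSq A w :=
  hA.inv.dotProduct_nonneg w

theorem det_rankOneUpdate (hA : A.PosDef) (s : ℝ) (w : Fin d → ℝ) :
    (rankOneUpdate A s w).det = A.det * (1 + s * dualSq A w) := by
  have h := det_add_mul (A := A) (replicateCol Unit (s • w)) (replicateRow Unit w)
    hA.det_pos.ne'.isUnit
  rw [← vecMulVec_eq Unit, smul_vecMulVec] at h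
  rw [rankOneUpdate, h]
  congr 1
  rw [det_unique, Matrix.add_apply, one_apply_eq]
  congr 1
  rw [Matrix.mul_assoc, ← replicateCol_mulVec, replicateRow_mul_replicateCol_apply, mulVec_smul,
    dotProduct_smul, smul_eq_mul, dualSq]

theorem trace_rankOneUpdate (A : Matrix (Fin d) (Fin d) ℝ) (s : ℝ) (w : Fin d → ℝ) :
    (rankOneUpdate A s w).trace = A.trace + s * (w ⬝ᵥ w) := by
  simp [rankOneUpdate, trace_vecMulVec]

/-- Every eigenvalue is at most the sum of all. The bound is crude, but it is only used under a
logarithm. -/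
theorem det_le_trace_pow (hA : A.PosDef) : A.det ≤ A.trace ^ d := by
  rw [hA.isHermitian.det_eq_prod_eigenvalues, hA.isHermitian.trace_eq_sum_eigenvalues]
  simp only [RCLike.ofReal_real_eq_id, id]
  calc ∏ i, hA.isHermitian.eigenvalues i
      ≤ ∏ _i : Fin d, ∑ j, hA.isHermitian.eigenvalues j :=
        Finset.prod_le_prod (fun i _ => (hA.eigenvalues_pos i).le) fun i _ =>
          Finset.single_le_sum (f := hA.isHermitian.eigenvalues)
            (fun j _ => (hA.eigenvalues_pos j).le) (Finset.mem_univ i)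
    _ = _ := by simp

/-- Completing the square along the direction `A⁻¹ w`. -/
theorem dotProduct_sub_smul_inv (hA : A.PosDef) (w e : Fin d → ℝ) (t : ℝ) :
    (e - t • (A⁻¹ *ᵥ w)) ⬝ᵥ A *ᵥ (e - t • (A⁻¹ *ᵥ w)) =
      e ⬝ᵥ A *ᵥ e - 2 * t * (w ⬝ᵥ e) + t ^ 2 * dualSq A w := by
  rw [mulVec_sub, mulVec_smul, hA.mulVec_inv_mulVec, dotProduct_sub, sub_dotProduct,
    sub_dotProduct, smul_dotProduct, smul_dotProduct, dotProduct_smul, dotProduct_smul,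
    hA.dotProduct_comm (A⁻¹ *ᵥ w) e, hA.mulVec_inv_mulVec, dotProduct_comm e w,
    dotProduct_comm (A⁻¹ *ᵥ w) w]
  simp only [smul_eq_mul]
  change _ - t * (w ⬝ᵥ e) - (t * (w ⬝ᵥ e) - t * (t * dualSq A w)) = _
  ring

/-- The Cauchy–Schwarz inequality for a norm and its dual. -/
theorem dotProduct_sq_le (hA : A.PosDef) (w e : Fin d → ℝ) :
    (w ⬝ᵥ e) ^ 2 ≤ dualSq A w * (e ⬝ᵥ A *ᵥ e) := by
  set h := dualSq A w with hh
  set z := w ⬝ᵥ e with hz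
  -- The quadratic form at `e - t A⁻¹ w` is a nonnegative polynomial in `t`, so its discriminant is
  -- at most zero.
  have key : ∀ t : ℝ, 0 ≤ h * (t * t) + (-2 * z) * t + e ⬝ᵥ A *ᵥ e := by
    intro t
    have h0 := hA.dotProduct_nonneg (e - t • (A⁻¹ *ᵥ w))
    rw [dotProduct_sub_smul_inv hA] at h0
    linarith
  have := discrim_le_zero key
  rw [discrim] at this
  nlinarith

/-- With `u = A⁻¹ w`, the Euclidean Cauchy–Schwarz inequality for `w ⬝ᵥ u = dualSq A w` and the
bound `u ⬝ᵥ u ≤ u ⬝ᵥ A u = dualSq A w` give the claim after cancelling a factor. -/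
theorem dualSq_le_dotProduct (hA : A.PosDef) (h1 : ∀ x : Fin d → ℝ, x ⬝ᵥ x ≤ x ⬝ᵥ A *ᵥ x)
    (w : Fin d → ℝ) : dualSq A w ≤ w ⬝ᵥ w := by
  have hu := h1 (A⁻¹ *ᵥ w)
  rw [hA.mulVec_inv_mulVec, dotProduct_comm (A⁻¹ *ᵥ w) w] at hu
  change _ ≤ dualSq A w at hu
  have cs := dotProduct_sq_le (A := (1 : Matrix (Fin d) (Fin d) ℝ)) PosDef.one w (A⁻¹ *ᵥ w)
  simp only [dualSq, inv_one, one_mulVec] at cs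
  change (dualSq A w) ^ 2 ≤ _ at cs
  have h0 := dualSq_nonneg hA w
  have hw : 0 ≤ w ⬝ᵥ w := by simpa using dotProduct_star_self_nonneg w
  by_contra hlt
  push Not at hlt
  nlinarith

/-- The Sherman–Morrison formula, checked by applying the updated matrix to the right-hand side. -/
theorem rankOneUpdate_inv_mulVec (hA : A.PosDef) {s : ℝ} (hs : 0 ≤ s) (w N : Fin d → ℝ) :
    (rankOneUpdate A s w)⁻¹ *ᵥ N =
      A⁻¹ *ᵥ N - (s * (w ⬝ᵥ A⁻¹ *ᵥ N) / (1 + s * dualSq A w)) • (A⁻¹ *ᵥ w) := by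
  have h : rankOneUpdate A s w *ᵥ
      (A⁻¹ *ᵥ N - (s * (w ⬝ᵥ A⁻¹ *ᵥ N) / (1 + s * dualSq A w)) • (A⁻¹ *ᵥ w)) = N := by
    have h0 := dualSq_nonneg hA w
    have h1 : 1 + s * dualSq A w ≠ 0 := by positivity
    rw [rankOneUpdate_mulVec, mulVec_sub, mulVec_smul, hA.mulVec_inv_mulVec,
      hA.mulVec_inv_mulVec, dotProduct_sub, dotProduct_smul]
    change _ + (s * (_ - _ • dualSq A w)) • w = N
    ext i
    simp only [Pi.add_apply, Pi.sub_apply, Pi.smul_apply, smul_eq_mul]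
    field_simp
    ring
  conv_lhs => rw [← h]
  exact (posDef_rankOneUpdate hA hs w).inv_mulVec_mulVec _

/-- The change of the self-normalised noise sum in one round. It is quadratic in the new noise `η`,
which is why exponential moments of quadratics are required. -/
theorem dualSq_rankOneUpdate_add_smul (hA : A.PosDef) (w N : Fin d → ℝ) (η : ℝ) :
    dualSq (rankOneUpdate A 1 w) (N + η • w) =
      dualSq A N + (-(w ⬝ᵥ A⁻¹ *ᵥ N) ^ 2 + 2 * η * (w ⬝ᵥ A⁻¹ *ᵥ N) + η ^ 2 * dualSq A w) /
        (1 + dualSq A w) := by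
  have h0 := dualSq_nonneg hA w
  have h1 : 1 + dualSq A w ≠ 0 := by positivity
  rw [dualSq, rankOneUpdate_inv_mulVec hA zero_le_one]
  simp only [mulVec_add, mulVec_smul, dotProduct_sub, dotProduct_add, add_dotProduct,
    smul_dotProduct, dotProduct_smul, smul_eq_mul]
  rw [hA.inv.dotProduct_comm N w]
  simp only [one_mul]
  rw [show N ⬝ᵥ A⁻¹ *ᵥ N = dualSq A N from rfl, show w ⬝ᵥ A⁻¹ *ᵥ w = dualSq A w from rfl]
  field_simp
  ring

theorem le_dotProduct_rankOneUpdate {s : ℝ} (hs : 0 ≤ s)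
    (h1 : ∀ x : Fin d → ℝ, x ⬝ᵥ x ≤ x ⬝ᵥ A *ᵥ x) (w x : Fin d → ℝ) :
    x ⬝ᵥ x ≤ x ⬝ᵥ rankOneUpdate A s w *ᵥ x := by
  rw [dotProduct_rankOneUpdate_mulVec]
  nlinarith [h1 x, mul_nonneg hs (sq_nonneg (w ⬝ᵥ x))]

/-! ### Ellipsoid updates -/

/-- The matrix of the ellipsoid that results from a cut in direction `w`. -/
noncomputable def ellipsoidUpdate (κ : ℝ) (A : Matrix (Fin d) (Fin d) ℝ) (w : Fin d → ℝ) :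
    Matrix (Fin d) (Fin d) ℝ := (1 + κ ^ 2 / 2)⁻¹ • rankOneUpdate A (κ / dualSq A w) w

/-- The centre of the ellipsoid that results from a cut in direction `w`. -/
noncomputable def centreUpdate (κ : ℝ) (A : Matrix (Fin d) (Fin d) ℝ) (g w : Fin d → ℝ) :
    Fin d → ℝ := g - (κ / (2 * (1 + κ)) / √(dualSq A w)) • (A⁻¹ *ᵥ w)

theorem posDef_ellipsoidUpdate (hA : A.PosDef) {κ : ℝ} (hκ : 0 ≤ κ) (w : Fin d → ℝ) :
    (ellipsoidUpdate κ A w).PosDef :=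
  (posDef_rankOneUpdate hA (div_nonneg hκ (dualSq_nonneg hA w)) w).smul (by positivity)

/-- A point of the ellipsoid that satisfies a shallow cut lies in the updated ellipsoid. -/
theorem mem_ellipsoidUpdate (hA : A.PosDef) {κ : ℝ} (hκ : 0 < κ) (hκ1 : κ ≤ 1)
    {g γ w : Fin d → ℝ} (hmem : (g - γ) ⬝ᵥ A *ᵥ (g - γ) ≤ 1) (hw : 0 < dualSq A w)
    (hcut : -(κ / 8) * √(dualSq A w) ≤ w ⬝ᵥ (g - γ)) :
    (centreUpdate κ A g w - γ) ⬝ᵥ ellipsoidUpdate κ A w *ᵥ (centreUpdate κ A g w - γ) ≤ 1 := by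
  set e := g - γ with he
  set h := dualSq A w with hh
  have hr : 0 < √h := Real.sqrt_pos.2 hw
  have hrr : √h * √h = h := Real.mul_self_sqrt hw.le
  set r := √h
  -- The position of `γ` along the cut in units of the half-width of the ellipsoid; it lies between
  -- `-κ / 8` and `1`.
  set ζ := (w ⬝ᵥ e) / r with hζ
  have hz : w ⬝ᵥ e = ζ * r := by rw [hζ]; field_simp
  have hζ1 : ζ ≤ 1 := by
    have cs := dotProduct_sq_le hA w e
    rw [← hh, hz] at cs
    have : ζ ^ 2 * h ≤ 1 * h := by nlinarith
    have := le_of_mul_le_mul_right this hw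
    nlinarith
  have hζ0 : -(κ / 8) ≤ ζ := by
    rw [hz] at hcut
    exact le_of_mul_le_mul_right hcut hr
  set τ := κ / (2 * (1 + κ)) / r with hτ
  have hsub : centreUpdate κ A g w - γ = e - τ • (A⁻¹ *ᵥ w) := by
    rw [centreUpdate, ← hh, he]
    abel
  have hq := dotProduct_sub_smul_inv hA w e τ
  have hl : w ⬝ᵥ (e - τ • (A⁻¹ *ᵥ w)) = w ⬝ᵥ e - τ * h := by
    rw [dotProduct_sub, dotProduct_smul, smul_eq_mul]; rfl
  rw [hsub, ellipsoidUpdate, smul_mulVec, dotProduct_smul, dotProduct_rankOneUpdate_mulVec, hq, hl,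
    smul_eq_mul, inv_mul_le_iff₀ (by positivity), mul_one, ← hh]
  have e1 : 2 * τ * (w ⬝ᵥ e) = κ / (1 + κ) * ζ := by
    rw [hz, hτ]; field_simp
  have e2 : τ ^ 2 * h = (κ / (2 * (1 + κ))) ^ 2 := by
    rw [hτ, ← hrr]; field_simp
  have e3 : κ / h * (w ⬝ᵥ e - τ * h) ^ 2 = κ * (ζ - κ / (2 * (1 + κ))) ^ 2 := by
    rw [hz, hτ, ← hrr]; field_simp
  rw [e1, e2, e3]
  have hk : 0 < 1 + κ := by positivity
  -- The new centre is the minimiser of the old quadratic form plus `κ ζ (ζ - 1)`, where `ζ (ζ - 1)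
  -- ≤ 0` describes the slab `0 ≤ ζ ≤ 1`. Hence the excess over the old form is `κ ζ (ζ - 1)` plus a
  -- constant. For a slightly negative `ζ` each of the two is at most `κ² / 4`; the normalisation by
  -- `1 + κ² / 2` absorbs their sum.
  have e4 : - (κ / (1 + κ) * ζ) + (κ / (2 * (1 + κ))) ^ 2 + κ * (ζ - κ / (2 * (1 + κ))) ^ 2 =
      κ * ζ * (ζ - 1) + κ ^ 2 / (4 * (1 + κ)) := by
    field_simp; ring
  have e5 : κ ^ 2 / (4 * (1 + κ)) ≤ κ ^ 2 / 4 := by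
    apply div_le_div_of_nonneg_left (by positivity) (by positivity) (by linarith)
  have e6 : ζ * (ζ - 1) ≤ κ / 4 := by
    by_cases h0 : 0 ≤ ζ
    · nlinarith
    · push Not at h0; nlinarith
  nlinarith

/-- The stretch gains a factor `1 + κ ≥ exp (κ / 2)`, and the normalisation loses `(1 + κ² / 2) ^ d
≤ exp (κ / 4)` because `d κ = 1 / 2`. The net gain is `exp (κ / 4)`. -/
theorem det_ellipsoidUpdate (hd : 1 ≤ d) (hA : A.PosDef) {w : Fin d → ℝ} (hw : 0 < dualSq A w) :
    Real.exp (1 / (8 * d)) * A.det ≤ (ellipsoidUpdate (1 / (2 * d)) A w).det := by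
  have hd' : (1 : ℝ) ≤ d := by exact_mod_cast hd
  set κ : ℝ := 1 / (2 * d) with hκ
  have hκ0 : 0 < κ := by positivity
  have hκ1 : κ ≤ 1 / 2 := by
    rw [hκ]; apply one_div_le_one_div_of_le <;> linarith
  have hdκ : d * κ = 1 / 2 := by rw [hκ]; field_simp
  rw [ellipsoidUpdate, det_smul, Fintype.card_fin, det_rankOneUpdate hA, div_mul_cancel₀ _ hw.ne']
  have h1 : Real.exp (-κ / 4) ≤ (1 + κ ^ 2 / 2)⁻¹ ^ d := by
    have : (1 + κ ^ 2 / 2) ^ d ≤ Real.exp (κ / 4) := by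
      calc (1 + κ ^ 2 / 2) ^ d ≤ (Real.exp (κ ^ 2 / 2)) ^ d := by
            gcongr
            linarith [Real.add_one_le_exp (κ ^ 2 / 2)]
        _ = Real.exp (κ / 4) := by
            rw [← Real.exp_nat_mul]; congr 1
            calc (d : ℝ) * (κ ^ 2 / 2) = (d * κ) * κ / 2 := by ring
              _ = κ / 4 := by rw [hdκ]; ring
    rw [inv_pow, neg_div, Real.exp_neg]
    exact inv_anti₀ (by positivity) this
  have h2 : Real.exp (κ / 2) ≤ 1 + κ := by
    have := Real.abs_exp_sub_one_le (x := κ / 2) (by rw [abs_of_pos] <;> linarith)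
    rw [abs_of_pos (show 0 < κ / 2 by positivity)] at this
    linarith [le_abs_self (Real.exp (κ / 2) - 1)]
  have h3 : Real.exp (1 / (8 * d)) = Real.exp (-κ / 4) * Real.exp (κ / 2) := by
    rw [← Real.exp_add, hκ]; congr 1; field_simp; norm_num
  rw [h3]
  calc _ = Real.exp (-κ / 4) * (A.det * Real.exp (κ / 2)) := by ring
    _ ≤ _ := by
      gcongr
      · exact mul_nonneg hA.det_pos.le (Real.exp_pos _).le
      · exact hA.det_pos.le

theorem trace_ellipsoidUpdate_le (hA : A.PosDef) {κ h₀ : ℝ} (hκ : 0 ≤ κ) (h₀pos : 0 < h₀)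
    {w : Fin d → ℝ} (hw : h₀ ≤ dualSq A w) :
    (ellipsoidUpdate κ A w).trace ≤ A.trace + κ * (w ⬝ᵥ w) / h₀ := by
  have hww : 0 ≤ w ⬝ᵥ w := by simpa using dotProduct_star_self_nonneg w
  have h1 : κ / dualSq A w * (w ⬝ᵥ w) ≤ κ * (w ⬝ᵥ w) / h₀ := by
    rw [div_mul_eq_mul_div]
    exact div_le_div_of_nonneg_left (by positivity) h₀pos hw
  have h2 := trace_rankOneUpdate A (κ / dualSq A w) w
  have h3 : 0 ≤ (rankOneUpdate A (κ / dualSq A w) w).trace :=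
    (posDef_rankOneUpdate hA (div_nonneg hκ (h₀pos.le.trans hw)) w).posSemidef.trace_nonneg
  rw [ellipsoidUpdate, trace_smul, smul_eq_mul]
  calc _ ≤ 1 * (rankOneUpdate A (κ / dualSq A w) w).trace := by
        gcongr
        apply inv_le_one_of_one_le₀
        nlinarith [sq_nonneg κ]
    _ ≤ _ := by linarith

end RankOne

/-! ### Measurability of matrix operations -/

section MatrixMeasurable

variable {d : ℕ}

instance : MeasurableSpace (Matrix (Fin d) (Fin d) ℝ) := MeasurableSpace.pi

instance : BorelSpace (Matrix (Fin d) (Fin d) ℝ) :=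
  inferInstanceAs (BorelSpace (Fin d → Fin d → ℝ))

instance : SecondCountableTopology (Matrix (Fin d) (Fin d) ℝ) :=
  inferInstanceAs (SecondCountableTopology (Fin d → Fin d → ℝ))

variable {Ω : Type} [MeasurableSpace Ω] {A : Ω → Matrix (Fin d) (Fin d) ℝ} {v w : Ω → Fin d → ℝ}

theorem Measurable.matrix_inv (hA : Measurable A) : Measurable fun ω => (A ω)⁻¹ := by
  have h : (fun A : Matrix (Fin d) (Fin d) ℝ => A⁻¹) = fun A => (A.det)⁻¹ • A.adjugate := by
    funext A
    rw [Matrix.inv_def, Ring.inverse_eq_inv']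
  have h1 : Measurable fun A : Matrix (Fin d) (Fin d) ℝ => A.det :=
    (Continuous.matrix_det continuous_id).measurable
  have h2 : Measurable fun A : Matrix (Fin d) (Fin d) ℝ => A.adjugate :=
    (Continuous.matrix_adjugate continuous_id).measurable
  have h3 : Measurable fun A : Matrix (Fin d) (Fin d) ℝ => A⁻¹ := h ▸ h1.inv.smul h2
  exact h3.comp hA

theorem Measurable.matrix_det (hA : Measurable A) : Measurable fun ω => (A ω).det :=
  (Continuous.matrix_det continuous_id).measurable.comp hA

theorem Measurable.matrix_mulVec (hA : Measurable A) (hv : Measurable v) :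
    Measurable fun ω => (A ω).mulVec (v ω) :=
  (Continuous.matrix_mulVec (A := fun p : Matrix (Fin d) (Fin d) ℝ × (Fin d → ℝ) => p.1)
    (B := fun p => p.2) continuous_fst continuous_snd).measurable.comp (hA.prodMk hv)

theorem Measurable.dotProduct (hv : Measurable v) (hw : Measurable w) :
    Measurable fun ω => v ω ⬝ᵥ w ω :=
  (Continuous.dotProduct (A := fun p : (Fin d → ℝ) × (Fin d → ℝ) => p.1)
    (B := fun p => p.2) continuous_fst continuous_snd).measurable.comp (hv.prodMk hw)

theorem Measurable.dualSq (hA : Measurable A) (hw : Measurable w) :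
    Measurable fun ω => dualSq (A ω) (w ω) :=
  hw.dotProduct (hA.matrix_inv.matrix_mulVec hw)

theorem Measurable.rankOneUpdate {s : Ω → ℝ} (hA : Measurable A) (hs : Measurable s)
    (hw : Measurable w) : Measurable fun ω => rankOneUpdate (A ω) (s ω) (w ω) := by
  have h : Measurable fun ω => Matrix.vecMulVec (w ω) (w ω) :=
    (Continuous.matrix_vecMulVec continuous_id continuous_id).measurable.comp hw
  exact hA.add (hs.smul h)

theorem Measurable.ellipsoidUpdate (κ : ℝ) (hA : Measurable A) (hw : Measurable w) :
    Measurable fun ω => ellipsoidUpdate κ (A ω) (w ω) :=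
  (hA.rankOneUpdate ((hA.dualSq hw).const_div κ) hw).const_smul (1 + κ ^ 2 / 2)⁻¹

theorem Measurable.centreUpdate (κ : ℝ) (hA : Measurable A) (hv : Measurable v)
    (hw : Measurable w) : Measurable fun ω => centreUpdate κ (A ω) (v ω) (w ω) :=
  hv.sub (((hA.dualSq hw).sqrt.const_div _).smul (hA.matrix_inv.matrix_mulVec hw))

end MatrixMeasurable

/-! ### The learning algorithm -/

/-- The parameters of the learning algorithm: a feature map, the radius of the confidence
ellipsoids for the reward, the accuracy of the payments, and a bound for all vectors. -/
structure Learner (α : Type) (d : ℕ) where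
  feat : α → Fin d → ℝ
  radius : ℝ
  acc : ℝ
  bound : ℝ

/-- The design matrix and the response vector of the regression for the reward, and the matrix and
the centre of an ellipsoid that contains the parameter of the cost. -/
abbrev LearnerState (d : ℕ) : Type :=
  Matrix (Fin d) (Fin d) ℝ × (Fin d → ℝ) × Matrix (Fin d) (Fin d) ℝ × (Fin d → ℝ)

namespace Learner

variable {α : Type} {d : ℕ}

/-- The step size of the ellipsoid updates. -/
noncomputable def step (_ : Learner α d) : ℝ := 1 / (2 * d)

/-- The amount added to the payment. -/
noncomputable def bonus (ℓ : Learner α d) : ℝ := ℓ.step * ℓ.acc / 8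

/-- The features of `a` and `b` are close. -/
def Near (ℓ : Learner α d) (a b : α) : Prop :=
  (ℓ.feat a - ℓ.feat b) ⬝ᵥ (ℓ.feat a - ℓ.feat b) ≤ (ℓ.bonus / (2 * ℓ.bound)) ^ 2

/-- `F` is a finite net of `S`. -/
def IsNet (ℓ : Learner α d) (S : Set α) (F : Finset α) : Prop :=
  F.Nonempty ∧ (F : Set α) ⊆ S ∧ ∀ a ∈ S, ∃ b ∈ F, ℓ.Near a b

open Classical in
/-- A finite net of `S`. -/
noncomputable def net (ℓ : Learner α d) (S : Set α) : Finset α :=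
  if h : ∃ F, ℓ.IsNet S F then h.choose else ∅

theorem isNet_net {ℓ : Learner α d} {S : Set α} (h : ∃ F, ℓ.IsNet S F) : ℓ.IsNet S (ℓ.net S) := by
  rw [net, dif_pos h]
  exact h.choose_spec

variable [Nonempty α]

/-- The action of the net with the smallest estimated cost. -/
noncomputable def cheapest (ℓ : Learner α d) (F : Finset α) (s : LearnerState d) : α :=
  chooseIn F fun b => ∀ b₁ ∈ F, s.2.2.2 ⬝ᵥ ℓ.feat b ≤ s.2.2.2 ⬝ᵥ ℓ.feat b₁

/-- The least squares estimate of the reward parameter. -/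
noncomputable def estimate (s : LearnerState d) : Fin d → ℝ := s.1⁻¹.mulVec s.2.1

/-- The optimistic estimate of the profit from an action. -/
noncomputable def index (ℓ : Learner α d) (F : Finset α) (s : LearnerState d) (b : α) : ℝ :=
  estimate s ⬝ᵥ ℓ.feat b + ℓ.radius * √(dualSq s.1 (ℓ.feat b)) - s.2.2.2 ⬝ᵥ ℓ.feat b +
    √(dualSq s.2.2.1 (ℓ.feat b - ℓ.feat (ℓ.cheapest F s)))

/-- The action that the principal wants the agent to take. -/
noncomputable def target (ℓ : Learner α d) (F : Finset α) (s : LearnerState d) : α :=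
  chooseIn F fun b => ∀ b' ∈ F, ℓ.index F s b' ≤ ℓ.index F s b

/-- The difference of the features of the target and of the cheapest action. -/
noncomputable def gap (ℓ : Learner α d) (F : Finset α) (s : LearnerState d) : Fin d → ℝ :=
  ℓ.feat (ℓ.target F s) - ℓ.feat (ℓ.cheapest F s)

/-- The payment for the target. -/
noncomputable def price (ℓ : Learner α d) (F : Finset α) (s : LearnerState d) : ℝ :=
  min (s.2.2.2 ⬝ᵥ ℓ.gap F s) 1 + ℓ.bonus

open Classical in
/-- The contract that only pays for the target. -/
noncomputable def offer (ℓ : Learner α d) (F : Finset α) (s : LearnerState d) (a : α) : ℝ≥0 :=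
  if a = ℓ.target F s then (ℓ.price F s).toNNReal else 0

/-- An action of the net near `a`. -/
noncomputable def round (ℓ : Learner α d) (F : Finset α) (a : α) : α :=
  chooseIn F fun b => ℓ.Near a b

open Classical in
/-- The direction of the cut that the action `a` of the agent yields. -/
noncomputable def cut (ℓ : Learner α d) (F : Finset α) (s : LearnerState d) (a : α) : Fin d → ℝ :=
  if a = ℓ.target F s then ℓ.gap F s
  else ℓ.feat (ℓ.round F a) - ℓ.feat (ℓ.target F s)

/-- The action `a` of the agent leads to an update of the ellipsoid. -/
def Cuts (ℓ : Learner α d) (F : Finset α) (s : LearnerState d) (a : α) : Prop :=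
  a ≠ ℓ.target F s ∨ ℓ.acc ^ 2 ≤ dualSq s.2.2.1 (ℓ.gap F s)

open Classical in
/-- The state after the action `p.1` and the noisy reward `p.2`. -/
noncomputable def next (ℓ : Learner α d) (F : Finset α) (s : LearnerState d) (p : α × ℝ) :
    LearnerState d :=
  (rankOneUpdate s.1 1 (ℓ.feat p.1), s.2.1 + p.2 • ℓ.feat p.1,
    if ℓ.Cuts F s p.1 then ellipsoidUpdate ℓ.step s.2.2.1 (ℓ.cut F s p.1) else s.2.2.1,
    if ℓ.Cuts F s p.1 then centreUpdate ℓ.step s.2.2.1 s.2.2.2 (ℓ.cut F s p.1) else s.2.2.2)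

/-- The state before the first round. -/
noncomputable def init (ℓ : Learner α d) : LearnerState d := (1, 0, (ℓ.bound ^ 2)⁻¹ • 1, 0)

/-- The state after `t` rounds. -/
noncomputable def state (ℓ : Learner α d) :
    (t : ℕ) → (Fin t → Set α) → (Fin t → α × ℝ) → LearnerState d
  | 0, _, _ => ℓ.init
  | t + 1, S, h =>
    ℓ.next (ℓ.net (S (Fin.last t))) (state ℓ t (Fin.init S) (Fin.init h)) (h (Fin.last t))

/-! ### Measurability of the learner's choices and of its state -/

section Measurability

variable [MeasurableSpace α] {Ω : Type} [MeasurableSpace Ω] {ℓ : Learner α d}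
  {s : Ω → LearnerState d} {a : Ω → α}

theorem measurable_cheapest (ℓ : Learner α d) (hs : Measurable s) (F : Finset α) :
    Measurable fun ω => ℓ.cheapest F (s ω) := by
  have h : ∀ b, Measurable fun ω => (s ω).2.2.2 ⬝ᵥ ℓ.feat b := fun b =>
    hs.snd.snd.snd.dotProduct measurable_const
  refine measurable_chooseIn F fun b _ => ?_
  simp only [Set.ofPred_forall]
  exact Finset.measurableSet_biInter _ fun b' _ => measurableSet_le (h b) (h b')

theorem measurable_index (hℓ : Measurable ℓ.feat) (hs : Measurable s) (F : Finset α) (b : α) :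
    Measurable fun ω => ℓ.index F (s ω) b := by
  have h1 := (hs.fst.matrix_inv.matrix_mulVec hs.snd.fst).dotProduct
    (measurable_const (a := ℓ.feat b))
  have h2 := (hs.fst.dualSq (measurable_const (a := ℓ.feat b))).sqrt.const_mul ℓ.radius
  have h3 := hs.snd.snd.snd.dotProduct (measurable_const (a := ℓ.feat b))
  have h4 := (hs.snd.snd.fst.dualSq
    ((measurable_const (a := ℓ.feat b)).sub (hℓ.comp (measurable_cheapest ℓ hs F)))).sqrt
  exact ((h1.add h2).sub h3).add h4

theorem measurable_target (hℓ : Measurable ℓ.feat) (hs : Measurable s) (F : Finset α) :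
    Measurable fun ω => ℓ.target F (s ω) := by
  refine measurable_chooseIn F fun b _ => ?_
  simp only [Set.ofPred_forall]
  exact Finset.measurableSet_biInter _ fun b' _ =>
    measurableSet_le (measurable_index hℓ hs F b') (measurable_index hℓ hs F b)

theorem measurable_gap (hℓ : Measurable ℓ.feat) (hs : Measurable s) (F : Finset α) :
    Measurable fun ω => ℓ.gap F (s ω) :=
  (hℓ.comp (measurable_target hℓ hs F)).sub (hℓ.comp (measurable_cheapest ℓ hs F))

theorem measurable_price (hℓ : Measurable ℓ.feat) (hs : Measurable s) (F : Finset α) :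
    Measurable fun ω => ℓ.price F (s ω) :=
  ((hs.snd.snd.snd.dotProduct (measurable_gap hℓ hs F)).min measurable_const).add_const _

theorem measurable_round (hℓ : Measurable ℓ.feat) (ha : Measurable a) (F : Finset α) :
    Measurable fun ω => ℓ.round F (a ω) := by
  refine measurable_chooseIn F fun b _ => ?_
  have h : Measurable fun ω => ℓ.feat (a ω) - ℓ.feat b := (hℓ.comp ha).sub measurable_const
  exact measurableSet_le (h.dotProduct h) measurable_const

variable [MeasurableEq α]

theorem measurable_offer (hℓ : Measurable ℓ.feat) (hs : Measurable s) (ha : Measurable a)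
    (F : Finset α) : Measurable fun ω => ℓ.offer F (s ω) (a ω) :=
  Measurable.ite (measurableSet_eq_fun ha (measurable_target hℓ hs F))
    (measurable_price hℓ hs F).real_toNNReal measurable_const

theorem measurable_cut (hℓ : Measurable ℓ.feat) (hs : Measurable s) (ha : Measurable a)
    (F : Finset α) : Measurable fun ω => ℓ.cut F (s ω) (a ω) :=
  Measurable.ite (measurableSet_eq_fun ha (measurable_target hℓ hs F)) (measurable_gap hℓ hs F)
    ((hℓ.comp (measurable_round hℓ ha F)).sub (hℓ.comp (measurable_target hℓ hs F)))

theorem measurable_next (hℓ : Measurable ℓ.feat) (hs : Measurable s) (ha : Measurable a)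
    {y : Ω → ℝ} (hy : Measurable y) (F : Finset α) :
    Measurable fun ω => ℓ.next F (s ω) (a ω, y ω) := by
  have hc : MeasurableSet {ω | ℓ.Cuts F (s ω) (a ω)} :=
    (measurableSet_eq_fun ha (measurable_target hℓ hs F)).compl.union
      (measurableSet_le measurable_const (hs.snd.snd.fst.dualSq (measurable_gap hℓ hs F)))
  have hw := measurable_cut hℓ hs ha F
  refine Measurable.prodMk (hs.fst.rankOneUpdate measurable_const (hℓ.comp ha))
    (Measurable.prodMk (hs.snd.fst.add (hy.smul (hℓ.comp ha))) (Measurable.prodMk ?_ ?_))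
  · exact Measurable.ite hc (hs.snd.snd.fst.ellipsoidUpdate _ hw) hs.snd.snd.fst
  · exact Measurable.ite hc (hs.snd.snd.fst.centreUpdate _ hs.snd.snd.snd hw) hs.snd.snd.snd

theorem measurable_state (hℓ : Measurable ℓ.feat) (t : ℕ) (S : Fin t → Set α) :
    Measurable fun h : Fin t → α × ℝ => ℓ.state t S h := by
  induction t with
  | zero => exact measurable_const
  | succ t ih =>
    have h1 : Measurable fun h : Fin (t + 1) → α × ℝ => ℓ.state t (Fin.init S) (Fin.init h) :=
      (ih _).comp (measurable_pi_lambda _ fun i => measurable_pi_apply _)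
    have h2 : Measurable fun h : Fin (t + 1) → α × ℝ => h (Fin.last t) := measurable_pi_apply _
    exact measurable_next hℓ h1 h2.fst h2.snd _

end Measurability

variable [MeasurableSpace α] [MeasurableEq α]

/-- The policy of the learner. -/
noncomputable def policy (ℓ : Learner α d) (hℓ : Measurable ℓ.feat) : Policy α where
  seedLaw := Measure.dirac 0
  isProbabilityMeasure_seedLaw := inferInstance
  contract t S _ h a := ℓ.offer (ℓ.net (S (Fin.last t))) (ℓ.state t (Fin.init S) h) a
  measurable_contract t _ := measurable_offer hℓ
    ((measurable_state hℓ t _).comp (measurable_snd.comp measurable_fst)) measurable_snd _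

/-- The state after `t` rounds against the agent `ag`. -/
noncomputable def stateAt (ℓ : Learner α d) (hℓ : Measurable ℓ.feat) (E : Environment α)
    (ag : Agent α) (t : ℕ) (ω : ℝ × (ℕ → ℝ)) : LearnerState d :=
  ℓ.state t (fun s => E.actionSet s) ((ℓ.policy hℓ).history E ag ω t)

variable {ℓ : Learner α d} {hℓ : Measurable ℓ.feat} {E : Environment α} {ag : Agent α}

theorem stateAt_zero (ω : ℝ × (ℕ → ℝ)) : ℓ.stateAt hℓ E ag 0 ω = ℓ.init := rfl

theorem stateAt_succ (t : ℕ) (ω : ℝ × (ℕ → ℝ)) :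
    ℓ.stateAt hℓ E ag (t + 1) ω = ℓ.next (ℓ.net (E.actionSet t)) (ℓ.stateAt hℓ E ag t ω)
      ((ℓ.policy hℓ).action E ag t ω, E.reward ((ℓ.policy hℓ).action E ag t ω) + ω.2 t) := by
  rw [stateAt, state, Policy.history, Fin.snoc_last, Fin.init_snoc]
  rfl

theorem posted_eq (t : ℕ) (ω : ℝ × (ℕ → ℝ)) :
    (ℓ.policy hℓ).posted E ag t ω = ℓ.offer (ℓ.net (E.actionSet t)) (ℓ.stateAt hℓ E ag t ω) := rfl

end Learner

/-! ### Histories -/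

section History

variable {α : Type} [MeasurableSpace α] {π : Policy α} {E : Environment α} {ag : Agent α}

/-- Only actions of earlier rounds are assumed measurable, so that measurability of the actions
themselves can be proved by strong induction. -/
theorem Policy.measurable_history (hE : Measurable E.reward) (t : ℕ)
    (h : ∀ s < t, Measurable (π.action E ag s)) :
    Measurable fun ω => π.history E ag ω t := by
  induction t with
  | zero => exact measurable_pi_lambda _ fun i => i.elim0
  | succ t ih =>
    have h1 := ih fun s hs => h s (hs.trans t.lt_succ_self)
    have h2 := h t t.lt_succ_self
    refine measurable_pi_lambda _ fun i => ?_
    refine Fin.lastCases ?_ (fun i => ?_) i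
    · simp only [Policy.history, Fin.snoc_last]
      refine Measurable.prodMk h2 ((hE.comp h2).add ?_)
      fun_prop
    · simp only [Policy.history, Fin.snoc_castSucc]
      exact (measurable_pi_apply i).comp h1

theorem Policy.history_resample (t : ℕ) (ω : ℝ × (ℕ → ℝ)) (z : ℝ) :
    ∀ s ≤ t, π.history E ag (resample t ω z) s = π.history E ag ω s := by
  intro s
  induction s with
  | zero => intro _; rfl
  | succ s ih =>
    intro hs
    have h := ih (by omega)
    simp only [Policy.history]
    rw [h]
    simp [resample, Function.update_of_ne (show s ≠ t by omega)]

theorem Policy.action_resample (t : ℕ) (ω : ℝ × (ℕ → ℝ)) (z : ℝ) :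
    π.action E ag t (resample t ω z) = π.action E ag t ω := by
  rw [Policy.action, Policy.posted, Policy.history_resample t ω z t le_rfl]
  rfl

theorem Policy.history_succ (t : ℕ) (ω : ℝ × (ℕ → ℝ)) :
    π.history E ag ω (t + 1) = Fin.snoc (α := fun _ => α × ℝ) (π.history E ag ω t)
      (π.action E ag t ω, E.reward (π.action E ag t ω) + ω.2 t) := rfl

end History

/-! ### Analysis of a single round -/

theorem dotProduct_self_nonneg' {d : ℕ} (v : Fin d → ℝ) : 0 ≤ v ⬝ᵥ v := by
  simpa using dotProduct_star_self_nonneg v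

theorem dotProduct_le_mul {d : ℕ} {u v : Fin d → ℝ} {x y : ℝ} (hx : 0 ≤ x) (hy : 0 ≤ y)
    (hu : u ⬝ᵥ u ≤ x ^ 2) (hv : v ⬝ᵥ v ≤ y ^ 2) : |u ⬝ᵥ v| ≤ x * y := by
  have cs := dotProduct_sq_le (A := (1 : Matrix (Fin d) (Fin d) ℝ)) Matrix.PosDef.one u v
  simp only [dualSq, inv_one, Matrix.one_mulVec] at cs
  refine abs_le_of_sq_le_sq ?_ (by positivity)
  calc (u ⬝ᵥ v) ^ 2 ≤ _ := cs
    _ ≤ x ^ 2 * y ^ 2 := mul_le_mul hu hv (dotProduct_self_nonneg' v) (by positivity)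
    _ = _ := by ring

namespace Learner

variable {α : Type} {d : ℕ}

/-- The environment `E` is linear in the features, with parameters `θ` for the reward and `γ` for
the cost, and the parameters of the learner are admissible for it. -/
structure Fits (ℓ : Learner α d) (E : Environment α) (θ γ : Fin d → ℝ) : Prop where
  one_le_dim : 1 ≤ d
  acc_pos : 0 < ℓ.acc
  acc_le_one : ℓ.acc ≤ 1
  one_le_bound : 1 ≤ ℓ.bound
  radius_nonneg : 0 ≤ ℓ.radius
  reward_sq_le : θ ⬝ᵥ θ ≤ ℓ.bound ^ 2
  cost_sq_le : γ ⬝ᵥ γ ≤ ℓ.bound ^ 2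
  exists_net : ∀ t, ∃ F, ℓ.IsNet (E.actionSet t) F
  feat_sq_le : ∀ t, ∀ a ∈ E.actionSet t, ℓ.feat a ⬝ᵥ ℓ.feat a ≤ ℓ.bound ^ 2
  reward_eq : ∀ a, E.reward a = ℓ.feat a ⬝ᵥ θ
  cost_eq : ∀ a, E.cost a = ℓ.feat a ⬝ᵥ γ
  reward_mem : ∀ t, ∀ a ∈ E.actionSet t, E.reward a ∈ Set.Icc (0 : ℝ) 1
  cost_mem : ∀ t, ∀ a ∈ E.actionSet t, E.cost a ∈ Set.Icc (0 : ℝ) 1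

/-- The ellipsoid of the state contains the cost parameter, and the matrices are positive
definite. -/
structure Valid (s : LearnerState d) (γ : Fin d → ℝ) : Prop where
  design_posDef : s.1.PosDef
  le_design : ∀ x : Fin d → ℝ, x ⬝ᵥ x ≤ x ⬝ᵥ s.1.mulVec x
  ellipsoid_posDef : s.2.2.1.PosDef
  mem_ellipsoid : (s.2.2.2 - γ) ⬝ᵥ s.2.2.1.mulVec (s.2.2.2 - γ) ≤ 1

/-- The estimate of the reward of every action is within its confidence interval. -/
def Confident (ℓ : Learner α d) (s : LearnerState d) (θ : Fin d → ℝ) : Prop :=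
  ∀ b, |ℓ.feat b ⬝ᵥ (estimate s - θ)| ≤ ℓ.radius * √(dualSq s.1 (ℓ.feat b))

variable {ℓ : Learner α d} {E : Environment α} {θ γ : Fin d → ℝ}

theorem Fits.step_pos (h : ℓ.Fits E θ γ) : 0 < ℓ.step := by
  have := h.one_le_dim
  rw [step]; positivity

theorem Fits.step_le (h : ℓ.Fits E θ γ) : ℓ.step ≤ 1 := by
  have : (1 : ℝ) ≤ d := by exact_mod_cast h.one_le_dim
  rw [step, div_le_one (by positivity)]; linarith

theorem Fits.bonus_pos (h : ℓ.Fits E θ γ) : 0 < ℓ.bonus := by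
  have := h.step_pos
  have := h.acc_pos
  rw [bonus]; positivity

theorem Fits.bonus_le (h : ℓ.Fits E θ γ) : ℓ.bonus ≤ ℓ.acc / 8 := by
  rw [bonus]
  nlinarith [h.step_le, h.acc_pos]

theorem Fits.isNet (h : ℓ.Fits E θ γ) (t : ℕ) :
    ℓ.IsNet (E.actionSet t) (ℓ.net (E.actionSet t)) := isNet_net (h.exists_net t)

theorem Fits.abs_dotProduct_le (h : ℓ.Fits E θ γ) {a b : α} (hab : ℓ.Near a b) {v : Fin d → ℝ}
    (hv : v ⬝ᵥ v ≤ ℓ.bound ^ 2) : |ℓ.feat a ⬝ᵥ v - ℓ.feat b ⬝ᵥ v| ≤ ℓ.bonus / 2 := by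
  have hb : 0 < ℓ.bound := zero_lt_one.trans_le h.one_le_bound
  have := h.bonus_pos
  rw [← sub_dotProduct]
  refine (dotProduct_le_mul (by positivity) hb.le hab hv).trans_eq ?_
  field_simp

theorem Fits.valid_init (h : ℓ.Fits E θ γ) : Valid ℓ.init γ where
  design_posDef := Matrix.PosDef.one
  le_design x := by simp [init]
  ellipsoid_posDef := by
    have := h.one_le_bound
    exact Matrix.PosDef.one.smul (by positivity)
  mem_ellipsoid := by
    have := h.one_le_bound
    simp only [init, zero_sub, Matrix.smul_mulVec, Matrix.one_mulVec, dotProduct_smul,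
      neg_dotProduct, dotProduct_neg, neg_neg, smul_eq_mul]
    rw [inv_mul_le_iff₀ (by positivity), mul_one]
    exact h.cost_sq_le

theorem Fits.dotProduct_sub_self_le (h : ℓ.Fits E θ γ) {t : ℕ} {a b : α} (ha : a ∈ E.actionSet t)
    (hb : b ∈ E.actionSet t) :
    (ℓ.feat a - ℓ.feat b) ⬝ᵥ (ℓ.feat a - ℓ.feat b) ≤ 4 * ℓ.bound ^ 2 := by
  have h1 := dotProduct_self_nonneg' (ℓ.feat a + ℓ.feat b)
  have h2 := h.feat_sq_le t a ha
  have h3 := h.feat_sq_le t b hb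
  rw [add_dotProduct, dotProduct_add, dotProduct_add] at h1
  rw [sub_dotProduct, dotProduct_sub, dotProduct_sub]
  linarith

variable [Nonempty α] {F : Finset α} {s : LearnerState d} {t : ℕ} {a : α}

theorem cheapest_spec (ℓ : Learner α d) (hF : F.Nonempty) (s : LearnerState d) :
    ℓ.cheapest F s ∈ F ∧
      ∀ b ∈ F, s.2.2.2 ⬝ᵥ ℓ.feat (ℓ.cheapest F s) ≤ s.2.2.2 ⬝ᵥ ℓ.feat b :=
  chooseIn_spec (F.exists_min_image (fun b => s.2.2.2 ⬝ᵥ ℓ.feat b) hF)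

theorem target_spec (ℓ : Learner α d) (hF : F.Nonempty) (s : LearnerState d) :
    ℓ.target F s ∈ F ∧ ∀ b ∈ F, ℓ.index F s b ≤ ℓ.index F s (ℓ.target F s) :=
  chooseIn_spec (F.exists_max_image (ℓ.index F s) hF)

theorem round_spec {S : Set α} (hF : ℓ.IsNet S F) (ha : a ∈ S) :
    ℓ.round F a ∈ F ∧ ℓ.Near a (ℓ.round F a) :=
  chooseIn_spec (hF.2.2 a ha)

theorem dotProduct_gap_nonneg (ℓ : Learner α d) (hF : F.Nonempty) (s : LearnerState d) :
    0 ≤ s.2.2.2 ⬝ᵥ ℓ.gap F s := by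
  rw [gap, dotProduct_sub, sub_nonneg]
  exact (ℓ.cheapest_spec hF s).2 _ (ℓ.target_spec hF s).1

theorem bonus_le_price (ℓ : Learner α d) (hF : F.Nonempty) (s : LearnerState d) :
    ℓ.bonus ≤ ℓ.price F s := by
  have := ℓ.dotProduct_gap_nonneg hF s
  rw [price]
  linarith [le_min this zero_le_one]

theorem price_le (ℓ : Learner α d) (F : Finset α) (s : LearnerState d) :
    ℓ.price F s ≤ 1 + ℓ.bonus := by
  rw [price]; linarith [min_le_right (s.2.2.2 ⬝ᵥ ℓ.gap F s) 1]

theorem Fits.offer_target (h : ℓ.Fits E θ γ) (hF : F.Nonempty) (s : LearnerState d) :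
    (ℓ.offer F s (ℓ.target F s) : ℝ) = ℓ.price F s := by
  rw [offer, if_pos rfl, Real.coe_toNNReal _ (h.bonus_pos.le.trans (ℓ.bonus_le_price hF s))]

theorem offer_of_ne (h : a ≠ ℓ.target F s) : ℓ.offer F s a = 0 := by
  rw [offer, if_neg h]

/-- If the agent takes the target, then its estimated cost gap is not too small. -/
theorem Fits.cut_of_eq (h : ℓ.Fits E θ γ) (hF : ℓ.IsNet (E.actionSet t) F)
    (ha : a ∈ bestResponses (E.actionSet t) E.cost (ℓ.offer F s)) (hat : a = ℓ.target F s) :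
    -ℓ.bonus ≤ ℓ.gap F s ⬝ᵥ (s.2.2.2 - γ) := by
  have hc := ℓ.cheapest_spec hF.1 s
  have hb := h.bonus_pos
  by_cases hne : ℓ.cheapest F s = ℓ.target F s
  · rw [gap, hne, sub_self, zero_dotProduct]; linarith
  · have := ha.2 _ (hF.2.1 hc.1)
    rw [hat, h.offer_target hF.1, offer_of_ne hne, h.cost_eq, h.cost_eq, NNReal.coe_zero,
      price] at this
    have h1 := min_le_left (s.2.2.2 ⬝ᵥ ℓ.gap F s) 1
    rw [dotProduct_sub, dotProduct_comm _ s.2.2.2]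
    conv_rhs => rw [gap, sub_dotProduct, ← gap]
    linarith

/-- If the agent does not take the target, then the resulting cut is deep. -/
theorem Fits.cut_of_ne (h : ℓ.Fits E θ γ) (hF : ℓ.IsNet (E.actionSet t) F)
    (ha : a ∈ bestResponses (E.actionSet t) E.cost (ℓ.offer F s)) (hat : a ≠ ℓ.target F s) :
    ℓ.bonus / 2 ≤ ℓ.cut F s a ⬝ᵥ (s.2.2.2 - γ) := by
  have hc := ℓ.cheapest_spec hF.1 s
  have ht := ℓ.target_spec hF.1 s
  have hb := h.bonus_pos
  have hr := round_spec hF ha.1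
  have h1 := ha.2 _ (hF.2.1 ht.1)
  rw [h.offer_target hF.1, offer_of_ne hat, NNReal.coe_zero, price] at h1
  have hca := h.cost_mem t _ (hF.2.1 ht.1)
  have hca' := h.cost_mem t _ ha.1
  rcases le_total (s.2.2.2 ⬝ᵥ ℓ.gap F s) 1 with hm | hm
  · rw [min_eq_left hm, h.cost_eq, h.cost_eq] at h1
    have h2 := (abs_le.1 (h.abs_dotProduct_le hr.2 h.cost_sq_le)).1
    -- Estimated costs can be compared with the cheapest one only on the net, hence the rounding of
    -- the agent's action. The rounding error is measured with `γ`, which is bounded, and not with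
    -- the centre; it consumes half of the bonus.
    have h3 := hc.2 _ hr.1
    rw [gap, dotProduct_sub] at h1
    rw [cut, if_neg hat, dotProduct_sub, sub_dotProduct, sub_dotProduct,
      dotProduct_comm _ s.2.2.2, dotProduct_comm _ s.2.2.2]
    linarith
  -- At the capped price `1 + bonus` a refusal is impossible, since costs differ by at most one.
  · rw [min_eq_right hm] at h1
    linarith [hca.2, hca'.1]

/-- For an accepted offer the width is at least `acc`, and `bonus = step * acc / 8` is exactly the
shallowness that the ellipsoid update tolerates. For a refusal the cut is positive at `γ`, and
Cauchy–Schwarz inside the ellipsoid turns its depth `bonus / 2` into a lower bound for the width,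
which later controls the trace. -/
theorem Fits.cut_spec (h : ℓ.Fits E θ γ) (hs : Valid s γ) (hF : ℓ.IsNet (E.actionSet t) F)
    (ha : a ∈ bestResponses (E.actionSet t) E.cost (ℓ.offer F s)) (hcut : ℓ.Cuts F s a) :
    (ℓ.bonus / 2) ^ 2 ≤ dualSq s.2.2.1 (ℓ.cut F s a) ∧
      -(ℓ.step / 8) * √(dualSq s.2.2.1 (ℓ.cut F s a)) ≤ ℓ.cut F s a ⬝ᵥ (s.2.2.2 - γ) := by
  have hb := h.bonus_pos
  have hb' := h.bonus_le
  have hstep := h.step_pos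
  have hacc := h.acc_pos
  by_cases hat : a = ℓ.target F s
  · have hcut' : ℓ.acc ^ 2 ≤ dualSq s.2.2.1 (ℓ.gap F s) := hcut.resolve_left (not_not.2 hat)
    rw [cut, if_pos hat]
    refine ⟨le_trans (by gcongr; linarith) hcut', le_trans ?_ (h.cut_of_eq hF ha hat)⟩
    have : ℓ.acc ≤ √(dualSq s.2.2.1 (ℓ.gap F s)) := Real.le_sqrt_of_sq_le hcut'
    rw [bonus]
    nlinarith
  · have hz := h.cut_of_ne hF ha hat
    constructor
    · have cs := dotProduct_sq_le hs.ellipsoid_posDef (ℓ.cut F s a) (s.2.2.2 - γ)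
      have hm := hs.mem_ellipsoid
      have := dualSq_nonneg hs.ellipsoid_posDef (ℓ.cut F s a)
      calc (ℓ.bonus / 2) ^ 2 ≤ (ℓ.cut F s a ⬝ᵥ (s.2.2.2 - γ)) ^ 2 := by gcongr
        _ ≤ _ := cs
        _ ≤ _ := by nlinarith
    · have := Real.sqrt_nonneg (dualSq s.2.2.1 (ℓ.cut F s a))
      nlinarith [mul_nonneg hstep.le this]

theorem Fits.valid_next (h : ℓ.Fits E θ γ) (hs : Valid s γ) (hF : ℓ.IsNet (E.actionSet t) F)
    (ha : a ∈ bestResponses (E.actionSet t) E.cost (ℓ.offer F s)) (y : ℝ) :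
    Valid (ℓ.next F s (a, y)) γ where
  design_posDef := posDef_rankOneUpdate hs.design_posDef zero_le_one _
  le_design := le_dotProduct_rankOneUpdate zero_le_one hs.le_design _
  ellipsoid_posDef := by
    simp only [next]
    split_ifs
    · exact posDef_ellipsoidUpdate hs.ellipsoid_posDef h.step_pos.le _
    · exact hs.ellipsoid_posDef
  mem_ellipsoid := by
    simp only [next]
    split_ifs with hc
    · have hcs := h.cut_spec hs hF ha hc
      have := h.bonus_pos
      exact mem_ellipsoidUpdate hs.ellipsoid_posDef h.step_pos h.step_le hs.mem_ellipsoid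
        (lt_of_lt_of_le (by positivity) hcs.1) hcs.2
    · exact hs.mem_ellipsoid

theorem Fits.cut_self_le (h : ℓ.Fits E θ γ) (hF : ℓ.IsNet (E.actionSet t) F)
    (ha : a ∈ E.actionSet t) : ℓ.cut F s a ⬝ᵥ ℓ.cut F s a ≤ 4 * ℓ.bound ^ 2 := by
  have h1 := hF.2.1 (ℓ.target_spec hF.1 s).1
  rw [cut]
  split_ifs
  · exact h.dotProduct_sub_self_le h1 (hF.2.1 (ℓ.cheapest_spec hF.1 s).1)
  · exact h.dotProduct_sub_self_le (hF.2.1 (round_spec hF ha).1) h1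

/-- The regret of a round without a cut in which the estimates are accurate. -/
theorem Fits.profit_le (h : ℓ.Fits E θ γ) (hs : Valid s γ) (hF : ℓ.IsNet (E.actionSet t) F)
    (hcut : ¬ ℓ.Cuts F s a) (hconf : ℓ.Confident s θ) {b : α} (hb : b ∈ E.actionSet t) :
    E.reward b - E.cost b - (E.reward a - (ℓ.offer F s a : ℝ)) ≤
      2 * ℓ.radius * √(dualSq s.1 (ℓ.feat a)) + 2 * ℓ.acc := by
  obtain ⟨hat, hacc⟩ : a = ℓ.target F s ∧ dualSq s.2.2.1 (ℓ.gap F s) < ℓ.acc ^ 2 := by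
    simpa [Cuts] using hcut
  obtain ⟨c, hc, hbc⟩ := hF.2.2 b hb
  have h1 := (abs_le.1 (h.abs_dotProduct_le hbc h.reward_sq_le)).2
  have h2 := (abs_le.1 (h.abs_dotProduct_le hbc h.cost_sq_le)).1
  have h3 := (abs_le.1 (hconf c)).1
  have h4 := (abs_le.1 (hconf a)).2
  have h5 := (ℓ.target_spec hF.1 s).2 c hc
  have h6 : √(dualSq s.2.2.1 (ℓ.gap F s)) ≤ ℓ.acc := by
    rw [Real.sqrt_le_left h.acc_pos.le]; exact hacc.le
  have h7 : (ℓ.feat c - ℓ.feat (ℓ.cheapest F s)) ⬝ᵥ (s.2.2.2 - γ) ≤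
      √(dualSq s.2.2.1 (ℓ.feat c - ℓ.feat (ℓ.cheapest F s))) := by
    refine Real.le_sqrt_of_sq_le ((dotProduct_sq_le hs.ellipsoid_posDef _ _).trans ?_)
    have := dualSq_nonneg hs.ellipsoid_posDef (ℓ.feat c - ℓ.feat (ℓ.cheapest F s))
    nlinarith [hs.mem_ellipsoid]
  -- The payment covers only the cost gap to the cheapest action. Comparing it with full costs is
  -- harmless because the cost of that action is nonnegative.
  have h8 := (h.cost_mem t _ (hF.2.1 (ℓ.cheapest_spec hF.1 s).1)).1
  have h9 := h.bonus_le
  have h10 : ℓ.price F s ≤ s.2.2.2 ⬝ᵥ ℓ.gap F s + ℓ.bonus := by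
    rw [price]; linarith [min_le_left (s.2.2.2 ⬝ᵥ ℓ.gap F s) 1]
  have h11 := h.acc_pos
  rw [index, index, ← hat] at h5
  have h12 : ℓ.feat a - ℓ.feat (ℓ.cheapest F s) = ℓ.gap F s := by rw [hat, gap]
  rw [h12] at h5
  have h13 : s.2.2.2 ⬝ᵥ ℓ.gap F s =
      s.2.2.2 ⬝ᵥ ℓ.feat a - s.2.2.2 ⬝ᵥ ℓ.feat (ℓ.cheapest F s) := by
    rw [← h12, dotProduct_sub]
  have h14 : (ℓ.offer F s a : ℝ) = ℓ.price F s := by rw [hat, h.offer_target hF.1]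
  rw [dotProduct_sub, dotProduct_comm _ (estimate s)] at h3 h4
  rw [dotProduct_sub, sub_dotProduct, sub_dotProduct, dotProduct_comm _ s.2.2.2,
    dotProduct_comm _ s.2.2.2] at h7
  rw [h.cost_eq] at h8
  rw [h14, h.reward_eq, h.reward_eq, h.cost_eq]
  linarith

theorem Fits.offer_le (h : ℓ.Fits E θ γ) (hF : F.Nonempty) (s : LearnerState d) (a : α) :
    (ℓ.offer F s a : ℝ) ≤ 2 := by
  by_cases hat : a = ℓ.target F s
  · rw [hat, h.offer_target hF]
    linarith [ℓ.price_le F s, h.bonus_le, h.acc_le_one]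
  · rw [offer_of_ne hat]; norm_num

end Learner

/-! ### The regret on a path -/

namespace Learner

variable {α : Type} {d : ℕ} [Nonempty α] [MeasurableSpace α] [MeasurableEq α]
  {ℓ : Learner α d} {hℓ : Measurable ℓ.feat} {E : Environment α} {ag : Agent α}
  {θ γ : Fin d → ℝ} {ω : ℝ × (ℕ → ℝ)}

/-- The action of round `t` yields a cut. -/
def CutsAt (ℓ : Learner α d) (hℓ : Measurable ℓ.feat) (E : Environment α) (ag : Agent α) (t : ℕ)
    (ω : ℝ × (ℕ → ℝ)) : Prop :=
  ℓ.Cuts (ℓ.net (E.actionSet t)) (ℓ.stateAt hℓ E ag t ω) ((ℓ.policy hℓ).action E ag t ω)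

open Classical in
/-- The number of cuts before round `t`. -/
noncomputable def cutCount (ℓ : Learner α d) (hℓ : Measurable ℓ.feat) (E : Environment α)
    (ag : Agent α) (t : ℕ) (ω : ℝ × (ℕ → ℝ)) : ℝ :=
  ∑ s ∈ Finset.range t, if ℓ.CutsAt hℓ E ag s ω then 1 else 0

/-- The squared width of the confidence interval for the action of round `t`. -/
noncomputable def width (ℓ : Learner α d) (hℓ : Measurable ℓ.feat) (E : Environment α)
    (ag : Agent α) (t : ℕ) (ω : ℝ × (ℕ → ℝ)) : ℝ :=
  dualSq (ℓ.stateAt hℓ E ag t ω).1 (ℓ.feat ((ℓ.policy hℓ).action E ag t ω))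

theorem action_mem (h : (ℓ.policy hℓ).IsBestResponding E ag) (t : ℕ) (ω : ℝ × (ℕ → ℝ)) :
    (ℓ.policy hℓ).action E ag t ω ∈ bestResponses (E.actionSet t) E.cost
      (ℓ.offer (ℓ.net (E.actionSet t)) (ℓ.stateAt hℓ E ag t ω)) :=
  h.mem_bestResponses t ω

theorem Fits.valid_stateAt (hf : ℓ.Fits E θ γ) (h : (ℓ.policy hℓ).IsBestResponding E ag) (t : ℕ)
    (ω : ℝ × (ℕ → ℝ)) : Valid (ℓ.stateAt hℓ E ag t ω) γ := by
  induction t with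
  | zero => exact hf.valid_init
  | succ t ih =>
    rw [stateAt_succ]
    exact hf.valid_next ih (hf.isNet t) (action_mem h t ω) _

theorem cutCount_le_self (t : ℕ) : ℓ.cutCount hℓ E ag t ω ≤ t := by
  rw [cutCount]
  refine (Finset.sum_le_card_nsmul _ _ 1 fun s _ => ?_).trans (by simp)
  split_ifs <;> norm_num

theorem cutCount_succ (t : ℕ) [Decidable (ℓ.CutsAt hℓ E ag t ω)] :
    ℓ.cutCount hℓ E ag (t + 1) ω =
      ℓ.cutCount hℓ E ag t ω + if ℓ.CutsAt hℓ E ag t ω then 1 else 0 := by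
  rw [cutCount, Finset.sum_range_succ, ← cutCount]
  congr

theorem Fits.le_det_ellipsoid (hf : ℓ.Fits E θ γ) (h : (ℓ.policy hℓ).IsBestResponding E ag)
    (t : ℕ) (ω : ℝ × (ℕ → ℝ)) :
    Real.exp (ℓ.cutCount hℓ E ag t ω / (8 * d)) * (ℓ.bound ^ 2)⁻¹ ^ d ≤
      (ℓ.stateAt hℓ E ag t ω).2.2.1.det := by
  classical
  induction t with
  | zero => simp [cutCount, stateAt_zero, init]
  | succ t ih =>
    have hv := hf.valid_stateAt h t ω
    rw [cutCount_succ, stateAt_succ, next]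
    by_cases hc : ℓ.CutsAt hℓ E ag t ω
    · have hs := hf.cut_spec hv (hf.isNet t) (action_mem h t ω) hc
      have hb := hf.bonus_pos
      have hd := det_ellipsoidUpdate hf.one_le_dim hv.ellipsoid_posDef
        (lt_of_lt_of_le (by positivity) hs.1)
      simp only [if_pos hc, if_pos (show ℓ.Cuts _ _ _ from hc)]
      rw [add_div, Real.exp_add]
      refine le_trans ?_ hd
      calc _ = Real.exp (1 / (8 * d)) *
            (Real.exp (ℓ.cutCount hℓ E ag t ω / (8 * d)) * (ℓ.bound ^ 2)⁻¹ ^ d) := by ring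
        _ ≤ _ := by gcongr
    · simp only [if_neg hc, if_neg (show ¬ ℓ.Cuts _ _ _ from hc), add_zero]
      exact ih

/-- Cut directions have norm at most `2 * bound` and width at least `bonus / 2`, so each cut adds a
bounded amount. This amount is polynomial in `T` for `acc = 1 / √T`, which suffices inside a
logarithm. -/
theorem Fits.trace_ellipsoid_le (hf : ℓ.Fits E θ γ) (h : (ℓ.policy hℓ).IsBestResponding E ag)
    (t : ℕ) (ω : ℝ × (ℕ → ℝ)) :
    (ℓ.stateAt hℓ E ag t ω).2.2.1.trace ≤
      d + ℓ.cutCount hℓ E ag t ω * (4 * ℓ.bound ^ 2 / (ℓ.bonus / 2) ^ 2) := by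
  classical
  induction t with
  | zero =>
    have hb := hf.one_le_bound
    have : (ℓ.bound ^ 2)⁻¹ ≤ 1 := inv_le_one_of_one_le₀ (by nlinarith)
    simp only [stateAt_zero, init, Matrix.trace_smul, Matrix.trace_one, Fintype.card_fin,
      smul_eq_mul, cutCount, Finset.range_zero, Finset.sum_empty, zero_mul, add_zero]
    nlinarith [(Nat.cast_nonneg d : (0 : ℝ) ≤ d)]
  | succ t ih =>
    have hv := hf.valid_stateAt h t ω
    have hb := hf.bonus_pos
    rw [cutCount_succ, stateAt_succ, next]
    by_cases hc : ℓ.CutsAt hℓ E ag t ω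
    · have hs := hf.cut_spec hv (hf.isNet t) (action_mem h t ω) hc
      have ht := trace_ellipsoidUpdate_le hv.ellipsoid_posDef hf.step_pos.le
        (by positivity : 0 < (ℓ.bonus / 2) ^ 2) hs.1
      simp only [if_pos hc, if_pos (show ℓ.Cuts _ _ _ from hc)]
      refine ht.trans ?_
      have hw := hf.cut_self_le (s := ℓ.stateAt hℓ E ag t ω) (hf.isNet t) (action_mem h t ω).1
      have h0 := dotProduct_self_nonneg' (ℓ.cut (ℓ.net (E.actionSet t)) (ℓ.stateAt hℓ E ag t ω)
        ((ℓ.policy hℓ).action E ag t ω))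
      have : ℓ.step * (ℓ.cut (ℓ.net (E.actionSet t)) (ℓ.stateAt hℓ E ag t ω)
          ((ℓ.policy hℓ).action E ag t ω) ⬝ᵥ ℓ.cut (ℓ.net (E.actionSet t))
          (ℓ.stateAt hℓ E ag t ω) ((ℓ.policy hℓ).action E ag t ω)) / (ℓ.bonus / 2) ^ 2 ≤
          4 * ℓ.bound ^ 2 / (ℓ.bonus / 2) ^ 2 := by
        exact div_le_div_of_nonneg_right (by nlinarith [hf.step_le, hf.step_pos]) (by positivity)
      linarith
    · simp only [if_neg hc, if_neg (show ¬ ℓ.Cuts _ _ _ from hc), add_zero]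
      exact ih

/-- The number of cuts is logarithmic. -/
theorem Fits.cutCount_le (hf : ℓ.Fits E θ γ) (h : (ℓ.policy hℓ).IsBestResponding E ag)
    (T : ℕ) (ω : ℝ × (ℕ → ℝ)) :
    ℓ.cutCount hℓ E ag T ω ≤ 8 * d ^ 2 *
      Real.log (ℓ.bound ^ 2 * (d + T * (4 * ℓ.bound ^ 2 / (ℓ.bonus / 2) ^ 2))) := by
  have hd : (1 : ℝ) ≤ d := by exact_mod_cast hf.one_le_dim
  have hR := hf.one_le_bound
  have hb := hf.bonus_pos
  set M := d + T * (4 * ℓ.bound ^ 2 / (ℓ.bonus / 2) ^ 2) with hM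
  have hM0 : 0 < M := by positivity
  have hv := (hf.valid_stateAt h T ω).ellipsoid_posDef
  have h1 := (hf.le_det_ellipsoid h T ω).trans (det_le_trace_pow hv)
  have h2 : (ℓ.stateAt hℓ E ag T ω).2.2.1.trace ≤ M := by
    refine (hf.trace_ellipsoid_le h T ω).trans ?_
    rw [hM]
    gcongr
    exact cutCount_le_self T
  have h3 : Real.exp (ℓ.cutCount hℓ E ag T ω / (8 * d)) ≤ (ℓ.bound ^ 2 * M) ^ d := by
    have h4 := h1.trans (pow_le_pow_left₀ hv.posSemidef.trace_nonneg h2 d)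
    rw [inv_pow, ← div_eq_mul_inv, div_le_iff₀ (by positivity)] at h4
    rw [mul_pow]
    linarith
  have h5 := Real.log_le_log (Real.exp_pos _) h3
  rw [Real.log_exp, Real.log_pow, div_le_iff₀ (by positivity)] at h5
  linarith

theorem Fits.trace_design_le (hf : ℓ.Fits E θ γ) (h : (ℓ.policy hℓ).IsBestResponding E ag)
    (t : ℕ) (ω : ℝ × (ℕ → ℝ)) :
    (ℓ.stateAt hℓ E ag t ω).1.trace ≤ d + t * ℓ.bound ^ 2 := by
  induction t with
  | zero => simp [stateAt_zero, init]
  | succ t ih =>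
    rw [stateAt_succ, next, trace_rankOneUpdate]
    have := hf.feat_sq_le t _ (action_mem h t ω).1
    push_cast
    linarith

theorem Fits.det_design_le (hf : ℓ.Fits E θ γ) (h : (ℓ.policy hℓ).IsBestResponding E ag)
    {t T : ℕ} (ht : t ≤ T) (ω : ℝ × (ℕ → ℝ)) :
    (ℓ.stateAt hℓ E ag t ω).1.det ≤ (d + T * ℓ.bound ^ 2) ^ d := by
  have hv := (hf.valid_stateAt h t ω).design_posDef
  refine (det_le_trace_pow hv).trans (pow_le_pow_left₀ hv.posSemidef.trace_nonneg ?_ d)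
  refine (hf.trace_design_le h t ω).trans ?_
  gcongr

theorem Fits.width_nonneg (hf : ℓ.Fits E θ γ) (h : (ℓ.policy hℓ).IsBestResponding E ag)
    (t : ℕ) (ω : ℝ × (ℕ → ℝ)) : 0 ≤ ℓ.width hℓ E ag t ω :=
  dualSq_nonneg (hf.valid_stateAt h t ω).design_posDef _

theorem det_design_succ (hf : ℓ.Fits E θ γ) (h : (ℓ.policy hℓ).IsBestResponding E ag)
    (t : ℕ) (ω : ℝ × (ℕ → ℝ)) :
    (ℓ.stateAt hℓ E ag (t + 1) ω).1.det =
      (ℓ.stateAt hℓ E ag t ω).1.det * (1 + ℓ.width hℓ E ag t ω) := by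
  rw [stateAt_succ, next, det_rankOneUpdate (hf.valid_stateAt h t ω).design_posDef, one_mul, width]

/-- The log-determinant grows by `log (1 + width)` in each round. As widths are at most `bound ^ 2`,
this logarithm is comparable to the width itself. -/
theorem Fits.sum_width_le_log_det (hf : ℓ.Fits E θ γ)
    (h : (ℓ.policy hℓ).IsBestResponding E ag) (t : ℕ) (ω : ℝ × (ℕ → ℝ)) :
    ∑ s ∈ Finset.range t, ℓ.width hℓ E ag s ω ≤
      (1 + ℓ.bound ^ 2) * Real.log (ℓ.stateAt hℓ E ag t ω).1.det := by
  induction t with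
  | zero => simp [stateAt_zero, init]
  | succ t ih =>
    have hv := hf.valid_stateAt h t ω
    have h0 := hf.width_nonneg h t ω
    have h1 : ℓ.width hℓ E ag t ω ≤ ℓ.bound ^ 2 :=
      (dualSq_le_dotProduct hv.design_posDef hv.le_design _).trans
        (hf.feat_sq_le t _ (action_mem h t ω).1)
    rw [det_design_succ hf h, Real.log_mul hv.design_posDef.det_pos.ne' (by positivity),
      Finset.sum_range_succ, mul_add]
    refine add_le_add ih ?_
    have h2 := Real.one_sub_inv_le_log_of_pos (show 0 < 1 + ℓ.width hℓ E ag t ω by positivity)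
    have h3 : ℓ.width hℓ E ag t ω =
        (1 + ℓ.width hℓ E ag t ω) * (1 - (1 + ℓ.width hℓ E ag t ω)⁻¹) := by
      field_simp; ring
    have h4 : 0 ≤ 1 - (1 + ℓ.width hℓ E ag t ω)⁻¹ :=
      sub_nonneg.2 (inv_le_one_of_one_le₀ (by linarith))
    calc ℓ.width hℓ E ag t ω
        = (1 + ℓ.width hℓ E ag t ω) * (1 - (1 + ℓ.width hℓ E ag t ω)⁻¹) := h3
      _ ≤ (1 + ℓ.bound ^ 2) * Real.log (1 + ℓ.width hℓ E ag t ω) := by gcongr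

/-- The elliptical potential lemma. -/
theorem Fits.sum_sqrt_width_le (hf : ℓ.Fits E θ γ)
    (h : (ℓ.policy hℓ).IsBestResponding E ag) (T : ℕ) (ω : ℝ × (ℕ → ℝ)) :
    ∑ t ∈ Finset.range T, √(ℓ.width hℓ E ag t ω) ≤
      √T * √((1 + ℓ.bound ^ 2) * (d * Real.log (d + T * ℓ.bound ^ 2))) := by
  have hv := hf.valid_stateAt h T ω
  have h1 : ∑ s ∈ Finset.range T, ℓ.width hℓ E ag s ω ≤
      (1 + ℓ.bound ^ 2) * (d * Real.log (d + T * ℓ.bound ^ 2)) := by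
    refine (hf.sum_width_le_log_det h T ω).trans ?_
    gcongr
    rw [← Real.log_pow]
    exact Real.log_le_log hv.design_posDef.det_pos (hf.det_design_le h le_rfl ω)
  rw [← Real.sqrt_mul (Nat.cast_nonneg T)]
  refine Real.le_sqrt_of_sq_le ?_
  have h2 := sq_sum_le_card_mul_sum_sq (s := Finset.range T)
    (f := fun t => √(ℓ.width hℓ E ag t ω))
  rw [Finset.card_range] at h2
  refine h2.trans ?_
  simp_rw [Real.sq_sqrt (hf.width_nonneg h _ ω)]
  gcongr

/-- The estimate of round `t` is not accurate. -/
def BadAt (ℓ : Learner α d) (hℓ : Measurable ℓ.feat) (E : Environment α) (ag : Agent α)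
    (θ : Fin d → ℝ) (t : ℕ) : Set (ℝ × (ℕ → ℝ)) :=
  {ω | ¬ ℓ.Confident (ℓ.stateAt hℓ E ag t ω) θ}

/-- The regret of round `t`. -/
noncomputable def roundRegret (ℓ : Learner α d) (hℓ : Measurable ℓ.feat) (E : Environment α)
    (ag : Agent α) (t : ℕ) (ω : ℝ × (ℕ → ℝ)) : ℝ :=
  (⨆ a : E.actionSet t, (E.reward a - E.cost a)) -
    (E.reward ((ℓ.policy hℓ).action E ag t ω) -
      ((ℓ.policy hℓ).posted E ag t ω ((ℓ.policy hℓ).action E ag t ω) : ℝ))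

theorem Fits.abs_roundRegret_le (hf : ℓ.Fits E θ γ)
    (h : (ℓ.policy hℓ).IsBestResponding E ag) (t : ℕ) (ω : ℝ × (ℕ → ℝ)) :
    |ℓ.roundRegret hℓ E ag t ω| ≤ 3 := by
  have ha := (action_mem h t ω).1
  have : Nonempty (E.actionSet t) := ⟨⟨_, ha⟩⟩
  have hle : ∀ a : E.actionSet t, E.reward a - E.cost a ≤ 1 := fun a => by
    linarith [(hf.reward_mem t a a.2).2, (hf.cost_mem t a a.2).1]
  have h1 : (⨆ a : E.actionSet t, (E.reward a - E.cost a)) ≤ 1 := ciSup_le hle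
  have h2 := le_ciSup (f := fun a : E.actionSet t => E.reward a - E.cost a)
    ⟨1, by rintro _ ⟨a, rfl⟩; exact hle a⟩ ⟨_, ha⟩
  have h3 := hf.reward_mem t _ ha
  have h4 := hf.cost_mem t _ ha
  have h5 := hf.offer_le (hf.isNet t).1 (ℓ.stateAt hℓ E ag t ω) ((ℓ.policy hℓ).action E ag t ω)
  rw [roundRegret, posted_eq, abs_le]
  simp only at h2
  constructor
  · linarith [h3.1, h3.2, h4.2, NNReal.coe_nonneg (ℓ.offer (ℓ.net (E.actionSet t))
      (ℓ.stateAt hℓ E ag t ω) ((ℓ.policy hℓ).action E ag t ω))]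
  · linarith [h3.1]

-- Rounds with a cut or with an inaccurate estimate are charged the trivial bound `3`; in all others
-- optimism applies.
open Classical in
theorem Fits.roundRegret_le (hf : ℓ.Fits E θ γ)
    (h : (ℓ.policy hℓ).IsBestResponding E ag) (t : ℕ) (ω : ℝ × (ℕ → ℝ)) :
    ℓ.roundRegret hℓ E ag t ω ≤ 3 * (if ℓ.CutsAt hℓ E ag t ω then 1 else 0) +
      2 * ℓ.radius * √(ℓ.width hℓ E ag t ω) + 2 * ℓ.acc +
      3 * (ℓ.BadAt hℓ E ag θ t).indicator 1 ω := by
  have h1 := (abs_le.1 (hf.abs_roundRegret_le h t ω)).2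
  have h2 : 0 ≤ 2 * ℓ.radius * √(ℓ.width hℓ E ag t ω) :=
    mul_nonneg (mul_nonneg zero_le_two hf.radius_nonneg) (Real.sqrt_nonneg _)
  have h3 := hf.acc_pos
  by_cases hc : ℓ.CutsAt hℓ E ag t ω
  · have : 0 ≤ (ℓ.BadAt hℓ E ag θ t).indicator (1 : ℝ × (ℕ → ℝ) → ℝ) ω :=
      Set.indicator_nonneg (fun _ _ => zero_le_one) _
    rw [if_pos hc]
    linarith
  · by_cases hb : ω ∈ ℓ.BadAt hℓ E ag θ t
    · rw [if_neg hc, Set.indicator_of_mem hb]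
      simp only [Pi.one_apply]
      linarith
    · rw [if_neg hc, Set.indicator_of_notMem hb]
      have : Nonempty (E.actionSet t) := ⟨⟨_, (action_mem h t ω).1⟩⟩
      have h4 : ∀ b : E.actionSet t, E.reward b - E.cost b ≤
          (E.reward ((ℓ.policy hℓ).action E ag t ω) -
            ((ℓ.policy hℓ).posted E ag t ω ((ℓ.policy hℓ).action E ag t ω) : ℝ)) +
          (2 * ℓ.radius * √(ℓ.width hℓ E ag t ω) + 2 * ℓ.acc) := fun b => by
        have := hf.profit_le (hf.valid_stateAt h t ω) (hf.isNet t) hc (not_not.1 hb) b.2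
        rw [posted_eq, width]
        linarith
      have := ciSup_le h4
      rw [roundRegret]
      linarith

theorem Fits.regret_le (hf : ℓ.Fits E θ γ)
    (h : (ℓ.policy hℓ).IsBestResponding E ag) (T : ℕ) (ω : ℝ × (ℕ → ℝ)) :
    (ℓ.policy hℓ).regret E ag T ω ≤
      3 * (8 * d ^ 2 *
        Real.log (ℓ.bound ^ 2 * (d + T * (4 * ℓ.bound ^ 2 / (ℓ.bonus / 2) ^ 2)))) +
      2 * ℓ.radius * (√T * √((1 + ℓ.bound ^ 2) * (d * Real.log (d + T * ℓ.bound ^ 2)))) +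
      2 * ℓ.acc * T +
      ∑ t ∈ Finset.range T, 3 * (ℓ.BadAt hℓ E ag θ t).indicator (1 : ℝ × (ℕ → ℝ) → ℝ) ω := by
  classical
  have h1 := Finset.sum_le_sum fun t (_ : t ∈ Finset.range T) => hf.roundRegret_le h t ω
  rw [Finset.sum_add_distrib, Finset.sum_add_distrib, Finset.sum_add_distrib, ← Finset.mul_sum,
    ← Finset.mul_sum _ _ (2 * ℓ.radius), Finset.sum_const, Finset.card_range, nsmul_eq_mul] at h1
  have h2 := hf.cutCount_le h T ω
  have h3 := mul_le_mul_of_nonneg_left (hf.sum_sqrt_width_le h T ω)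
    (mul_nonneg zero_le_two hf.radius_nonneg)
  rw [cutCount] at h2
  change ∑ t ∈ Finset.range T, ℓ.roundRegret hℓ E ag t ω ≤ _
  linarith

end Learner

/-! ### Concentration of the estimates -/

theorem Policy.isProbabilityMeasure_law {α : Type} [MeasurableSpace α] (π : Policy α)
    {E : Environment α} {σ : ℝ≥0} (h : IsSubgaussianNoise σ E.noise) :
    IsProbabilityMeasure (π.law E) := by
  have := h.isProbabilityMeasure
  have := π.isProbabilityMeasure_seedLaw
  rw [Policy.law]
  infer_instance

theorem Policy.lintegral_law_resample {α : Type} [MeasurableSpace α] (π : Policy α)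
    {E : Environment α} (h : IsProbabilityMeasure E.noise) (t : ℕ)
    {G : ℝ × (ℕ → ℝ) → ENNReal} (hG : Measurable G) :
    ∫⁻ ω, G ω ∂(π.law E) = ∫⁻ ω, ∫⁻ z, G (resample t ω z) ∂E.noise ∂(π.law E) := by
  have := π.isProbabilityMeasure_seedLaw
  exact lintegral_resample _ _ t hG

namespace Learner

variable {α : Type} {d : ℕ}

/-- The sum of the features of the actions taken, weighted with the noise. -/
noncomputable def noiseSum (s : LearnerState d) (θ : Fin d → ℝ) : Fin d → ℝ :=
  s.2.1 - s.1.mulVec θ + θ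

/-- The potential of the concentration argument. -/
noncomputable def potential (σ : ℝ) (s : LearnerState d) (θ : Fin d → ℝ) : ℝ :=
  Real.exp (dualSq s.1 (noiseSum s θ) / (2 * σ ^ 2)) / √s.1.det

theorem measurable_potential {Ω : Type} [MeasurableSpace Ω] {s : Ω → LearnerState d} (σ : ℝ)
    (θ : Fin d → ℝ) (hs : Measurable s) : Measurable fun ω => potential σ (s ω) θ := by
  have h : Measurable fun ω => noiseSum (s ω) θ :=
    (hs.snd.fst.sub (hs.fst.matrix_mulVec measurable_const)).add measurable_const
  exact ((hs.fst.dualSq h).div_const _).exp.div hs.fst.matrix_det.sqrt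

/-- The supermartingale step. The exponent is quadratic in `z`, and the quadratic moment bound with
`v = 1 + q` is sharp enough that its factor `√(1 + q)` cancels the growth of the determinant, while
its exponential cancels the decrease of the dual norm of `N`. -/
theorem lintegral_exp_dualSq_le {σ : ℝ≥0} (hσ : 0 < σ) {ν : Measure ℝ}
    (h : IsSubgaussianNoise σ ν) {V : Matrix (Fin d) (Fin d) ℝ} (hV : V.PosDef)
    (N a : Fin d → ℝ) :
    ∫⁻ z, ENNReal.ofReal (Real.exp (dualSq (rankOneUpdate V 1 a) (N + z • a) / (2 * σ ^ 2)) /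
        √(rankOneUpdate V 1 a).det) ∂ν ≤
      ENNReal.ofReal (Real.exp (dualSq V N / (2 * σ ^ 2)) / √V.det) := by
  have hσ' : (0 : ℝ) < σ := hσ
  set q := dualSq V a with hq
  set m := a ⬝ᵥ V⁻¹.mulVec N with hm
  have hq0 : 0 ≤ q := dualSq_nonneg hV a
  have hv : 0 < 1 + q := by positivity
  set α := m / (σ ^ 2 * (1 + q)) with hα
  set b := √(q / (σ ^ 2 * (1 + q))) with hb
  have hb2 : b ^ 2 = q / (σ ^ 2 * (1 + q)) := Real.sq_sqrt (by positivity)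
  have hD : 0 < V.det := hV.det_pos
  set K := Real.exp (dualSq V N / (2 * σ ^ 2)) * Real.exp (-(m ^ 2 / (2 * σ ^ 2 * (1 + q)))) /
    (√V.det * √(1 + q)) with hK
  have hK0 : 0 ≤ K := by positivity
  have e : ∀ z : ℝ, Real.exp (dualSq (rankOneUpdate V 1 a) (N + z • a) / (2 * σ ^ 2)) /
      √(rankOneUpdate V 1 a).det = K * Real.exp (α * z + b ^ 2 * z ^ 2 / 2) := by
    intro z
    rw [dualSq_rankOneUpdate_add_smul hV, det_rankOneUpdate hV, one_mul, ← hq, ← hm,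
      Real.sqrt_mul hD.le, hK, div_mul_eq_mul_div, ← Real.exp_add, ← Real.exp_add, hb2, hα]
    congr 2
    field_simp
    ring
  simp_rw [e, ENNReal.ofReal_mul hK0]
  rw [lintegral_const_mul _ (by fun_prop)]
  refine (mul_le_mul_right (lintegral_exp_quadratic_le h hv (b := b) ?_) _).trans_eq ?_
  · rw [hb2]; field_simp; ring
  · rw [← ENNReal.ofReal_mul hK0]
    congr 1
    have h1 : √(1 + q) ≠ 0 := (Real.sqrt_pos.2 hv).ne'
    have e2 : α ^ 2 * σ ^ 2 * (1 + q) / 2 = m ^ 2 / (2 * σ ^ 2 * (1 + q)) := by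
      rw [hα]; field_simp
    rw [hK, e2, Real.exp_neg]
    have h2 := (Real.exp_pos (m ^ 2 / (2 * σ ^ 2 * (1 + q)))).ne'
    field_simp

theorem confident_of_dualSq_le {ℓ : Learner α d} {E : Environment α} {θ γ : Fin d → ℝ}
    {s : LearnerState d} {q : ℝ} (hf : ℓ.Fits E θ γ) (hs : Valid s γ)
    (hq : dualSq s.1 (noiseSum s θ) ≤ q) (hr : 2 * q + 2 * ℓ.bound ^ 2 ≤ ℓ.radius ^ 2) :
    ℓ.Confident s θ := by
  intro b
  have hV := hs.design_posDef
  set N := noiseSum s θ with hN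
  have e : estimate s - θ = s.1⁻¹.mulVec (N - θ) := by
    rw [hN, noiseSum, add_sub_cancel_right, Matrix.mulVec_sub, hV.inv_mulVec_mulVec, estimate]
  have h1 : dualSq s.1 (N - θ) ≤ ℓ.radius ^ 2 := by
    have h2 := dualSq_nonneg hV (N + θ)
    have h3 := (dualSq_le_dotProduct hV hs.le_design θ).trans hf.reward_sq_le
    -- The parallelogram law separates the noise from the bias `θ` of the regularisation.
    have h4 : dualSq s.1 (N - θ) = 2 * dualSq s.1 N + 2 * dualSq s.1 θ - dualSq s.1 (N + θ) := by
      simp only [dualSq, Matrix.mulVec_sub, Matrix.mulVec_add, dotProduct_sub, sub_dotProduct,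
        dotProduct_add, add_dotProduct]
      ring
    linarith
  refine abs_le_of_sq_le_sq ?_ (mul_nonneg hf.radius_nonneg (Real.sqrt_nonneg _))
  have h5 := dualSq_nonneg hV (ℓ.feat b)
  rw [mul_pow, Real.sq_sqrt h5, e]
  refine (dotProduct_sq_le hV _ _).trans ?_
  rw [hV.mulVec_inv_mulVec, dotProduct_comm, mul_comm]
  exact mul_le_mul_of_nonneg_right h1 h5

theorem Fits.measurable_reward [MeasurableSpace α] {ℓ : Learner α d} {E : Environment α}
    {θ γ : Fin d → ℝ} (hf : ℓ.Fits E θ γ) (hℓ : Measurable ℓ.feat) :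
    Measurable E.reward := by
  rw [show E.reward = fun a => ℓ.feat a ⬝ᵥ θ from funext hf.reward_eq]
  exact hℓ.dotProduct measurable_const

theorem Fits.measurable_cost [MeasurableSpace α] {ℓ : Learner α d} {E : Environment α}
    {θ γ : Fin d → ℝ} (hf : ℓ.Fits E θ γ) (hℓ : Measurable ℓ.feat) :
    Measurable E.cost := by
  rw [show E.cost = fun a => ℓ.feat a ⬝ᵥ γ from funext hf.cost_eq]
  exact hℓ.dotProduct measurable_const

/-- The mean reward added to the response equals what the rank-one update adds to the design matrix
applied to `θ`, so only noise survives. -/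
theorem noiseSum_next [Nonempty α] {ℓ : Learner α d} {E : Environment α} {θ γ : Fin d → ℝ}
    (hf : ℓ.Fits E θ γ) (F : Finset α) (s : LearnerState d) (a : α) (z : ℝ) :
    noiseSum (ℓ.next F s (a, E.reward a + z)) θ = noiseSum s θ + z • ℓ.feat a := by
  simp only [noiseSum, next, rankOneUpdate_mulVec, hf.reward_eq, one_mul, add_smul]
  abel

variable [Nonempty α] [MeasurableSpace α] [MeasurableEq α]
  {ℓ : Learner α d} {hℓ : Measurable ℓ.feat} {E : Environment α} {ag : Agent α}
  {θ γ : Fin d → ℝ} {σ : ℝ≥0}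

theorem Fits.measurable_stateAt (hf : ℓ.Fits E θ γ) (t : ℕ)
    (h : ∀ s < t, Measurable ((ℓ.policy hℓ).action E ag s)) :
    Measurable (ℓ.stateAt hℓ E ag t) :=
  (measurable_state hℓ t _).comp
    (Policy.measurable_history (hf.measurable_reward hℓ) t h)

theorem stateAt_resample (t : ℕ) (ω : ℝ × (ℕ → ℝ)) (z : ℝ) :
    ℓ.stateAt hℓ E ag t (resample t ω z) = ℓ.stateAt hℓ E ag t ω := by
  rw [stateAt, Policy.history_resample t ω z t le_rfl]
  rfl

theorem Fits.lintegral_potential_le (hf : ℓ.Fits E θ γ) (hσ : 0 < σ)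
    (hν : IsSubgaussianNoise σ E.noise) (h : (ℓ.policy hℓ).IsBestResponding E ag) (t : ℕ) :
    ∫⁻ ω, ENNReal.ofReal (potential σ (ℓ.stateAt hℓ E ag t ω) θ) ∂((ℓ.policy hℓ).law E) ≤ 1 := by
  have := (ℓ.policy hℓ).isProbabilityMeasure_law hν
  induction t with
  | zero => simp [stateAt_zero, init, potential, noiseSum, dualSq]
  | succ t ih =>
    have hm : Measurable fun ω =>
        ENNReal.ofReal (potential σ (ℓ.stateAt hℓ E ag (t + 1) ω) θ) :=
      (measurable_potential _ _
        (hf.measurable_stateAt (t + 1) fun s _ => h.measurable_action s)).ennreal_ofReal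
    rw [(ℓ.policy hℓ).lintegral_law_resample hν.isProbabilityMeasure t hm]
    refine (lintegral_mono fun ω => ?_).trans ih
    have hv := (hf.valid_stateAt h t ω).design_posDef
    refine le_trans (le_of_eq (lintegral_congr fun z => ?_))
      (lintegral_exp_dualSq_le hσ hν hv (noiseSum (ℓ.stateAt hℓ E ag t ω) θ)
        (ℓ.feat ((ℓ.policy hℓ).action E ag t ω)))
    have hz : (resample t ω z).2 t = z := by simp [resample]
    rw [stateAt_succ, stateAt_resample, Policy.action_resample, hz, potential, noiseSum_next hf]
    rfl

/-- The estimates are accurate with high probability. -/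
theorem Fits.measure_badAt_le (hf : ℓ.Fits E θ γ) (hσ : 0 < σ)
    (hν : IsSubgaussianNoise σ E.noise) (h : (ℓ.policy hℓ).IsBestResponding E ag) {t T : ℕ}
    (hT : 1 ≤ T) (ht : t ≤ T)
    (hr : 2 * (2 * σ ^ 2 * (Real.log T + d / 2 * Real.log (d + T * ℓ.bound ^ 2))) +
      2 * ℓ.bound ^ 2 ≤ ℓ.radius ^ 2) :
    ((ℓ.policy hℓ).law E).real (ℓ.BadAt hℓ E ag θ t) ≤ 1 / T := by
  have := (ℓ.policy hℓ).isProbabilityMeasure_law hν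
  have hσ' : (0 : ℝ) < σ := hσ
  have hT' : (0 : ℝ) < T := by exact_mod_cast hT
  have hd : (1 : ℝ) ≤ d := by exact_mod_cast hf.one_le_dim
  set q := 2 * σ ^ 2 * (Real.log T + d / 2 * Real.log (d + T * ℓ.bound ^ 2)) with hq
  have hm : Measurable fun ω => ENNReal.ofReal (potential σ (ℓ.stateAt hℓ E ag t ω) θ) :=
    (measurable_potential _ _
      (hf.measurable_stateAt t fun s _ => h.measurable_action s)).ennreal_ofReal
  have hsub : ℓ.BadAt hℓ E ag θ t ⊆
      {ω | (T : ENNReal) ≤ ENNReal.ofReal (potential σ (ℓ.stateAt hℓ E ag t ω) θ)} := by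
    intro ω hω
    have hv := hf.valid_stateAt h t ω
    have h1 : q < dualSq (ℓ.stateAt hℓ E ag t ω).1 (noiseSum (ℓ.stateAt hℓ E ag t ω) θ) := by
      by_contra hle
      exact hω (confident_of_dualSq_le hf hv (not_lt.1 hle) hr)
    have hdet := hf.det_design_le h ht ω
    have hpos := hv.design_posDef.det_pos
    set M : ℝ := d + T * ℓ.bound ^ 2 with hM
    have hM0 : 0 < M := by positivity
    -- The threshold `q` is chosen so that on the bad event the potential is at least `T`, whatever
    -- the determinant; Markov's inequality then gives `1 / T`.
    have h2 : Real.exp (q / (2 * σ ^ 2)) = T * √(M ^ d) := by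
      rw [hq, mul_div_cancel_left₀ _ (by positivity), Real.exp_add, Real.exp_log hT',
        Real.sqrt_eq_rpow, ← Real.rpow_natCast, ← Real.rpow_mul hM0.le, Real.rpow_def_of_pos hM0]
      ring_nf
    rw [Set.mem_ofPred_eq, ← ENNReal.ofReal_natCast]
    refine ENNReal.ofReal_le_ofReal ?_
    rw [potential, le_div_iff₀ (Real.sqrt_pos.2 hpos)]
    calc (T : ℝ) * √(ℓ.stateAt hℓ E ag t ω).1.det ≤ T * √(M ^ d) := by gcongr
      _ = Real.exp (q / (2 * σ ^ 2)) := h2.symm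
      _ ≤ _ := by
        apply Real.exp_le_exp.2
        gcongr
  have h3 : (ℓ.policy hℓ).law E (ℓ.BadAt hℓ E ag θ t) ≤ 1 / T := by
    refine (measure_mono hsub).trans ?_
    refine (meas_ge_le_lintegral_div hm.aemeasurable (by positivity) (by simp)).trans ?_
    exact ENNReal.div_le_div_right (hf.lintegral_potential_le hσ hν h t) _
  have h4 := ENNReal.toReal_mono (by simp; omega) h3
  simpa [Measure.real] using h4

end Learner

/-! ### Agents that break ties in favor of the principal -/

namespace Learner

variable {α : Type} {d : ℕ} [Nonempty α] {ℓ : Learner α d} {E : Environment α} {θ γ : Fin d → ℝ}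

/-- The agent who takes the action for which the contract pays unless, for him or for the principal
in the case of a tie, the action `b t` is better. -/
noncomputable def favoringAgent (E : Environment α) (b : ℕ → α) : Agent α := by
  classical
  exact fun t x =>
    let a := Classical.epsilon fun a => x a ≠ 0
    if -E.cost (b t) < x a - E.cost a ∨
      (-E.cost (b t) = x a - E.cost a ∧ E.reward (b t) ≤ E.reward a - x a) then a else b t

-- The price is positive, so the target is the only paid action and an agent who sees nothing but
-- the contract can recover it.
open Classical in
theorem Fits.favoringAgent_offer (hf : ℓ.Fits E θ γ) {F : Finset α} (hF : F.Nonempty)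
    (b : ℕ → α) (t : ℕ) (s : LearnerState d) :
    favoringAgent E b t (ℓ.offer F s) =
      if -E.cost (b t) < ℓ.price F s - E.cost (ℓ.target F s) ∨
        (-E.cost (b t) = ℓ.price F s - E.cost (ℓ.target F s) ∧
          E.reward (b t) ≤ E.reward (ℓ.target F s) - ℓ.price F s)
      then ℓ.target F s else b t := by
  have hp := hf.bonus_pos.trans_le (ℓ.bonus_le_price hF s)
  have h0 : ℓ.offer F s (ℓ.target F s) ≠ 0 := by
    rw [← NNReal.coe_ne_zero, hf.offer_target hF]
    exact hp.ne'
  have h1 : (Classical.epsilon fun a => ℓ.offer F s a ≠ 0) = ℓ.target F s := by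
    by_contra hne
    exact (Classical.epsilon_spec (p := fun a => ℓ.offer F s a ≠ 0) ⟨_, h0⟩) (offer_of_ne hne)
  simp only [favoringAgent, h1, hf.offer_target hF]

variable [MeasurableSpace α] [MeasurableEq α] {hℓ : Measurable ℓ.feat} {ag : Agent α} {σ : ℝ≥0}

/-- A contract with one paid action leaves two candidates: that action, and a cheapest action with
the largest reward. Measurability goes by strong induction, because the offer of a round depends on
earlier actions only. -/
theorem Fits.exists_agent (hf : ℓ.Fits E θ γ) (hℓ : Measurable ℓ.feat)
    (hbest : ∀ t, ∃ b ∈ E.actionSet t, (∀ b' ∈ E.actionSet t, E.cost b ≤ E.cost b') ∧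
      ∀ b' ∈ E.actionSet t, E.cost b' = E.cost b → E.reward b' ≤ E.reward b) :
    ∃ ag, (ℓ.policy hℓ).IsBestResponding E ag ∧ (ℓ.policy hℓ).TiesFavorPrincipal E ag := by
  classical
  choose b hbmem hbmin hbmax using hbest
  have hact : ∀ t ω, (ℓ.policy hℓ).action E (favoringAgent E b) t ω = _ := fun t ω =>
    hf.favoringAgent_offer (hf.isNet t).1 b t (ℓ.stateAt hℓ E (favoringAgent E b) t ω)
  have hx : ∀ t ω a, ((ℓ.policy hℓ).posted E (favoringAgent E b) t ω a : ℝ) =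
      if a = ℓ.target (ℓ.net (E.actionSet t)) (ℓ.stateAt hℓ E (favoringAgent E b) t ω)
      then ℓ.price (ℓ.net (E.actionSet t)) (ℓ.stateAt hℓ E (favoringAgent E b) t ω) else 0 := by
    intro t ω a
    rw [posted_eq]
    split_ifs with h
    · rw [h, hf.offer_target (hf.isNet t).1]
    · rw [offer_of_ne h, NNReal.coe_zero]
  refine ⟨favoringAgent E b, ⟨fun t ω => ?_, fun t => ?_⟩, fun t ω c hc => ?_⟩
  · have hF := hf.isNet t
    have ht := hF.2.1 (ℓ.target_spec hF.1 (ℓ.stateAt hℓ E (favoringAgent E b) t ω)).1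
    have hp := hf.bonus_pos.trans_le
      (ℓ.bonus_le_price hF.1 (ℓ.stateAt hℓ E (favoringAgent E b) t ω))
    refine ⟨?_, fun c hc => ?_⟩
    · rw [hact]
      split_ifs
      exacts [ht, hbmem t]
    · have hbc := hbmin t c hc
      rw [hx, hx, hact]
      set a := ℓ.target (ℓ.net (E.actionSet t)) (ℓ.stateAt hℓ E (favoringAgent E b) t ω)
      set p := ℓ.price (ℓ.net (E.actionSet t)) (ℓ.stateAt hℓ E (favoringAgent E b) t ω)
      by_cases hcond : -E.cost (b t) < p - E.cost a ∨
          (-E.cost (b t) = p - E.cost a ∧ E.reward (b t) ≤ E.reward a - p)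
      · rw [if_pos hcond, if_pos rfl]
        by_cases hca : c = a
        · rw [if_pos hca, hca]
        · rw [if_neg hca]
          rcases hcond with h | h
          · linarith
          · linarith [h.1]
      · rw [if_neg hcond]
        push Not at hcond
        have hba : b t ≠ a := fun h => by
          have := hcond.1
          rw [h] at this
          linarith
        rw [if_neg hba]
        by_cases hca : c = a
        · rw [if_pos hca, hca]; linarith [hcond.1]
        · rw [if_neg hca]; linarith
  · induction t using Nat.strong_induction_on with
    | _ t ih =>
      have hs := hf.measurable_stateAt (hℓ := hℓ) t ih
      have h1 := measurable_target hℓ hs (ℓ.net (E.actionSet t))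
      have h2 := measurable_price hℓ hs (ℓ.net (E.actionSet t))
      have h3 := h2.sub ((hf.measurable_cost hℓ).comp h1)
      have h4 := ((hf.measurable_reward hℓ).comp h1).sub h2
      rw [show (ℓ.policy hℓ).action E (favoringAgent E b) t = _ from funext (hact t)]
      exact Measurable.ite ((measurableSet_lt measurable_const h3).union
        ((measurableSet_eq_fun measurable_const h3).inter (measurableSet_le measurable_const h4)))
        h1 measurable_const
  · have hF := hf.isNet t
    have ht := hF.2.1 (ℓ.target_spec hF.1 (ℓ.stateAt hℓ E (favoringAgent E b) t ω)).1
    have hp := hf.bonus_pos.trans_le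
      (ℓ.bonus_le_price hF.1 (ℓ.stateAt hℓ E (favoringAgent E b) t ω))
    have hc1 := hc.2 _ ht
    have hc2 := hc.2 _ (hbmem t)
    have hbc := hbmin t c hc.1
    have hbc' := hbmax t c hc.1
    rw [hx, hx] at hc1 hc2
    rw [hx, hx, hact]
    set a := ℓ.target (ℓ.net (E.actionSet t)) (ℓ.stateAt hℓ E (favoringAgent E b) t ω)
    set p := ℓ.price (ℓ.net (E.actionSet t)) (ℓ.stateAt hℓ E (favoringAgent E b) t ω)
    by_cases hcond : -E.cost (b t) < p - E.cost a ∨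
        (-E.cost (b t) = p - E.cost a ∧ E.reward (b t) ≤ E.reward a - p)
    · rw [if_pos hcond, if_pos rfl]
      by_cases hca : c = a
      · rw [if_pos hca, hca]
      · rw [if_neg hca] at hc1 hc2 ⊢
        rw [if_pos rfl] at hc1
        rcases hcond with h | h
        · linarith
        · have := hbc' (by linarith [h.1])
          linarith [h.2]
    · rw [if_neg hcond]
      push Not at hcond
      have hba : b t ≠ a := fun h => by
        have := hcond.1
        rw [h] at this
        linarith
      rw [if_neg hba] at hc2 ⊢
      by_cases hca : c = a
      · rw [if_pos hca, hca]
        rw [hca, if_pos rfl] at hc2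
        have := hcond.2 (le_antisymm (by linarith) hcond.1)
        linarith
      · rw [if_neg hca] at hc2 ⊢
        have := hbc' (by linarith)
        linarith

/-! ### The expected regret of the learner -/

theorem Fits.measurable_regret (hf : ℓ.Fits E θ γ) (h : (ℓ.policy hℓ).IsBestResponding E ag)
    (T : ℕ) : Measurable ((ℓ.policy hℓ).regret E ag T) := by
  refine Finset.measurable_fun_sum _ fun t _ => ?_
  have ha := h.measurable_action t
  have hs := hf.measurable_stateAt (hℓ := hℓ) t fun s _ => h.measurable_action s
  have hx := (measurable_offer hℓ hs ha (ℓ.net (E.actionSet t))).coe_nnreal_real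
  exact measurable_const.sub (((hf.measurable_reward hℓ).comp ha).sub hx)

/-- The bound for the expected regret of the learner. -/
noncomputable def regretBound (ℓ : Learner α d) (T : ℕ) : ℝ :=
  3 * (8 * d ^ 2 *
    Real.log (ℓ.bound ^ 2 * (d + T * (4 * ℓ.bound ^ 2 / (ℓ.bonus / 2) ^ 2)))) +
  2 * ℓ.radius * (√T * √((1 + ℓ.bound ^ 2) * (d * Real.log (d + T * ℓ.bound ^ 2)))) +
  2 * ℓ.acc * T + 3

theorem Fits.integrable_regret (hf : ℓ.Fits E θ γ) (hν : IsSubgaussianNoise σ E.noise)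
    (h : (ℓ.policy hℓ).IsBestResponding E ag) (T : ℕ) :
    Integrable ((ℓ.policy hℓ).regret E ag T) ((ℓ.policy hℓ).law E) := by
  have := (ℓ.policy hℓ).isProbabilityMeasure_law hν
  refine Integrable.of_bound (hf.measurable_regret h T).aestronglyMeasurable (T * 3)
    (Filter.Eventually.of_forall fun ω => ?_)
  rw [Real.norm_eq_abs]
  refine (Finset.abs_sum_le_sum_abs _ _).trans ?_
  refine (Finset.sum_le_card_nsmul _ _ 3 fun t _ => hf.abs_roundRegret_le h t ω).trans_eq ?_
  simp

theorem Fits.integral_regret_le (hf : ℓ.Fits E θ γ) (hσ : 0 < σ)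
    (hν : IsSubgaussianNoise σ E.noise) (h : (ℓ.policy hℓ).IsBestResponding E ag) {T : ℕ}
    (hT : 1 ≤ T)
    (hr : 2 * (2 * σ ^ 2 * (Real.log T + d / 2 * Real.log (d + T * ℓ.bound ^ 2))) +
      2 * ℓ.bound ^ 2 ≤ ℓ.radius ^ 2) :
    ∫ ω, (ℓ.policy hℓ).regret E ag T ω ∂((ℓ.policy hℓ).law E) ≤ ℓ.regretBound T := by
  have := (ℓ.policy hℓ).isProbabilityMeasure_law hν
  set μ := (ℓ.policy hℓ).law E with hμ
  -- The bad event quantifies over all actions, possibly uncountably many, so it is replaced by a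
  -- measurable hull of the same measure.
  let B := fun t => toMeasurable μ (ℓ.BadAt hℓ E ag θ t)
  have hB : ∀ t, MeasurableSet (B t) := fun t => measurableSet_toMeasurable _ _
  have hint : ∀ t, Integrable ((B t).indicator (1 : ℝ × (ℕ → ℝ) → ℝ)) μ := fun t =>
    (integrable_const (1 : ℝ)).indicator (hB t)
  have hT' : (0 : ℝ) < T := by exact_mod_cast hT
  calc _ ≤ ∫ ω, (ℓ.regretBound T - 3 +
        ∑ t ∈ Finset.range T, 3 * (B t).indicator (1 : ℝ × (ℕ → ℝ) → ℝ) ω) ∂μ := by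
        refine integral_mono (hf.integrable_regret hν h T) ((integrable_const _).add
          (integrable_finsetSum _ fun t _ => (hint t).const_mul 3)) fun ω => ?_
        refine (hf.regret_le h T ω).trans ?_
        rw [regretBound, add_sub_cancel_right]
        exact add_le_add le_rfl (Finset.sum_le_sum fun t _ => mul_le_mul_of_nonneg_left
          (Set.indicator_le_indicator_of_subset (f := (1 : ℝ × (ℕ → ℝ) → ℝ))
            (subset_toMeasurable μ _) (fun _ => zero_le_one) ω) zero_le_three)
    _ = ℓ.regretBound T - 3 + ∑ t ∈ Finset.range T, 3 * μ.real (ℓ.BadAt hℓ E ag θ t) := by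
        rw [integral_add (integrable_const _)
          (integrable_finsetSum _ fun t _ => (hint t).const_mul 3),
          integral_finsetSum _ fun t _ => (hint t).const_mul 3]
        simp only [integral_const, probReal_univ, one_smul]
        congr 1
        refine Finset.sum_congr rfl fun t _ => ?_
        rw [integral_const_mul, integral_indicator_one (hB t)]
        simp [B, Measure.real, measure_toMeasurable]
    -- A separate bound for each round suffices: `T` rounds, each bad with probability at most `1 /
    -- T`, contribute the final `3` of `regretBound`.
    _ ≤ ℓ.regretBound T - 3 + ∑ t ∈ Finset.range T, 3 * (1 / (T : ℝ)) := by
        gcongr with t ht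
        exact hf.measure_badAt_le hσ hν h hT (Finset.mem_range.1 ht).le hr
    _ = ℓ.regretBound T := by
        rw [Finset.sum_const, Finset.card_range, nsmul_eq_mul]
        field_simp
        ring

/-! ### Choice of the parameters and size of the bound -/

theorem log_number_of_cuts_le {d : ℕ} (hd : 1 ≤ d) {R T : ℝ} (hR : 1 ≤ R) (hT : 1 ≤ T) :
    Real.log (R ^ 2 * (d + T * (4 * R ^ 2 / ((1 / (2 * d) * (1 / √T) / 8) / 2) ^ 2))) ≤
      (|Real.log (R ^ 2 * (d + 4096 * R ^ 2 * d ^ 2))| + 2) * (1 + Real.log T) := by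
  have hd' : (1 : ℝ) ≤ d := by exact_mod_cast hd
  have hT0 : (0 : ℝ) < T := by positivity
  have hlog : 0 ≤ Real.log T := Real.log_nonneg hT
  have hacc : (1 / √T) ^ 2 = 1 / T := by rw [div_pow, Real.sq_sqrt hT0.le, one_pow]
  have e : T * (4 * R ^ 2 / ((1 / (2 * d) * (1 / √T) / 8) / 2) ^ 2) =
      4096 * R ^ 2 * d ^ 2 * T ^ 2 := by
    rw [show ((1 / (2 * (d : ℝ)) * (1 / √T) / 8) / 2) ^ 2 =
      (1 / √T) ^ 2 / (1024 * d ^ 2) by ring, hacc]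
    field_simp
    norm_num
  rw [e]
  set K := R ^ 2 * (d + 4096 * R ^ 2 * d ^ 2) with hK
  have hK0 : 0 < K := by positivity
  have h1 : R ^ 2 * (d + 4096 * R ^ 2 * d ^ 2 * T ^ 2) ≤ K * T ^ 2 := by
    have h2 : (1 : ℝ) ≤ T ^ 2 := one_le_pow₀ hT
    have h3 : R ^ 2 * d * 1 ≤ R ^ 2 * d * T ^ 2 := by gcongr
    rw [hK]
    linarith
  calc _ ≤ Real.log (K * T ^ 2) := Real.log_le_log (by positivity) h1
    _ = Real.log K + 2 * Real.log T := by
        rw [Real.log_mul (by positivity) (by positivity), Real.log_pow]; norm_num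
    _ ≤ _ := by nlinarith [le_abs_self (Real.log K), abs_nonneg (Real.log K)]

theorem log_trace_le {d : ℕ} (hd : 1 ≤ d) {R T : ℝ} (hR : 1 ≤ R) (hT : 1 ≤ T) :
    Real.log (d + T * R ^ 2) ≤ (Real.log (d + R ^ 2) + 1) * (1 + Real.log T) := by
  have hd' : (1 : ℝ) ≤ d := by exact_mod_cast hd
  have hlog : 0 ≤ Real.log T := Real.log_nonneg hT
  have h0 : 0 ≤ Real.log (d + R ^ 2) := Real.log_nonneg (by nlinarith)
  calc Real.log (d + T * R ^ 2) ≤ Real.log ((d + R ^ 2) * T) :=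
        Real.log_le_log (by positivity) (by nlinarith)
    _ = Real.log (d + R ^ 2) + Real.log T := Real.log_mul (by positivity) (by positivity)
    _ ≤ _ := by nlinarith

/-- With suitable parameters, the bound for the expected regret is `√T` up to a logarithm. -/
theorem exists_regretBound_le {d : ℕ} (hd : 1 ≤ d) (σ : ℝ≥0) {R : ℝ} (hR : 1 ≤ R) :
    ∃ C : ℝ, ∀ T : ℕ, 1 ≤ T → ∃ r : ℝ, 0 ≤ r ∧
      2 * (2 * σ ^ 2 * (Real.log T + d / 2 * Real.log (d + T * R ^ 2))) + 2 * R ^ 2 ≤ r ^ 2 ∧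
      ∀ (α : Type) (φ : α → Fin d → ℝ),
        regretBound ⟨φ, r, 1 / √(T : ℝ), R⟩ T ≤ C * √(T : ℝ) * (1 + Real.log T) := by
  have hd' : (1 : ℝ) ≤ d := by exact_mod_cast hd
  obtain ⟨K₁, hK₁, t1⟩ : ∃ K : ℝ, 0 ≤ K ∧ ∀ T : ℝ, 1 ≤ T →
      Real.log (R ^ 2 * (d + T * (4 * R ^ 2 / ((1 / (2 * d) * (1 / √T) / 8) / 2) ^ 2))) ≤
        K * (1 + Real.log T) :=
    ⟨_, by positivity, fun T hT => log_number_of_cuts_le hd hR hT⟩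
  obtain ⟨K₂, hK₂, t2⟩ : ∃ K : ℝ, 0 ≤ K ∧ ∀ T : ℝ, 1 ≤ T →
      Real.log (d + T * R ^ 2) ≤ K * (1 + Real.log T) :=
    ⟨_, add_nonneg (Real.log_nonneg (by nlinarith)) zero_le_one,
      fun T hT => log_trace_le hd hR hT⟩
  -- With `L = 1 + log T`, the squared radius may be taken as `K₃ L`, and `K₄ L` bounds the factor
  -- from the elliptical potential. Their square roots multiply to a single power of `L`, so the
  -- final exponent of the logarithm is one.
  obtain ⟨K₃, hK₃⟩ : ∃ K : ℝ, K = 4 * σ ^ 2 * (1 + d / 2 * K₂) + 2 * R ^ 2 := ⟨_, rfl⟩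
  obtain ⟨K₄, hK₄⟩ : ∃ K : ℝ, K = (1 + R ^ 2) * (d * K₂) := ⟨_, rfl⟩
  have hK₃0 : 0 ≤ K₃ := by rw [hK₃]; positivity
  have hK₄0 : 0 ≤ K₄ := by rw [hK₄]; positivity
  refine ⟨24 * d ^ 2 * K₁ + 2 * (√K₃ * √K₄) + 5, fun T hT => ?_⟩
  have hT' : (1 : ℝ) ≤ T := by exact_mod_cast hT
  have hT0 : (0 : ℝ) < T := by positivity
  have h1 := t1 T hT'
  have h2 := t2 T hT'
  obtain ⟨L, hL⟩ : ∃ L, L = 1 + Real.log T := ⟨_, rfl⟩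
  obtain ⟨u, hu⟩ : ∃ u, u = √(T : ℝ) := ⟨_, rfl⟩
  have hL1 : 1 ≤ L := by linarith [Real.log_nonneg hT']
  have hs1 : 1 ≤ u := hu ▸ Real.one_le_sqrt.2 hT'
  rw [← hL] at h1 h2 ⊢
  have h3 : 2 * (2 * σ ^ 2 * (Real.log T + d / 2 * Real.log (d + T * R ^ 2))) + 2 * R ^ 2 ≤
      K₃ * L := by
    have h4 : 2 * R ^ 2 * 1 ≤ 2 * R ^ 2 * L := by gcongr
    have h5 : 2 * (2 * (σ : ℝ) ^ 2 * (Real.log T + d / 2 * Real.log (d + T * R ^ 2))) ≤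
        2 * (2 * σ ^ 2 * (L + d / 2 * (K₂ * L))) := by
      gcongr
      linarith
    rw [hK₃]
    linarith
  refine ⟨√(K₃ * L), Real.sqrt_nonneg _, ?_, fun α φ => ?_⟩
  · rwa [Real.sq_sqrt (by positivity)]
  have h6 : √(K₃ * L) * √((1 + R ^ 2) * (d * Real.log (d + T * R ^ 2))) ≤ √K₃ * √K₄ * L := by
    have h7 : (1 + R ^ 2) * (d * Real.log (d + T * R ^ 2)) ≤ K₄ * L := by
      calc _ ≤ (1 + R ^ 2) * (d * (K₂ * L)) := by gcongr
        _ = _ := by rw [hK₄]; ring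
    calc _ ≤ √(K₃ * L) * √(K₄ * L) := by gcongr
      _ = √K₃ * √K₄ * (√L * √L) := by
          rw [Real.sqrt_mul hK₃0, Real.sqrt_mul hK₄0]; ring
      _ = _ := by rw [Real.mul_self_sqrt (by positivity)]
  have h8 : 2 * (1 / √(T : ℝ)) * T = 2 * √(T : ℝ) := by
    have h := Real.mul_self_sqrt hT0.le
    field_simp
    nlinarith
  simp only [regretBound, bonus, step]
  rw [h8]
  rw [← hu] at h1 ⊢
  obtain ⟨X, hX⟩ : ∃ X, X =
    Real.log (R ^ 2 * (d + T * (4 * R ^ 2 / ((1 / (2 * d) * (1 / u) / 8) / 2) ^ 2))) := ⟨_, rfl⟩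
  obtain ⟨Y, hY⟩ : ∃ Y, Y = √((1 + R ^ 2) * (d * Real.log (d + T * R ^ 2))) := ⟨_, rfl⟩
  obtain ⟨r, hr⟩ : ∃ r, r = √(K₃ * L) := ⟨_, rfl⟩
  obtain ⟨c, hc⟩ : ∃ c, c = √K₃ * √K₄ := ⟨_, rfl⟩
  rw [← hX] at h1 ⊢
  rw [← hY, ← hr, ← hc] at h6
  rw [← hY, ← hr, ← hc]
  have f0 : L ≤ u * L := le_mul_of_one_le_left (by linarith) hs1
  have f1 : 3 * (8 * (d : ℝ) ^ 2 * X) ≤ 24 * d ^ 2 * (K₁ * (u * L)) := by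
    calc 3 * (8 * (d : ℝ) ^ 2 * X) ≤ 3 * (8 * (d : ℝ) ^ 2 * (K₁ * (u * L))) := by
          gcongr
          exact h1.trans (by gcongr)
      _ = _ := by ring
  have f2 : 2 * r * (u * Y) ≤ 2 * u * (c * L) := by
    calc 2 * r * (u * Y) = 2 * u * (r * Y) := by ring
      _ ≤ _ := by gcongr
  have f3 : u ≤ u * L := le_mul_of_one_le_right (by linarith) hL1
  linarith

end Learner

/-! ### Upper bounds -/

section Upper

variable {α : Type} {d : ℕ}

/-- A bandit problem whose rewards and costs are linear in the features `φ`. -/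
structure IsFeatureBandit (φ : α → Fin d → ℝ) (R : ℝ) (σ : ℝ≥0) (E : Environment α) : Prop where
  exists_parameters : ∃ θ γ : Fin d → ℝ, θ ⬝ᵥ θ ≤ R ^ 2 ∧ γ ⬝ᵥ γ ≤ R ^ 2 ∧
    (∀ a, E.reward a = φ a ⬝ᵥ θ) ∧ ∀ a, E.cost a = φ a ⬝ᵥ γ
  nonempty : ∀ t, (E.actionSet t).Nonempty
  isCompact : ∀ t, IsCompact (φ '' E.actionSet t)
  feat_sq_le : ∀ t, ∀ a ∈ E.actionSet t, φ a ⬝ᵥ φ a ≤ R ^ 2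
  reward_mem : ∀ t, ∀ a ∈ E.actionSet t, E.reward a ∈ Set.Icc (0 : ℝ) 1
  cost_mem : ∀ t, ∀ a ∈ E.actionSet t, E.cost a ∈ Set.Icc (0 : ℝ) 1
  noise : IsSubgaussianNoise σ E.noise

/-- Compactness is used in feature space; centres of the covering balls are pulled back to actions
of `S`. -/
theorem Learner.exists_isNet {ℓ : Learner α d} {S : Set α} (hS : S.Nonempty)
    (hc : IsCompact (ℓ.feat '' S)) (h : ℓ.bonus / (2 * ℓ.bound) ≠ 0) : ∃ F, ℓ.IsNet S F := by
  classical
  obtain ⟨a₀, ha₀⟩ := hS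
  have : Nonempty α := ⟨a₀⟩
  have hU : ∀ x ∈ ℓ.feat '' S,
      {y | (y - x) ⬝ᵥ (y - x) < (ℓ.bonus / (2 * ℓ.bound)) ^ 2} ∈ nhds x := by
    intro x _
    have hcont : Continuous fun y : Fin d → ℝ => (y - x) ⬝ᵥ (y - x) :=
      (continuous_id.sub continuous_const).dotProduct (continuous_id.sub continuous_const)
    refine (isOpen_lt hcont continuous_const).mem_nhds ?_
    simp only [Set.mem_ofPred_eq, sub_self, dotProduct_zero]
    positivity
  obtain ⟨G, hG, hcov⟩ := hc.elim_nhds_subcover _ hU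
  choose! f hf using fun x (hx : x ∈ G) => hG x hx
  have hmem : ∀ a ∈ S, ∃ b ∈ G.image f, ℓ.Near a b := by
    intro a ha
    obtain ⟨x, hx, hax⟩ := Set.mem_iUnion₂.1 (hcov (Set.mem_image_of_mem _ ha))
    refine ⟨f x, Finset.mem_image_of_mem f hx, ?_⟩
    rw [Learner.Near, (hf x hx).2]
    rw [Set.mem_ofPred_eq] at hax
    exact hax.le
  refine ⟨G.image f, ?_, ?_, hmem⟩
  · obtain ⟨b, hb, _⟩ := hmem a₀ ha₀
    exact ⟨b, hb⟩
  · intro b hb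
    obtain ⟨x, hx, rfl⟩ := Finset.mem_image.1 (Finset.mem_coe.1 hb)
    exact (hf x hx).1

/-- The cheapest actions have a compact set of features, on which the reward attains its maximum. -/
theorem IsFeatureBandit.exists_cheapest {φ : α → Fin d → ℝ} {R : ℝ} {σ : ℝ≥0}
    {E : Environment α} (hE : IsFeatureBandit φ R σ E) (t : ℕ) :
    ∃ b ∈ E.actionSet t, (∀ b' ∈ E.actionSet t, E.cost b ≤ E.cost b') ∧
      ∀ b' ∈ E.actionSet t, E.cost b' = E.cost b → E.reward b' ≤ E.reward b := by
  obtain ⟨θ, γ, -, -, hr, hc⟩ := hE.exists_parameters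
  have hcont : ∀ v : Fin d → ℝ, Continuous fun y : Fin d → ℝ => y ⬝ᵥ v := fun v =>
    continuous_id.dotProduct continuous_const
  obtain ⟨x, hx, hxmin⟩ := (hE.isCompact t).exists_isMinOn ((hE.nonempty t).image _)
    (hcont γ).continuousOn
  have hK : IsCompact (φ '' E.actionSet t ∩ {y | y ⬝ᵥ γ = x ⬝ᵥ γ}) :=
    (hE.isCompact t).inter_right (isClosed_eq (hcont γ) continuous_const)
  obtain ⟨y, ⟨⟨b, hb, hby⟩, hyx⟩, hymax⟩ := hK.exists_isMaxOn ⟨x, hx, rfl⟩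
    (hcont θ).continuousOn
  rw [Set.mem_ofPred_eq] at hyx
  refine ⟨b, hb, fun b' hb' => ?_, fun b' hb' he => ?_⟩
  · rw [hc, hc, hby, hyx]
    exact hxmin (Set.mem_image_of_mem φ hb')
  · rw [hr, hr, hby]
    refine hymax ⟨Set.mem_image_of_mem φ hb', ?_⟩
    rw [hc, hc, hby, hyx] at he
    exact he

theorem exists_policy_expectedRegretLE (hd : 1 ≤ d) {σ : ℝ≥0} (hσ : 0 < σ) {R : ℝ} (hR : 1 ≤ R)
    [Nonempty α] [MeasurableSpace α] [MeasurableEq α] {φ : α → Fin d → ℝ} (hφ : Measurable φ) :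
    ∃ C : ℝ, ∀ T : ℕ, 1 ≤ T → ∃ π : Policy α, ∀ E : Environment α, IsFeatureBandit φ R σ E →
      π.ExpectedRegretLE E T (C * √(T : ℝ) * (1 + Real.log T) ^ 1) := by
  obtain ⟨C, hC⟩ := Learner.exists_regretBound_le hd σ hR
  refine ⟨C, fun T hT => ?_⟩
  obtain ⟨r, hr0, hr, hB⟩ := hC T hT
  have hT' : (1 : ℝ) ≤ T := by exact_mod_cast hT
  have hs : 1 ≤ √(T : ℝ) := Real.one_le_sqrt.2 hT'
  let ℓ : Learner α d := ⟨φ, r, 1 / √(T : ℝ), R⟩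
  have hbonus : ℓ.bonus / (2 * ℓ.bound) ≠ 0 := by
    have : (1 : ℝ) ≤ d := by exact_mod_cast hd
    have : 0 < ℓ.bonus / (2 * ℓ.bound) := by
      simp only [ℓ, Learner.bonus, Learner.step]
      positivity
    exact this.ne'
  refine ⟨ℓ.policy hφ, fun E hE => ?_⟩
  obtain ⟨θ, γ, hθ, hγ, hrew, hcost⟩ := hE.exists_parameters
  have hf : ℓ.Fits E θ γ :=
    { one_le_dim := hd
      acc_pos := by positivity
      acc_le_one := (div_le_one (by positivity)).2 hs
      one_le_bound := hR
      radius_nonneg := hr0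
      reward_sq_le := hθ
      cost_sq_le := hγ
      exists_net := fun t => Learner.exists_isNet (hE.nonempty t) (hE.isCompact t) hbonus
      feat_sq_le := hE.feat_sq_le
      reward_eq := hrew
      cost_eq := hcost
      reward_mem := hE.reward_mem
      cost_mem := hE.cost_mem }
  refine ⟨hf.exists_agent hφ hE.exists_cheapest, fun ag hag =>
    ⟨hf.integrable_regret hE.noise hag T, ?_⟩⟩
  rw [pow_one]
  exact (hf.integral_regret_le hσ hE.noise hag hT hr).trans (hB α φ)

/-- Arms become standard basis vectors and the parameters are the vectors of rewards and costs, of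
squared norm at most `N ≤ N ^ 2`; hence `R = N`. -/
theorem multiArmedBandit_upper (N : ℕ) (σ : ℝ≥0) (hN : 1 ≤ N) (hσ : 0 < σ) :
    ∃ C : ℝ, ∀ T : ℕ, 1 ≤ T → ∃ π : Policy (Fin N),
      ∀ E : Environment (Fin N), IsMultiArmedBandit N σ E →
        π.ExpectedRegretLE E T (C * √(T : ℝ) * (1 + Real.log T) ^ 1) := by
  have : Nonempty (Fin N) := ⟨⟨0, hN⟩⟩
  have hN' : (1 : ℝ) ≤ N := by exact_mod_cast hN
  have hsq : ∀ v : Fin N → ℝ, (∀ i, v i ∈ Set.Icc (0 : ℝ) 1) → v ⬝ᵥ v ≤ (N : ℝ) ^ 2 := by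
    intro v hv
    calc v ⬝ᵥ v ≤ ∑ _i : Fin N, (1 : ℝ) :=
          Finset.sum_le_sum fun i _ => mul_le_one₀ (hv i).2 (hv i).1 (hv i).2
      _ ≤ _ := by simp; nlinarith
  obtain ⟨C, hC⟩ := exists_policy_expectedRegretLE hN hσ hN'
    (measurable_of_finite fun i : Fin N => (Pi.single i 1 : Fin N → ℝ))
  refine ⟨C, fun T hT => ?_⟩
  obtain ⟨π, hπ⟩ := hC T hT
  refine ⟨π, fun E hE => hπ E
    { exists_parameters := ⟨E.reward, E.cost, hsq _ hE.reward_mem, hsq _ hE.cost_mem,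
        fun a => by simp, fun a => by simp⟩
      nonempty := fun t => by rw [hE.actionSet_eq]; exact Set.univ_nonempty
      isCompact := fun t => (Set.toFinite _).isCompact
      feat_sq_le := fun t a _ => ?_
      reward_mem := fun t a _ => hE.reward_mem a
      cost_mem := fun t a _ => hE.cost_mem a
      noise := hE.noise }⟩
  rw [single_dotProduct, Pi.single_eq_same, one_mul]
  nlinarith

theorem linearBandit_upper (d : ℕ) (σ : ℝ≥0) (hd : 1 ≤ d) (hσ : 0 < σ) :
    ∃ C : ℝ, ∀ T : ℕ, 1 ≤ T → ∃ π : Policy (EuclideanSpace ℝ (Fin d)),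
      ∀ E : Environment (EuclideanSpace ℝ (Fin d)), IsLinearBandit d σ E →
        π.ExpectedRegretLE E T (C * √(T : ℝ) * (1 + Real.log T) ^ 1) := by
  have hd' : (1 : ℝ) ≤ d := by exact_mod_cast hd
  have hdot : ∀ x y : EuclideanSpace ℝ (Fin d), inner ℝ x y = x.ofLp ⬝ᵥ y.ofLp := by
    intro x y
    rw [EuclideanSpace.inner_eq_star_dotProduct, dotProduct_comm]
    simp
  have hnorm : ∀ x : EuclideanSpace ℝ (Fin d), x.ofLp ⬝ᵥ x.ofLp = ‖x‖ ^ 2 := fun x => by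
    rw [← hdot, real_inner_self_eq_norm_sq]
  have hcont : Continuous fun x : EuclideanSpace ℝ (Fin d) => x.ofLp :=
    PiLp.continuous_ofLp 2 _
  obtain ⟨C, hC⟩ := exists_policy_expectedRegretLE hd hσ hd' hcont.measurable
  refine ⟨C, fun T hT => ?_⟩
  obtain ⟨π, hπ⟩ := hC T hT
  refine ⟨π, fun E hE => hπ E ?_⟩
  obtain ⟨θ, γ, hθ, hγ, hr, hc⟩ := hE.exists_parameters
  exact
    { exists_parameters := ⟨θ.ofLp, γ.ofLp,
        by rw [hnorm]; gcongr; linarith, by rw [hnorm]; gcongr; linarith,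
        fun a => by rw [hr, ← hdot], fun a => by rw [hc, ← hdot]⟩
      nonempty := hE.nonempty
      isCompact := fun t => (hE.isCompact t).image hcont
      feat_sq_le := fun t a ha => by
        rw [hnorm]
        have h1 := hE.norm_le t a ha
        have h2 : √(d : ℝ) ≤ d := Real.sqrt_le_iff.2 ⟨by linarith, by nlinarith⟩
        gcongr
        exact h1.trans h2
      reward_mem := hE.reward_mem
      cost_mem := hE.cost_mem
      noise := hE.noise }

end Upper

/-! ### Change of measure for Gaussian noise -/

theorem isSubgaussianNoise_gaussianReal (σ : ℝ≥0) :
    IsSubgaussianNoise σ (gaussianReal 0 (σ ^ 2)) where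
  isProbabilityMeasure := inferInstance
  centered := integral_id_gaussianReal
  subgaussian :=
    ⟨fun t => integrable_exp_mul_gaussianReal t, fun t => by
      rw [mgf_fun_id_gaussianReal]; simp⟩

theorem lintegral_mul_sq_le {Ω : Type} [MeasurableSpace Ω] {μ : Measure Ω} {f g : Ω → ENNReal}
    (hf : AEMeasurable f μ) (hg : AEMeasurable g μ) :
    (∫⁻ ω, f ω * g ω ∂μ) ^ 2 ≤ (∫⁻ ω, f ω ^ 2 ∂μ) * ∫⁻ ω, g ω ^ 2 ∂μ := by
  have h := ENNReal.lintegral_mul_le_Lp_mul_Lq μ Real.HolderConjugate.two_two hf hg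
  simp only [ENNReal.rpow_two, Pi.mul_apply] at h
  refine (pow_le_pow_left₀ zero_le h 2).trans_eq ?_
  rw [mul_pow, ← ENNReal.rpow_two, ← ENNReal.rpow_two, ← ENNReal.rpow_mul, ← ENNReal.rpow_mul]
  norm_num

/-- The shift is a change of measure with likelihood ratio `D`, whose second moment is `exp (Δ² /
v)`; Cauchy–Schwarz does the rest. -/
theorem lintegral_gaussianReal_shift_sq_le {v : ℝ≥0} (hv : v ≠ 0) {Δ δ : ℝ} (hΔ : |Δ| ≤ δ)
    {f : ℝ → ENNReal} (hf : Measurable f) :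
    (∫⁻ z, f (Δ + z) ∂(gaussianReal 0 v)) ^ 2 ≤
      ENNReal.ofReal (Real.exp (δ ^ 2 / v)) * ∫⁻ z, f z ^ 2 ∂(gaussianReal 0 v) := by
  have hv' : (0 : ℝ) < v := NNReal.coe_pos.2 (pos_iff_ne_zero.2 hv)
  set D : ℝ → ENNReal := fun z => ENNReal.ofReal (Real.exp (Δ * z / v - Δ ^ 2 / (2 * v)))
    with hD
  have hDm : Measurable D := by fun_prop
  have h1 : ∫⁻ z, f (Δ + z) ∂(gaussianReal 0 v) = ∫⁻ z, D z * f z ∂(gaussianReal 0 v) := by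
    have h2 : ∫⁻ z, f (Δ + z) ∂(gaussianReal 0 v) = ∫⁻ z, f z ∂(gaussianReal Δ v) := by
      rw [← lintegral_map hf (by fun_prop), gaussianReal_map_const_add, zero_add]
    rw [h2, gaussianReal_of_var_ne_zero _ hv, gaussianReal_of_var_ne_zero _ hv,
      lintegral_withDensity_eq_lintegral_mul _ (measurable_gaussianPDF _ _) hf,
      lintegral_withDensity_eq_lintegral_mul _ (measurable_gaussianPDF _ _)
        (g := fun z => D z * f z) (hDm.mul hf)]
    refine lintegral_congr fun z => ?_
    simp only [Pi.mul_apply, hD]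
    rw [← mul_assoc]
    congr 1
    simp only [gaussianPDF]
    rw [← ENNReal.ofReal_mul (gaussianPDFReal_nonneg _ _ _)]
    congr 1
    simp only [gaussianPDFReal, sub_zero]
    rw [mul_assoc (√(2 * Real.pi * v))⁻¹, ← Real.exp_add]
    congr 2
    field_simp
    ring
  have h3 : ∫⁻ z, D z ^ 2 ∂(gaussianReal 0 v) = ENNReal.ofReal (Real.exp (Δ ^ 2 / v)) := by
    have h4 : ∀ z, D z ^ 2 = ENNReal.ofReal (Real.exp (-(Δ ^ 2 / v))) *
        ENNReal.ofReal (Real.exp (2 * Δ / v * z)) := by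
      intro z
      simp only [hD]
      rw [← ENNReal.ofReal_pow (Real.exp_pos _).le, ← ENNReal.ofReal_mul (Real.exp_pos _).le,
        ← Real.exp_add, ← Real.exp_nat_mul]
      congr 2
      field_simp
      push_cast
      ring
    simp_rw [h4]
    rw [lintegral_const_mul _ (by fun_prop), ← ofReal_integral_eq_lintegral_ofReal
      (integrable_exp_mul_gaussianReal _)
      (Filter.Eventually.of_forall fun x => (Real.exp_pos _).le)]
    have h5 := congrFun (mgf_id_gaussianReal (μ := 0) (v := v)) (2 * Δ / v)
    simp only [mgf, id] at h5
    rw [h5, ← ENNReal.ofReal_mul (Real.exp_pos _).le, ← Real.exp_add]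
    congr 2
    field_simp
    ring
  rw [h1]
  refine (lintegral_mul_sq_le hDm.aemeasurable hf.aemeasurable).trans ?_
  rw [h3]
  gcongr ENNReal.ofReal (Real.exp (?_ / v)) * _
  exact sq_le_sq.2 (hΔ.trans (le_abs_self δ))

/-! ### Finitely many actions -/

theorem Policy.measurable_contract_apply {α : Type} [MeasurableSpace α] (π : Policy α) (t : ℕ)
    (s : Fin (t + 1) → Set α) (a : α) :
    Measurable fun p : ℝ × (Fin t → α × ℝ) => π.contract t s p.1 p.2 a :=
  (π.measurable_contract t s).comp (measurable_id.prodMk measurable_const)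

section Finite

variable {α : Type} [Nonempty α]

/-- The agent who chooses among his best responses one that is best for the principal. -/
noncomputable def finiteAgent (S : Finset α) (c r : α → ℝ) : Agent α := fun _ x =>
  chooseIn S fun a => (∀ b ∈ S, (x b : ℝ) - c b ≤ (x a : ℝ) - c a) ∧
    ∀ b ∈ S, (∀ b' ∈ S, (x b' : ℝ) - c b' ≤ (x b : ℝ) - c b) → r b - (x b : ℝ) ≤ r a - (x a : ℝ)

theorem finiteAgent_spec {S : Finset α} (hS : S.Nonempty) (c r : α → ℝ) (t : ℕ) (x : α → ℝ≥0) :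
    finiteAgent S c r t x ∈ bestResponses (S : Set α) c x ∧
      ∀ b ∈ bestResponses (S : Set α) c x,
        r b - (x b : ℝ) ≤ r (finiteAgent S c r t x) - (x (finiteAgent S c r t x) : ℝ) := by
  classical
  have h : ∃ a ∈ S, (∀ b ∈ S, (x b : ℝ) - c b ≤ (x a : ℝ) - c a) ∧
      ∀ b ∈ S, (∀ b' ∈ S, (x b' : ℝ) - c b' ≤ (x b : ℝ) - c b) →
        r b - (x b : ℝ) ≤ r a - (x a : ℝ) := by
    obtain ⟨a, ha, hmax⟩ := S.exists_max_image (fun a => (x a : ℝ) - c a) hS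
    obtain ⟨b, hb, hbmax⟩ := (S.filter fun b =>
      ∀ b' ∈ S, (x b' : ℝ) - c b' ≤ (x b : ℝ) - c b).exists_max_image (fun a => r a - (x a : ℝ))
        ⟨a, Finset.mem_filter.2 ⟨ha, hmax⟩⟩
    rw [Finset.mem_filter] at hb
    exact ⟨b, hb.1, hb.2, fun b' hb' h' => hbmax b' (Finset.mem_filter.2 ⟨hb', h'⟩)⟩
  have hs := chooseIn_spec h
  exact ⟨⟨hs.1, fun b hb => hs.2.1 b hb⟩, fun b hb => hs.2.2 b hb.1 fun b' hb' => hb.2 b' hb'⟩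

variable [MeasurableSpace α]

theorem measurable_finiteAgent {Ω : Type} [MeasurableSpace Ω] (S : Finset α) (c r : α → ℝ) (t : ℕ)
    {x : Ω → α → ℝ≥0} (hx : ∀ a, Measurable fun ω => x ω a) :
    Measurable fun ω => finiteAgent S c r t (x ω) := by
  have hx' : ∀ a, Measurable fun ω => (x ω a : ℝ) := fun a => (hx a).coe_nnreal_real
  have hbr : ∀ a, MeasurableSet {ω | ∀ b ∈ S, (x ω b : ℝ) - c b ≤ (x ω a : ℝ) - c a} := by
    intro a
    simp only [Set.ofPred_forall]
    exact Finset.measurableSet_biInter _ fun b _ =>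
      measurableSet_le ((hx' b).sub_const _) ((hx' a).sub_const _)
  refine measurable_chooseIn S fun a _ => (hbr a).inter ?_
  have h : {ω | ∀ b ∈ S, (∀ b' ∈ S, (x ω b' : ℝ) - c b' ≤ (x ω b : ℝ) - c b) →
      r b - (x ω b : ℝ) ≤ r a - (x ω a : ℝ)} =
      ⋂ b ∈ S, ({ω | ∀ b' ∈ S, (x ω b' : ℝ) - c b' ≤ (x ω b : ℝ) - c b}ᶜ ∪
        {ω | r b - (x ω b : ℝ) ≤ r a - (x ω a : ℝ)}) := by
    ext ω
    simp only [Set.mem_ofPred_eq, Set.mem_iInter, Set.mem_union, Set.mem_compl_iff, imp_iff_not_or]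
  have hm := Finset.measurableSet_biInter S fun b _ => (hbr b).compl.union
    (measurableSet_le ((hx' b).const_sub (r b)) ((hx' a).const_sub (r a)))
  rw [← h] at hm
  exact hm

/-- The bandit problem with actions `S` and Gaussian noise of variance `v`. -/
noncomputable def gaussianBandit (S : Finset α) (r c : α → ℝ) (v : ℝ≥0) : Environment α :=
  ⟨fun _ => S, r, c, gaussianReal 0 v⟩

variable {π : Policy α} {S : Finset α} {r c : α → ℝ} {v : ℝ≥0} {ag : Agent α}

theorem measurable_action_finiteAgent (hr : Measurable r) (r' : α → ℝ) (t : ℕ) :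
    Measurable (π.action (gaussianBandit S r c v) (finiteAgent S c r') t) := by
  induction t using Nat.strong_induction_on with
  | _ t ih =>
    have h := Policy.measurable_history (E := gaussianBandit S r c v) hr t ih
    exact measurable_finiteAgent S c r' t fun a =>
      (π.measurable_contract_apply t _ a).comp (measurable_fst.prodMk h)

/-- The tie-breaking reward `r'` need not be the true one. With `r' = 0` the same agent
best-responds in both worlds of the lower bound, as these differ only in the rewards. -/
theorem isBestResponding_finiteAgent (hS : S.Nonempty) (hr : Measurable r) (r' : α → ℝ) :
    π.IsBestResponding (gaussianBandit S r c v) (finiteAgent S c r') where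
  mem_bestResponses t _ := (finiteAgent_spec hS c r' t _).1
  measurable_action := measurable_action_finiteAgent hr r'

theorem exists_agent_gaussianBandit (hS : S.Nonempty) (hr : Measurable r) :
    ∃ ag : Agent α, π.IsBestResponding (gaussianBandit S r c v) ag ∧
      π.TiesFavorPrincipal (gaussianBandit S r c v) ag :=
  ⟨finiteAgent S c r, isBestResponding_finiteAgent hS hr r,
    fun t _ b hb => (finiteAgent_spec hS c r t _).2 b hb⟩

/-- Changing the rewards by at most `δ` changes probabilities in a controlled way. -/
theorem lintegral_history_sq_le (hv : v ≠ 0) {r₀ r₁ : α → ℝ} (hr₀ : Measurable r₀)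
    (hr₁ : Measurable r₁) (hS : S.Nonempty) {δ : ℝ} (hδ : ∀ a ∈ S, |r₁ a - r₀ a| ≤ δ) (t : ℕ)
    {f : ℝ × (Fin t → α × ℝ) → ENNReal} (hf : Measurable f) :
    (∫⁻ ω, f (ω.1, π.history (gaussianBandit S r₁ c v) (finiteAgent S c 0) ω t)
        ∂(π.law (gaussianBandit S r₁ c v))) ^ 2 ≤
      ENNReal.ofReal (Real.exp (δ ^ 2 / v)) ^ t *
        ∫⁻ ω, f (ω.1, π.history (gaussianBandit S r₀ c v) (finiteAgent S c 0) ω t) ^ 2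
          ∂(π.law (gaussianBandit S r₀ c v)) := by
  have hlaw : ∀ r, π.law (gaussianBandit S r c v) =
      π.seedLaw.prod (Measure.infinitePi fun _ : ℕ => gaussianReal 0 v) := fun _ => rfl
  have := π.isProbabilityMeasure_seedLaw
  rw [hlaw, hlaw]
  induction t with
  | zero =>
    rw [pow_zero, one_mul]
    have h := lintegral_mul_sq_le (μ := π.seedLaw.prod
      (Measure.infinitePi fun _ : ℕ => gaussianReal 0 v)) (f := fun _ => 1)
      (g := fun ω => f (ω.1, π.history (gaussianBandit S r₁ c v) (finiteAgent S c 0) ω 0))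
      aemeasurable_const (hf.comp (measurable_fst.prodMk
        (Policy.measurable_history (E := gaussianBandit S r₁ c v) hr₁ 0
          (by simp)))).aemeasurable
    simp only [one_mul, one_pow, lintegral_const, measure_univ, mul_one] at h
    exact h
  | succ t ih =>
    set A : ℝ × (Fin t → α × ℝ) → α := fun p =>
      finiteAgent S c 0 t (π.contract t (fun _ => (S : Set α)) p.1 p.2) with hA
    have hAm : Measurable A := measurable_finiteAgent S c 0 t fun a =>
      π.measurable_contract_apply t _ a
    have hAS : ∀ p, A p ∈ S := fun p => (finiteAgent_spec hS c 0 t _).1.1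
    have hext : ∀ r : α → ℝ, Measurable r →
        Measurable fun p : (ℝ × (Fin t → α × ℝ)) × ℝ =>
          (p.1.1, Fin.snoc (α := fun _ => α × ℝ) p.1.2 (A p.1, r (A p.1) + p.2)) := by
      intro r hr
      refine Measurable.prodMk (by fun_prop) (measurable_pi_lambda _ fun i => ?_)
      refine Fin.lastCases ?_ (fun i => ?_) i
      · simp only [Fin.snoc_last]
        exact (hAm.comp measurable_fst).prodMk
          ((hr.comp (hAm.comp measurable_fst)).add measurable_snd)
      · simp only [Fin.snoc_castSucc]
        fun_prop
    have hstep : ∀ r : α → ℝ, Measurable r → ∀ g : ℝ × (Fin (t + 1) → α × ℝ) → ENNReal,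
        Measurable g →
        ∫⁻ ω, g (ω.1, π.history (gaussianBandit S r c v) (finiteAgent S c 0) ω (t + 1))
          ∂(π.seedLaw.prod (Measure.infinitePi fun _ : ℕ => gaussianReal 0 v)) =
        ∫⁻ ω, (fun p : ℝ × (Fin t → α × ℝ) => ∫⁻ z, g (p.1, Fin.snoc (α := fun _ => α × ℝ) p.2
            (A p, r (A p) + z)) ∂(gaussianReal 0 v))
          (ω.1, π.history (gaussianBandit S r c v) (finiteAgent S c 0) ω t)
          ∂(π.seedLaw.prod (Measure.infinitePi fun _ : ℕ => gaussianReal 0 v)) := by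
      intro r hr g hg
      have hm : Measurable fun ω =>
          g (ω.1, π.history (gaussianBandit S r c v) (finiteAgent S c 0) ω (t + 1)) :=
        hg.comp (measurable_fst.prodMk (Policy.measurable_history (E := gaussianBandit S r c v)
          hr _ fun s _ => measurable_action_finiteAgent hr 0 s))
      rw [lintegral_resample _ _ t hm]
      refine lintegral_congr fun ω => lintegral_congr fun z => ?_
      have hz : (resample t ω z).2 t = z := by simp [resample]
      rw [Policy.history_succ, Policy.action_resample, Policy.history_resample t ω z t le_rfl, hz]
      rfl
    have hg₁ : Measurable fun p : ℝ × (Fin t → α × ℝ) => ∫⁻ z, f (p.1,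
        Fin.snoc (α := fun _ => α × ℝ) p.2 (A p, r₁ (A p) + z)) ∂(gaussianReal 0 v) :=
      (hf.comp (hext r₁ hr₁)).lintegral_prod_right'
    -- The noise of the last round is integrated out first. The induction hypothesis changes the
    -- rewards of the first `t` rounds in the remaining function of the shorter history, and the
    -- Gaussian shift for the last round costs one further factor.
    rw [hstep r₁ hr₁ f hf, hstep r₀ hr₀ _ (hf.pow_const 2)]
    refine (ih hg₁).trans ?_
    rw [pow_succ (ENNReal.ofReal _) t, mul_assoc]
    gcongr
    have hm : Measurable fun ω : ℝ × (ℕ → ℝ) =>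
        (fun p : ℝ × (Fin t → α × ℝ) => ∫⁻ z, f (p.1, Fin.snoc (α := fun _ => α × ℝ) p.2
            (A p, r₀ (A p) + z)) ^ 2 ∂(gaussianReal 0 v))
          (ω.1, π.history (gaussianBandit S r₀ c v) (finiteAgent S c 0) ω t) :=
      (((hf.pow_const 2).comp (hext r₀ hr₀)).lintegral_prod_right').comp
        (measurable_fst.prodMk (Policy.measurable_history (E := gaussianBandit S r₀ c v) hr₀ t
          fun s _ => measurable_action_finiteAgent hr₀ 0 s))
    refine (lintegral_mono fun ω => ?_).trans_eq (lintegral_const_mul _ hm)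
    set p : ℝ × (Fin t → α × ℝ) :=
      (ω.1, π.history (gaussianBandit S r₀ c v) (finiteAgent S c 0) ω t)
    have hfz : Measurable fun z =>
        f (p.1, Fin.snoc (α := fun _ => α × ℝ) p.2 (A p, r₀ (A p) + z)) :=
      (hf.comp (hext r₀ hr₀)).comp (measurable_const.prodMk measurable_id)
    have h := lintegral_gaussianReal_shift_sq_le hv (hδ _ (hAS p)) hfz
    simp only [← add_assoc, add_sub_cancel] at h
    exact h

end Finite

/-! ### Lower bound -/

section LowerBound

variable {α : Type} [MeasurableSpace α] {π : Policy α} {S : Finset α} {v : ℝ≥0}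

/-- In this form the contract after a fixed sequence of past actions no longer refers to the agent
or to the cost, which makes the set of tie-producing cost scales independent of the scale. -/
theorem Policy.history_eq (π : Policy α) (E : Environment α) (ag : Agent α) (ω : ℝ × (ℕ → ℝ))
    (t : ℕ) : π.history E ag ω t =
      fun i : Fin t => (π.action E ag i ω, E.reward (π.action E ag i ω) + ω.2 i) := by
  induction t with
  | zero => exact funext fun i => i.elim0
  | succ t ih =>
    rw [Policy.history_succ]
    funext i
    refine Fin.lastCases ?_ (fun i => ?_) i
    · simp only [Fin.snoc_last, Fin.val_last]
    · simp only [Fin.snoc_castSucc, ih, Fin.val_castSucc]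

/-- The contract that follows the actions `y` when all of `S` is available in each round. -/
noncomputable def Policy.contractAfter (π : Policy α) (S : Finset α) (r : α → ℝ) {t : ℕ}
    (y : Fin t → S) (ω : ℝ × (ℕ → ℝ)) : α → ℝ≥0 :=
  π.contract t (fun _ => (S : Set α)) ω.1 fun i => ((y i : α), r (y i) + ω.2 i)

theorem Policy.measurable_contractAfter (π : Policy α) (S : Finset α) (r : α → ℝ) {t : ℕ}
    (y : Fin t → S) (a : α) : Measurable fun ω => π.contractAfter S r y ω a := by
  refine (π.measurable_contract_apply t (fun _ => (S : Set α)) a).comp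
    (measurable_fst.prodMk (measurable_pi_lambda _ fun i => ?_))
  fun_prop

theorem Policy.posted_eq_contractAfter {c r : α → ℝ} {ag : Agent α} {t : ℕ} {ω : ℝ × (ℕ → ℝ)}
    (h : ∀ s, π.action (gaussianBandit S r c v) ag s ω ∈ S) :
    π.posted (gaussianBandit S r c v) ag t ω =
      π.contractAfter S r (fun i : Fin t => ⟨_, h i⟩) ω := by
  rw [Policy.posted, Policy.history_eq]
  rfl

/-- The cost scales for which a tie between two actions has positive probability. -/
def Policy.tieScales (π : Policy α) (S : Finset α) (r q : α → ℝ) (v : ℝ≥0) : Set ℝ :=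
  {s | ∃ (t : ℕ) (y : Fin t → S) (a b : S),
    0 < (π.seedLaw.prod (Measure.infinitePi fun _ : ℕ => gaussianReal 0 v))
      {ω | ((π.contractAfter S r y ω a : ℝ) - π.contractAfter S r y ω b) / (q a - q b) = s}}

/-- A random variable has at most countably many atoms, and there are countably many rounds, action
sequences and pairs of actions. -/
theorem Policy.countable_tieScales (π : Policy α) (S : Finset α) (r q : α → ℝ) (v : ℝ≥0) :
    (π.tieScales S r q v).Countable := by
  have := π.isProbabilityMeasure_seedLaw
  simp only [Policy.tieScales, Set.ofPred_exists]
  refine Set.countable_iUnion fun t => Set.countable_iUnion fun y => Set.countable_iUnion fun a =>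
    Set.countable_iUnion fun b => Measure.countable_meas_level_set_pos ?_
  exact ((π.measurable_contractAfter S r y a).coe_nnreal_real.sub
    (π.measurable_contractAfter S r y b).coe_nnreal_real).div_const _

/-- If ties have probability zero, then all best-responding agents behave in the same way. -/
theorem Policy.ae_action_eq {r q : α → ℝ} {s : ℝ} (hq : Set.InjOn q S)
    (hs : s ∉ π.tieScales S r q v) {ag ag' : Agent α}
    (h : π.IsBestResponding (gaussianBandit S r (s • q) v) ag)
    (h' : π.IsBestResponding (gaussianBandit S r (s • q) v) ag') :
    ∀ᵐ ω ∂π.law (gaussianBandit S r (s • q) v), ∀ t,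
      π.action (gaussianBandit S r (s • q) v) ag t ω =
        π.action (gaussianBandit S r (s • q) v) ag' t ω := by
  set E := gaussianBandit S r (s • q) v with hE
  have hne : ∀ᵐ ω ∂π.law E, ∀ (t : ℕ) (y : Fin t → S) (a b : S),
      ((π.contractAfter S r y ω a : ℝ) - π.contractAfter S r y ω b) / (q a - q b) ≠ s := by
    simp only [ae_all_iff]
    intro t y a b
    by_contra hcon
    refine hs ⟨t, y, a, b, pos_iff_ne_zero.2 fun h0 => hcon ?_⟩
    rw [ae_iff]
    simp only [ne_eq, not_not]
    exact h0
  filter_upwards [hne] with ω hω t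
  induction t using Nat.strong_induction_on with
  | _ t ih =>
    -- Equal pasts give equal contracts. Two different best responses to one contract would be a tie
    -- at scale `s`, which is excluded.
    have hpost : π.posted E ag t ω = π.posted E ag' t ω := by
      simp only [Policy.posted, Policy.history_eq]
      congr 1
      funext i
      rw [ih i i.2]
    have h1 := h.mem_bestResponses t ω
    have h2 := h'.mem_bestResponses t ω
    have hmem : ∀ n, π.action E ag n ω ∈ S := fun n => (h.mem_bestResponses n ω).1
    rw [← hpost] at h2
    rw [Policy.posted_eq_contractAfter hmem] at h1 h2
    by_contra hab
    have h3 := h1.2 _ h2.1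
    have h4 := h2.2 _ h1.1
    refine hω t (fun i : Fin t => ⟨_, hmem i⟩) ⟨_, h1.1⟩ ⟨_, h2.1⟩
      ((div_eq_iff (sub_ne_zero.2 fun h => hab (hq h1.1 h2.1 h))).2 ?_)
    simp only [hE, gaussianBandit, Pi.smul_apply, smul_eq_mul] at h3 h4 ⊢
    linarith

/-- The regret of a round is at least the loss in welfare, provided that some action is free. -/
theorem Policy.IsBestResponding.le_round_regret {c r : α → ℝ} {ag : Agent α}
    (h : π.IsBestResponding (gaussianBandit S r c v) ag) {a₀ b : α} (ha₀ : a₀ ∈ S) (hc : c a₀ = 0)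
    (hb : b ∈ S) (t : ℕ) (ω : ℝ × (ℕ → ℝ)) :
    (r b - c b) - (r (π.action (gaussianBandit S r c v) ag t ω) -
        c (π.action (gaussianBandit S r c v) ag t ω)) ≤
      (⨆ a : (gaussianBandit S r c v).actionSet t,
        ((gaussianBandit S r c v).reward a - (gaussianBandit S r c v).cost a)) -
      ((gaussianBandit S r c v).reward (π.action (gaussianBandit S r c v) ag t ω) -
        (π.posted (gaussianBandit S r c v) ag t ω
          (π.action (gaussianBandit S r c v) ag t ω) : ℝ)) := by
  -- The free action guarantees the agent nonnegative utility, so the payment covers the cost of his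
  -- action.
  have h1 := (h.mem_bestResponses t ω).2 a₀ ha₀
  have h2 : r b - c b ≤ ⨆ a : (S : Set α), (r a - c a) :=
    le_ciSup (f := fun a : (S : Set α) => r a - c a) (Set.finite_range _).bddAbove ⟨b, hb⟩
  have h3 := (π.posted (gaussianBandit S r c v) ag t ω a₀).2
  simp only [gaussianBandit] at h1 h2 h3 ⊢
  rw [hc] at h1
  have h4 : (0 : ℝ) ≤ (π.posted ⟨fun _ => (S : Set α), r, c, gaussianReal 0 v⟩ ag t ω a₀ : ℝ) := h3
  linarith

theorem Policy.isProbabilityMeasure_law_gaussianBandit (π : Policy α) (S : Finset α)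
    (r c : α → ℝ) (v : ℝ≥0) : IsProbabilityMeasure (π.law (gaussianBandit S r c v)) :=
  have := π.isProbabilityMeasure_seedLaw
  inferInstanceAs (IsProbabilityMeasure (π.seedLaw.prod
    (Measure.infinitePi fun _ : ℕ => gaussianReal 0 v)))

variable [Nonempty α]

/-- The probability that the agent takes `a` in round `t`. -/
noncomputable def Policy.actionProb (π : Policy α) (S : Finset α) (r c : α → ℝ) (v : ℝ≥0) (a : α)
    (t : ℕ) : ℝ :=
  (π.law (gaussianBandit S r c v)).real
    {ω | π.action (gaussianBandit S r c v) (finiteAgent S c 0) t ω = a}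

theorem Policy.actionProb_sq_le [MeasurableSingletonClass α] (hv : v ≠ 0) {r₀ r₁ c : α → ℝ} (hr₀ : Measurable r₀)
    (hr₁ : Measurable r₁) (hS : S.Nonempty) {δ : ℝ} (hδ : ∀ a ∈ S, |r₁ a - r₀ a| ≤ δ) (a : α)
    (t : ℕ) : π.actionProb S r₁ c v a t ^ 2 ≤
      Real.exp (δ ^ 2 / v) ^ t * π.actionProb S r₀ c v a t := by
  have := π.isProbabilityMeasure_seedLaw
  set B : Set (ℝ × (Fin t → α × ℝ)) :=
    {p | finiteAgent S c 0 t (π.contract t (fun _ => (S : Set α)) p.1 p.2) = a} with hB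
  have hBm : MeasurableSet B :=
    (measurable_finiteAgent S c 0 t fun a => π.measurable_contract_apply t _ a)
      (measurableSet_singleton a)
  have h := lintegral_history_sq_le (π := π) (c := c) hv hr₀ hr₁ hS hδ t
    (f := B.indicator 1) (measurable_one.indicator hBm)
  have hind : ∀ r : α → ℝ, Measurable r → ∀ n ≠ 0,
      ∫⁻ ω, B.indicator 1 (ω.1, π.history (gaussianBandit S r c v) (finiteAgent S c 0) ω t) ^ n
        ∂(π.law (gaussianBandit S r c v)) =
      (π.law (gaussianBandit S r c v))
        {ω | π.action (gaussianBandit S r c v) (finiteAgent S c 0) t ω = a} := by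
    intro r hr n hn
    refine Eq.trans ?_ (lintegral_indicator_one (s := π.action (gaussianBandit S r c v)
      (finiteAgent S c 0) t ⁻¹' {a})
      (measurable_action_finiteAgent hr 0 t (measurableSet_singleton a)))
    refine lintegral_congr fun ω => ?_
    have hiff : (ω.1, π.history (gaussianBandit S r c v) (finiteAgent S c 0) ω t) ∈ B ↔
        ω ∈ π.action (gaussianBandit S r c v) (finiteAgent S c 0) t ⁻¹' {a} := Iff.rfl
    by_cases hω : ω ∈ π.action (gaussianBandit S r c v) (finiteAgent S c 0) t ⁻¹' {a}
    · rw [Set.indicator_of_mem (hiff.2 hω), Set.indicator_of_mem hω]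
      simp
    · rw [Set.indicator_of_notMem (fun h => hω (hiff.1 h)), Set.indicator_of_notMem hω]
      simp [hn]
  have h1 := hind r₁ hr₁ 1 one_ne_zero
  simp only [pow_one] at h1
  rw [h1, hind r₀ hr₀ 2 two_ne_zero] at h
  have := π.isProbabilityMeasure_law_gaussianBandit S r₀ c v
  have h2 := ENNReal.toReal_mono (ENNReal.mul_ne_top (by simp) (measure_ne_top _ _)) h
  simpa [Policy.actionProb, Measure.real, ENNReal.toReal_pow, ENNReal.toReal_mul,
    ENNReal.toReal_ofReal (Real.exp_pos _).le] using h2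

/-- If the actions in `B` lose at least `ε` compared to some other action, and no action gains, then
the expected regret is at least `ε` times the expected number of rounds with an action in `B`. -/
theorem Policy.le_integral_regret {r q : α → ℝ} {s : ℝ} (hr : Measurable r) (hq : Set.InjOn q S)
    (hs : s ∉ π.tieScales S r q v) {ag : Agent α}
    (h : π.IsBestResponding (gaussianBandit S r (s • q) v) ag) {a₀ b : α} (ha₀ : a₀ ∈ S)
    (hc : q a₀ = 0) (hb : b ∈ S) {B : Set α} (hB : MeasurableSet B) {ε : ℝ}
    (hle : ∀ a ∈ S, B.indicator (fun _ => ε) a ≤ (r b - s * q b) - (r a - s * q a)) {T : ℕ}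
    (hint : Integrable (π.regret (gaussianBandit S r (s • q) v) ag T)
      (π.law (gaussianBandit S r (s • q) v))) :
    ε * ∑ t ∈ Finset.range T, (π.law (gaussianBandit S r (s • q) v)).real
        {ω | π.action (gaussianBandit S r (s • q) v) (finiteAgent S (s • q) 0) t ω ∈ B} ≤
      ∫ ω, π.regret (gaussianBandit S r (s • q) v) ag T ω
        ∂(π.law (gaussianBandit S r (s • q) v)) := by
  have hcan : π.IsBestResponding (gaussianBandit S r (s • q) v) (finiteAgent S (s • q) 0) :=
    isBestResponding_finiteAgent ⟨a₀, ha₀⟩ hr 0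
  have hae := Policy.ae_action_eq hq hs h hcan
  set E := gaussianBandit S r (s • q) v with hE
  have : IsProbabilityMeasure (π.law E) := π.isProbabilityMeasure_law_gaussianBandit S r (s • q) v
  have hm : ∀ t, MeasurableSet {ω | π.action E (finiteAgent S (s • q) 0) t ω ∈ B} := fun t =>
    hcan.measurable_action t hB
  have hi : ∀ t ∈ Finset.range T, Integrable
      ({ω | π.action E (finiteAgent S (s • q) 0) t ω ∈ B}.indicator fun _ => ε) (π.law E) :=
    fun t _ => (integrable_const ε).indicator (hm t)
  have hsum : ε * ∑ t ∈ Finset.range T,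
      (π.law E).real {ω | π.action E (finiteAgent S (s • q) 0) t ω ∈ B} =
      ∫ ω, ∑ t ∈ Finset.range T,
        {ω | π.action E (finiteAgent S (s • q) 0) t ω ∈ B}.indicator (fun _ => ε) ω
          ∂(π.law E) := by
    rw [integral_finsetSum _ hi, Finset.mul_sum]
    refine Finset.sum_congr rfl fun t _ => ?_
    rw [integral_indicator_const _ (hm t), smul_eq_mul, mul_comm]
  rw [hsum]
  refine integral_mono_ae (integrable_finsetSum _ hi) hint ?_
  filter_upwards [hae] with ω hω
  refine Finset.sum_le_sum fun t _ => le_trans ?_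
    (h.le_round_regret ha₀ (by simp [hc]) hb t ω)
  have h1 := hle _ (h.mem_bestResponses t ω).1
  rw [hω t] at h1
  rw [← hE, hω t]
  exact h1

end LowerBound

/-! ### The two-point argument -/

section LowerBound

variable {α : Type} [MeasurableSpace α] {π : Policy α} {S : Finset α} [Nonempty α]
  [MeasurableSingletonClass α]

/-- In one world avoiding `a₁` is wrong, in the other taking it is wrong. The two error frequencies
add up to a constant fraction of the rounds, so in one of the worlds the regret is at least half of
the total. -/
theorem Policy.exists_expectedRegretGE {σ : ℝ≥0} (hσ : 0 < σ) {w q : α → ℝ} (hw : Measurable w)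
    (hq : Set.InjOn q S) (hq₀ : ∀ a ∈ S, 0 ≤ q a) {a₀ a₁ : α} (ha₀ : a₀ ∈ S) (ha₁ : a₁ ∈ S)
    (hqa₀ : q a₀ = 0) (hqa₁ : q a₁ = 1) (hwa₁ : w a₁ = 1) (hwa : ∀ a ∈ S, a ≠ a₁ → w a = 0)
    {T : ℕ} (hT : 1 ≤ T) :
    ∃ u ∈ Set.Icc (0 : ℝ) 1, ∃ s ∈ Set.Icc (0 : ℝ) 1,
      π.ExpectedRegretGE (gaussianBandit S (u • w) (s • q) (σ ^ 2)) T
        (min (σ : ℝ) (1 / 2) / 24 * √(T : ℝ)) := by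
  have hσ' : (0 : ℝ) < σ := hσ
  have hT' : (1 : ℝ) ≤ T := by exact_mod_cast hT
  have hsqrt : (1 : ℝ) ≤ √(T : ℝ) := Real.one_le_sqrt.2 hT'
  have hsq : √(T : ℝ) ^ 2 = T := Real.sq_sqrt (by linarith)
  -- `m ≤ σ` keeps the information of `T` rounds bounded, and `m ≤ 1 / 2` keeps the reward and cost
  -- scales within `[0, 1]`.
  set m : ℝ := min (σ : ℝ) (1 / 2) with hm
  have hm0 : 0 < m := lt_min hσ' (by norm_num)
  have hmσ : m ≤ σ := min_le_left _ _
  have hm2 : m ≤ 1 / 2 := min_le_right _ _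
  set δ : ℝ := m / √(T : ℝ) with hδ
  have hδ0 : 0 < δ := div_pos hm0 (by linarith)
  have hδ2 : δ ≤ 1 / 2 := (div_le_self hm0.le hsqrt).trans hm2
  have hδT : δ * T = m * √(T : ℝ) := by
    calc δ * T = m / √(T : ℝ) * √(T : ℝ) ^ 2 := by rw [hsq]
      _ = m * √(T : ℝ) := by field_simp
  have hδsq : δ ^ 2 * T ≤ (σ : ℝ) ^ 2 := by
    have h : δ ^ 2 * T = m ^ 2 := by
      rw [hδ, div_pow, hsq]
      field_simp
    rw [h]
    exact pow_le_pow_left₀ hm0.le hmσ 2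
  have hv : σ ^ 2 ≠ 0 := pow_ne_zero 2 hσ.ne'
  have hne : a₀ ≠ a₁ := by
    rintro rfl
    rw [hqa₀] at hqa₁
    exact zero_ne_one hqa₁
  -- The cost scale lies in the middle third between the two reward scales, so a wrong decision
  -- loses at least `δ / 3` in either world. It also avoids the countably many scales with ties in
  -- either world.
  obtain ⟨s, hs, hs1, hs2⟩ := (((π.countable_tieScales S ((1 / 2 + δ) • w) q (σ ^ 2)).union
    (π.countable_tieScales S ((1 / 2 : ℝ) • w) q (σ ^ 2))).dense_compl ℝ).exists_between
      (show 1 / 2 + δ / 3 < 1 / 2 + 2 * δ / 3 by linarith)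
  rw [Set.mem_compl_iff, Set.mem_union, not_or] at hs
  have hsI : s ∈ Set.Icc (0 : ℝ) 1 := ⟨by linarith, by linarith⟩
  have hex : ∀ u : ℝ, ∃ ag : Agent α,
      π.IsBestResponding (gaussianBandit S (u • w) (s • q) (σ ^ 2)) ag ∧
        π.TiesFavorPrincipal (gaussianBandit S (u • w) (s • q) (σ ^ 2)) ag := fun u =>
    exists_agent_gaussianBandit ⟨a₀, ha₀⟩ (hw.const_smul u)
  set p : ℕ → ℝ := π.actionProb S ((1 / 2 + δ) • w) (s • q) (σ ^ 2) a₁ with hp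
  set p' : ℕ → ℝ := π.actionProb S ((1 / 2 : ℝ) • w) (s • q) (σ ^ 2) a₁ with hp'
  have hp1 : ∀ t, p t ≤ 1 := fun t =>
    have := π.isProbabilityMeasure_law_gaussianBandit S ((1 / 2 + δ) • w) (s • q) (σ ^ 2)
    measureReal_le_one
  have hpp' : ∀ t ∈ Finset.range T, p t ^ 2 ≤ 4 * p' t := by
    intro t ht
    have hclose : ∀ a ∈ S, |((1 / 2 + δ) • w) a - ((1 / 2 : ℝ) • w) a| ≤ δ := by
      intro a ha
      simp only [Pi.smul_apply, smul_eq_mul]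
      have h : (1 / 2 + δ) * w a - 1 / 2 * w a = δ * w a := by ring
      rw [h, abs_mul, abs_of_pos hδ0]
      by_cases haa : a = a₁
      · simp [haa, hwa₁]
      · simp [hwa a ha haa, hδ0.le]
    have h := π.actionProb_sq_le (c := s • q) hv (hw.const_smul (1 / 2 : ℝ))
      (hw.const_smul (1 / 2 + δ)) ⟨a₀, ha₀⟩ hclose a₁ t
    refine h.trans (mul_le_mul_of_nonneg_right ?_ measureReal_nonneg)
    rw [← Real.exp_nat_mul]
    -- The accumulated likelihood factor is thus at most `e < 4`.
    have h1 : (t : ℝ) * (δ ^ 2 / ((σ ^ 2 : ℝ≥0) : ℝ)) ≤ 1 := by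
      have h2 : (t : ℝ) ≤ T := by exact_mod_cast (Finset.mem_range.1 ht).le
      push_cast
      rw [← mul_div_assoc, div_le_one (by positivity)]
      exact (mul_le_mul_of_nonneg_right h2 (sq_nonneg δ)).trans (by linarith)
    exact (Real.exp_le_exp.2 h1).trans (by linarith [Real.exp_one_lt_d9])
  have hsum : δ * T / 12 ≤ δ / 3 * (∑ t ∈ Finset.range T, (1 - p t)) +
      δ / 3 * ∑ t ∈ Finset.range T, p' t := by
    rw [← mul_add, ← Finset.sum_add_distrib]
    -- By `p² ≤ 4 p'` and `p ≤ 1`, one has `1 - p + p' ≥ (1 - p / 2)² ≥ 1 / 4`.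
    have h : ∑ _t ∈ Finset.range T, (1 / 4 : ℝ) ≤ ∑ t ∈ Finset.range T, (1 - p t + p' t) :=
      Finset.sum_le_sum fun t ht => by
        nlinarith [hpp' t ht, hp1 t]
    rw [Finset.sum_const, Finset.card_range, nsmul_eq_mul] at h
    linarith [mul_le_mul_of_nonneg_left h (by positivity : 0 ≤ δ / 3)]
  rcases le_or_gt (δ * T / 24) (δ / 3 * ∑ t ∈ Finset.range T, (1 - p t)) with hcase | hcase
  · refine ⟨1 / 2 + δ, ⟨by linarith, by linarith⟩, s, hsI, hex _, fun ag hag hint => ?_⟩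
    have h := Policy.le_integral_regret (hw.const_smul (1 / 2 + δ)) hq hs.1 hag ha₀ hqa₀ ha₁
      (measurableSet_singleton a₁).compl (ε := δ / 3) (fun a ha => ?_) hint
    · refine le_trans ?_ h
      have hcompl : ∀ t ∈ Finset.range T,
          (π.law (gaussianBandit S ((1 / 2 + δ) • w) (s • q) (σ ^ 2))).real
            {ω | π.action (gaussianBandit S ((1 / 2 + δ) • w) (s • q) (σ ^ 2))
              (finiteAgent S (s • q) 0) t ω ∈ ({a₁} : Set α)ᶜ} = 1 - p t := by
        intro t _
        have := π.isProbabilityMeasure_law_gaussianBandit S ((1 / 2 + δ) • w) (s • q) (σ ^ 2)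
        exact probReal_compl_eq_one_sub (measurable_action_finiteAgent
          (hw.const_smul (1 / 2 + δ)) 0 t (measurableSet_singleton a₁))
      rw [Finset.sum_congr rfl hcompl]
      linarith
    · simp only [Pi.smul_apply, smul_eq_mul, hqa₁, hwa₁]
      by_cases haa : a = a₁
      · simp [haa, hqa₁, hwa₁]
      · rw [Set.indicator_of_mem (by simpa using haa), hwa a ha haa]
        have := mul_nonneg hsI.1 (hq₀ a ha)
        linarith
  · refine ⟨1 / 2, ⟨by norm_num, by norm_num⟩, s, hsI, hex _, fun ag hag hint => ?_⟩
    have h := Policy.le_integral_regret (hw.const_smul (1 / 2 : ℝ)) hq hs.2 hag ha₀ hqa₀ ha₀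
      (measurableSet_singleton a₁) (ε := δ / 3) (fun a ha => ?_) hint
    · refine le_trans ?_ h
      have hsame : ∀ t ∈ Finset.range T,
          (π.law (gaussianBandit S ((1 / 2 : ℝ) • w) (s • q) (σ ^ 2))).real
            {ω | π.action (gaussianBandit S ((1 / 2 : ℝ) • w) (s • q) (σ ^ 2))
              (finiteAgent S (s • q) 0) t ω ∈ ({a₁} : Set α)} = p' t := fun t _ => rfl
      rw [Finset.sum_congr rfl hsame]
      linarith
    · simp only [Pi.smul_apply, smul_eq_mul, hqa₀, hwa a₀ ha₀ hne]
      by_cases haa : a = a₁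
      · rw [haa, Set.indicator_of_mem (Set.mem_singleton a₁), hqa₁, hwa₁]
        linarith
      · rw [Set.indicator_of_notMem (by simpa using haa), hwa a ha haa]
        have := mul_nonneg hsI.1 (hq₀ a ha)
        linarith

end LowerBound

/-! ### The hard instances and the main theorem -/

theorem multiArmedBandit_lower (N : ℕ) (σ : ℝ≥0) (hN : 2 ≤ N) (hσ : 0 < σ) :
    ∃ c : ℝ, 0 < c ∧ ∀ T : ℕ, 1 ≤ T → ∀ π : Policy (Fin N),
      ∃ E : Environment (Fin N), IsMultiArmedBandit N σ E ∧
        π.ExpectedRegretGE E T (c * √(T : ℝ)) := by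
  have hσ' : (0 : ℝ) < σ := hσ
  refine ⟨min (σ : ℝ) (1 / 2) / 24, by positivity, fun T hT π => ?_⟩
  have : Nonempty (Fin N) := ⟨⟨0, by omega⟩⟩
  set w : Fin N → ℝ := fun i => if (i : ℕ) = 1 then 1 else 0 with hw
  -- Distinct costs are needed to exclude ties. The default value `0⁻¹ = 0` makes arm `0` free, and
  -- arm `1` has cost scale one.
  set q : Fin N → ℝ := fun i => ((i : ℕ) : ℝ)⁻¹ with hq
  have hq01 : ∀ i, q i ∈ Set.Icc (0 : ℝ) 1 := fun i =>
    ⟨by positivity, Nat.cast_inv_le_one _⟩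
  have hw01 : ∀ i, w i ∈ Set.Icc (0 : ℝ) 1 := fun i => by
    simp only [hw]
    split_ifs <;> norm_num
  obtain ⟨u, hu, s, hs, h⟩ := π.exists_expectedRegretGE (S := Finset.univ) hσ (w := w) (q := q)
    (measurable_of_finite w)
    (fun i _ j _ hij => Fin.ext (Nat.cast_injective (inv_injective hij))) (fun i _ => (hq01 i).1)
    (a₀ := ⟨0, by omega⟩) (a₁ := ⟨1, by omega⟩) (Finset.mem_univ _) (Finset.mem_univ _)
    (by simp [hq]) (by simp [hq]) (by simp [hw])
    (fun a _ ha => if_neg fun h => ha (Fin.ext h)) hT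
  exact ⟨_, ⟨fun t => Finset.coe_univ,
    fun i => ⟨mul_nonneg hu.1 (hw01 i).1, mul_le_one₀ hu.2 (hw01 i).1 (hw01 i).2⟩,
    fun i => ⟨mul_nonneg hs.1 (hq01 i).1, mul_le_one₀ hs.2 (hq01 i).1 (hq01 i).2⟩,
    isSubgaussianNoise_gaussianReal σ⟩, h⟩

theorem linearBandit_lower (d : ℕ) (σ : ℝ≥0) (hd : 1 ≤ d) (hσ : 0 < σ) :
    ∃ c : ℝ, 0 < c ∧ ∀ T : ℕ, 1 ≤ T → ∀ π : Policy (EuclideanSpace ℝ (Fin d)),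
      ∃ E : Environment (EuclideanSpace ℝ (Fin d)), IsLinearBandit d σ E ∧
        π.ExpectedRegretGE E T (c * √(T : ℝ)) := by
  classical
  have hσ' : (0 : ℝ) < σ := hσ
  refine ⟨min (σ : ℝ) (1 / 2) / 24, by positivity, fun T hT π => ?_⟩
  -- Two actions suffice in every dimension: the free action `0` and a unit vector `e`, with reward
  -- and cost parameters both multiples of `e`.
  set e : EuclideanSpace ℝ (Fin d) := EuclideanSpace.single ⟨0, hd⟩ 1 with he
  have hnorm : ‖e‖ = 1 := by simp [he]
  set w : EuclideanSpace ℝ (Fin d) → ℝ := fun a => inner ℝ a e with hw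
  have hw1 : w e = 1 := by simp [hw, hnorm]
  have hw0 : w 0 = 0 := inner_zero_left _
  have hmem : ∀ a ∈ ({0, e} : Finset (EuclideanSpace ℝ (Fin d))), a = 0 ∨ a = e := by simp
  have hw01 : ∀ a ∈ ({0, e} : Finset (EuclideanSpace ℝ (Fin d))), w a ∈ Set.Icc (0 : ℝ) 1 := by
    intro a ha
    rcases hmem a ha with rfl | rfl
    · simp [hw0]
    · simp [hw1]
  have hinj : Set.InjOn w ({0, e} : Finset (EuclideanSpace ℝ (Fin d))) := by
    intro a ha b hb hab
    rcases hmem a ha with rfl | rfl <;> rcases hmem b hb with rfl | rfl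
    · rfl
    · simp [hw0, hw1] at hab
    · simp [hw0, hw1] at hab
    · rfl
  obtain ⟨u, hu, s, hs, h⟩ := π.exists_expectedRegretGE (S := {0, e}) hσ (w := w) (q := w)
    (by fun_prop) hinj (fun a ha => (hw01 a ha).1) (a₀ := 0) (a₁ := e) (by simp) (by simp)
    hw0 hw1 hw1 (fun a ha hne => by
      rcases hmem a ha with rfl | rfl
      · exact hw0
      · exact absurd rfl hne) hT
  have hscale : ∀ x ∈ Set.Icc (0 : ℝ) 1, ‖x • e‖ ≤ 1 ∧
      (x • w = fun a => inner ℝ a (x • e)) ∧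
      ∀ a ∈ ({0, e} : Finset _), (x • w) a ∈ Set.Icc (0 : ℝ) 1 := by
    intro x hx
    refine ⟨?_, ?_, fun a ha => ⟨mul_nonneg hx.1 (hw01 a ha).1,
      mul_le_one₀ hx.2 (hw01 a ha).1 (hw01 a ha).2⟩⟩
    · rw [norm_smul, hnorm, mul_one, Real.norm_of_nonneg hx.1]
      exact hx.2
    · funext a
      simp [hw, inner_smul_right]
  have hd' : (1 : ℝ) ≤ √(d : ℝ) := Real.one_le_sqrt.2 (by exact_mod_cast hd)
  exact ⟨_, ⟨⟨u • e, s • e, (hscale u hu).1, (hscale s hs).1, (hscale u hu).2.1,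
      (hscale s hs).2.1⟩,
    fun t => ⟨0, by simp [gaussianBandit]⟩,
    fun t => (Finset.finite_toSet _).isCompact,
    fun t a ha => by
      rcases hmem a ha with rfl | rfl
      · simp
      · rw [hnorm]
        exact hd',
    fun t a ha => (hscale u hu).2.2 a ha,
    fun t a ha => (hscale s hs).2.2 a ha,
    isSubgaussianNoise_gaussianReal σ⟩, h⟩

theorem mainTheorem3 :
    ∃ k : ℕ,
      -- multi-armed bandits: upper bound, lower bound
      ((∀ (N : ℕ) (σ : ℝ≥0), 1 ≤ N → 0 < σ →
          ∃ C : ℝ, ∀ T : ℕ, 1 ≤ T → ∃ π : Policy (Fin N),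
            ∀ E : Environment (Fin N), IsMultiArmedBandit N σ E →
              π.ExpectedRegretLE E T (C * √(T : ℝ) * (1 + Real.log T) ^ k)) ∧
        (∀ (N : ℕ) (σ : ℝ≥0), 2 ≤ N → 0 < σ →
          ∃ c : ℝ, 0 < c ∧ ∀ T : ℕ, 1 ≤ T → ∀ π : Policy (Fin N),
            ∃ E : Environment (Fin N), IsMultiArmedBandit N σ E ∧
              π.ExpectedRegretGE E T (c * √(T : ℝ)))) ∧
      -- linear bandits: upper bound, lower bound
      ((∀ (d : ℕ) (σ : ℝ≥0), 1 ≤ d → 0 < σ →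
          ∃ C : ℝ, ∀ T : ℕ, 1 ≤ T → ∃ π : Policy (EuclideanSpace ℝ (Fin d)),
            ∀ E : Environment (EuclideanSpace ℝ (Fin d)), IsLinearBandit d σ E →
              π.ExpectedRegretLE E T (C * √(T : ℝ) * (1 + Real.log T) ^ k)) ∧
        (∀ (d : ℕ) (σ : ℝ≥0), 1 ≤ d → 0 < σ →
          ∃ c : ℝ, 0 < c ∧ ∀ T : ℕ, 1 ≤ T → ∀ π : Policy (EuclideanSpace ℝ (Fin d)),
            ∃ E : Environment (EuclideanSpace ℝ (Fin d)), IsLinearBandit d σ E ∧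
              π.ExpectedRegretGE E T (c * √(T : ℝ)))) :=
  ⟨1, ⟨multiArmedBandit_upper, multiArmedBandit_lower⟩, linearBandit_upper, linearBandit_lower⟩
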